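/- **Setting.** Let $\mathbb X,\mathbb A$ be measurable spaces, $\xi$ a probability measure on $\mathbb X$, $\lambda$ a $\sigma$-finite base measure on $\mathbb A$, $\pi(s,\cdot)$ a known probability density with respect to $\lambda$ for each $s\in\mathbb X$, and $g:\mathbb X\times\mathbb A\to\mathbb R$ a known weight function with $g=0$ ($\xi\otimes\lambda$-a.e.) where $\pi=0$. Observe $n=2m\ge 2$ i.i.d. triples $(X_i,A_i,Y_i)$ with $X_i\sim\xi$, $A_i\mid X_i\sim\pi(X_i,\cdot)$, $\mathbb E[Y_i\mid X_i,A_i]=\mu^*(X_i,A_i)$ and conditional variance $\sigma^2(s,a)=\mathrm{Var}(Y\mid X=s,A=a)<\infty$. Let $\langle h_1,h_2\rangle_\lambda=\int h_1h_2\,d\lambda$ and $$\tau^*=\int_{\mathbb A}\mathbb E_\xi[g(X,a)\mu^*(X,a)]\,d\lambda(a),\qquad \|h\|_\omega^2=\int_{\mathbb A}\mathbb E_\xi\Big[\tfrac{g^2(X,a)}{\pi(X,a)}h^2(X,a)\Big]d\lambda(a),$$ $$v_*^2=\mathrm{Var}_\xi\big(\langle g(X,\cdot),\mu^*(X,\cdot)\rangle_\lambda\big)+\|\sigma\|_\omega^2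 .$$ **Function class and estimator.** Let $d\ge 2$, let $\phi=(\phi_1,\dots,\phi_d)$ be measurable functions on $\mathbb X\times\mathbb A$, $R_1>0$, and $\mathcal F=\{\langle\theta,\phi\rangle:\|\theta\|_1\le R_1\}$. Split the sample into its first half $\mathcal B_1$ and its second half $\mathcal B_2$; for $j=1,2$ let $\widehat\mu^{(j)}$ be a (measurable) weighted least-squares estimate $$\widehat\mu^{(j)}\in\arg\min_{\mu\in\mathcal F}\frac1m\sum_{i\in\mathcal B_j}\frac{g^2(X_i,A_i)}{\pi^2(X_i,A_i)}\{\mu(X_i,A_i)-Y_i\}^2,$$ put $\widehat f^{(j)}(s,a)=\frac{g(s,a)}{\pi(s,a)}\widehat\mu^{(j)}(s,a)-\langle g(s,\cdot),\widehat\mu^{(j)}(s,\cdot)\rangle_\lambda$, and $$\widehat\tau_n=\frac1n\sum_{i\in\mathcal B_1}\Big\{\frac{g(X_i,A_i)}{\pi(X_i,A_i)}Y_i-\widehat f^{(2)}(X_i,A_i)\Big\}+\frac1n\sum_{i\in\mathcal B_2}\Big\{\frac{g(X_i,A_i)}{\pi(X_i,A_i)}Y_i-\widehat f^{(1)}(X_i,A_i)\Big\}.$$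 **Assumptions.** (a) Small-ball condition: for some $\alpha_1,\alpha_2>0$, $\mathbb P\big[|\tfrac{g(X,A)}{\pi(X,A)}h(X,A)|\ge\alpha_1\|h\|_\omega\big]\ge\alpha_2$ for all $h\in\{f_1-f_2: f_1,f_2\in\mathcal F\}$. (b) Moment bounds: for some $\bar\sigma,\nu>0$ and all integers $\ell\ge1$, $$\mathbb E\Big|\tfrac{g(X,A)}{\pi(X,A)}(Y-\mu^*(X,A))\Big|^\ell\le(\bar\sigma\sqrt\ell)^\ell,\qquad \max_{j\le d}\mathbb E\Big|\tfrac{g(X,A)}{\pi(X,A)}\phi_j(X,A)\Big|^\ell\le(\nu\sqrt\ell)^\ell .$$ (c) The matrix $\Sigma=\mathbb E\big[\tfrac{g^2(X,A)}{\pi^2(X,A)}\phi(X,A)\phi(X,A)^\top\big]$ has smallest eigenvalue $\lambda_{\min}(\Sigma)>0$; $\lambda_{\max}(\Sigma)$ denotes its largest eigenvalue. **Claim.** There are constants $c_0,c>0$ depending only on $(\alpha_1,\alpha_2)$ such that, for every $k\in\{1,\dots,d\}$ and every even $n\ge2$ with $$n\ \ge\ c_0\Big\{\frac{\nu^2k\log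 d}{\lambda_{\min}(\Sigma)}+\log^2 d+\log\Big(\frac{R_1\lambda_{\max}(\Sigma)}{\bar\sigma\nu}\Big)\Big\},$$ one has $$\mathbb E\big[|\widehat\tau_n-\tau^*|^2\big]\le\frac{v_*^2}{n}+\frac cn\inf_{\substack{\|\bar\theta\|_1=R_1\\ \|\bar\theta\|_0\le k}}\Big\{\|\mu^*-\langle\bar\theta,\phi\rangle\|_\omega^2+\frac{\bar\sigma^2\|\bar\theta\|_0\log d}{n}\cdot\frac{\nu^2}{\lambda_{\min}(\Sigma)}\Big\}.$$ -/

import Mathlib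

open MeasureTheory ProbabilityTheory
open scoped ENNReal

noncomputable section

namespace OffPolicy

/-- The observational model: contexts `x ∼ ξ`, actions `a` with conditional density `π (x, ·)`
with respect to the base measure `lam`, outcomes `y ∼ κ (x, a)` with finite conditional second
moment, and the known weight function `g`, which vanishes (a.e.) where `π` does. -/
structure Model (𝕏 𝔸 : Type*) [MeasurableSpace 𝕏] [MeasurableSpace 𝔸] where
  ξ : Measure 𝕏
  prob_ξ : IsProbabilityMeasure ξ
  lam : Measure 𝔸
  sigmaFinite_lam : SigmaFinite lam
  π : 𝕏 × 𝔸 → ℝ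
  measurable_π : Measurable π
  π_nonneg : ∀ p, 0 ≤ π p
  lintegral_π : ∀ x, ∫⁻ a, ENNReal.ofReal (π (x, a)) ∂lam = 1
  g : 𝕏 × 𝔸 → ℝ
  measurable_g : Measurable g
  overlap : ∀ᵐ p ∂(ξ.prod lam), π p = 0 → g p = 0
  κ : Kernel (𝕏 × 𝔸) ℝ
  markov_κ : IsMarkovKernel κ
  memLp_κ : ∀ p, MemLp id 2 (κ p)

namespace Model

variable {𝕏 𝔸 : Type*} [MeasurableSpace 𝕏] [MeasurableSpace 𝔸] (M : Model 𝕏 𝔸)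

/-- The treatment effect `μ⋆ (x, a) = 𝔼[Y ∣ x, a]`. -/
def muStar (p : 𝕏 × 𝔸) : ℝ := ∫ y, y ∂(M.κ p)

/-- The conditional variance `σ² (x, a)` of the outcome. -/
def condVar (p : 𝕏 × 𝔸) : ℝ := variance id (M.κ p)

/-- The importance ratio `g / π`. -/
def ratio (p : 𝕏 × 𝔸) : ℝ := M.g p / M.π p

/-- The law of a context-action pair `(X, A)`. -/
def pairLaw : Measure (𝕏 × 𝔸) :=
  (M.ξ.prod M.lam).withDensity fun p => ENNReal.ofReal (M.π p)

/-- The law of one observation `((X, A), Y)`. -/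
def dataLaw : Measure ((𝕏 × 𝔸) × ℝ) := M.pairLaw ⊗ₘ M.κ

/-- The law of `n` i.i.d. observations. -/
def sampleLaw (n : ℕ) : Measure (Fin n → (𝕏 × 𝔸) × ℝ) := Measure.pi fun _ => M.dataLaw

/-- The target functional `τ⋆ = ∫ 𝔼_ξ[g(X, a) μ⋆(X, a)] dλ(a)`. -/
def tauStar : ℝ := ∫ p, M.g p * M.muStar p ∂(M.ξ.prod M.lam)

/-- The squared weighted norm `‖h‖_ω² = ∫ 𝔼_ξ[(g²/π)(X, a) h²(X, a)] dλ(a)`. -/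
def wNormSq (h : 𝕏 × 𝔸 → ℝ) : ℝ≥0∞ :=
  ∫⁻ p, ENNReal.ofReal (M.g p ^ 2 / M.π p * h p ^ 2) ∂(M.ξ.prod M.lam)

/-- The weighted norm `‖h‖_ω`. -/
def wNorm (h : 𝕏 × 𝔸 → ℝ) : ℝ≥0∞ := M.wNormSq h ^ (1 / 2 : ℝ)

/-- The semi-parametric efficient variance `v_⋆²`. -/
def vStarSq : ℝ≥0∞ :=
  evariance (fun x => ∫ a, M.g (x, a) * M.muStar (x, a) ∂M.lam) M.ξ +
    ∫⁻ p, ENNReal.ofReal (M.g p ^ 2 / M.π p * M.condVar p) ∂(M.ξ.prod M.lam)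

/-- The small-ball condition with parameters `(α₁, α₂)` for the differences of members of `F`. -/
def SmallBall (F : Set (𝕏 × 𝔸 → ℝ)) (α₁ α₂ : ℝ) : Prop :=
  ∀ f₁ ∈ F, ∀ f₂ ∈ F, ENNReal.ofReal α₂ ≤
    M.pairLaw {p | ENNReal.ofReal α₁ * M.wNorm (f₁ - f₂) ≤
      ENNReal.ofReal |M.ratio p * (f₁ - f₂) p|}

/-- The weighted least-squares objective. -/
def wlsLoss {m : ℕ} (D : Fin m → (𝕏 × 𝔸) × ℝ) (μ : 𝕏 × 𝔸 → ℝ) : ℝ :=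
  (1 / m : ℝ) * ∑ i, M.ratio (D i).1 ^ 2 * (μ (D i).1 - (D i).2) ^ 2

/-- `μhat` is a (jointly measurable) weighted least-squares estimator over the class `F`,
based on `m` observations. -/
structure IsWLSEstimator (F : Set (𝕏 × 𝔸 → ℝ)) (m : ℕ)
    (μhat : (Fin m → (𝕏 × 𝔸) × ℝ) → 𝕏 × 𝔸 → ℝ) : Prop where
  measurable : Measurable fun q : (Fin m → (𝕏 × 𝔸) × ℝ) × (𝕏 × 𝔸) => μhat q.1 q.2
  mem : ∀ D, μhat D ∈ F
  minimizes : ∀ D, ∀ μ ∈ F, M.wlsLoss D (μhat D) ≤ M.wlsLoss D μ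

/-- The auxiliary function `f = g μ / π - ⟨g(x, ·), μ(x, ·)⟩_λ`. -/
def aux (μ : 𝕏 × 𝔸 → ℝ) (p : 𝕏 × 𝔸) : ℝ :=
  M.ratio p * μ p - ∫ a, M.g (p.1, a) * μ (p.1, a) ∂M.lam

/-- The cross-fitted two-stage estimator based on `n = m + m` observations: each half of the
sample is corrected by the auxiliary function that is fitted on the other half. -/
def tauHat {m : ℕ} (μhat₁ μhat₂ : (Fin m → (𝕏 × 𝔸) × ℝ) → 𝕏 × 𝔸 → ℝ)
    (D : Fin (m + m) → (𝕏 × 𝔸) × ℝ) : ℝ :=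
  let B₁ : Fin m → (𝕏 × 𝔸) × ℝ := fun i => D (Fin.castAdd m i)
  let B₂ : Fin m → (𝕏 × 𝔸) × ℝ := fun i => D (Fin.natAdd m i)
  (1 / (m + m : ℕ) : ℝ) *
      ∑ i, (M.ratio (B₁ i).1 * (B₁ i).2 - M.aux (μhat₂ B₂) (B₁ i).1) +
    (1 / (m + m : ℕ) : ℝ) *
      ∑ i, (M.ratio (B₂ i).1 * (B₂ i).2 - M.aux (μhat₁ B₁) (B₂ i).1)

/-- The mean-squared error of the two-stage estimator. -/
def mse {m : ℕ} (μhat₁ μhat₂ : (Fin m → (𝕏 × 𝔸) × ℝ) → 𝕏 × 𝔸 → ℝ) : ℝ≥0∞ :=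
  ∫⁻ D, ENNReal.ofReal ((M.tauHat μhat₁ μhat₂ D - M.tauStar) ^ 2) ∂(M.sampleLaw (m + m))

/-- The weighted second moment matrix `Σ = 𝔼[(g²/π²)(X, A) φ(X, A) φ(X, A)ᵀ]`. -/
def momentMatrix {d : ℕ} (φ : Fin d → 𝕏 × 𝔸 → ℝ) : Matrix (Fin d) (Fin d) ℝ :=
  Matrix.of fun i j => ∫ p, M.ratio p ^ 2 * (φ i p * φ j p) ∂M.pairLaw

theorem momentMatrix_isHermitian {d : ℕ} (φ : Fin d → 𝕏 × 𝔸 → ℝ) :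
    (M.momentMatrix φ).IsHermitian := by
  ext i j
  simp [momentMatrix, mul_comm (φ i _)]

/-- The smallest eigenvalue of `Σ`. -/
def lamMin {d : ℕ} (φ : Fin d → 𝕏 × 𝔸 → ℝ) : ℝ :=
  ⨅ i, (M.momentMatrix_isHermitian φ).eigenvalues i

/-- The largest eigenvalue of `Σ`. -/
def lamMax {d : ℕ} (φ : Fin d → 𝕏 × 𝔸 → ℝ) : ℝ :=
  ⨆ i, (M.momentMatrix_isHermitian φ).eigenvalues i

/-- The sub-Gaussian moment bound on the weighted outcome noise. -/
def NoiseMoments (sbar : ℝ) : Prop :=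
  ∀ l : ℕ, 1 ≤ l →
    ∫⁻ z, ENNReal.ofReal (|M.ratio z.1 * (z.2 - M.muStar z.1)| ^ l) ∂M.dataLaw ≤
      ENNReal.ofReal ((sbar * √(l : ℝ)) ^ l)

/-- The sub-Gaussian moment bound on the weighted basis functions. -/
def FeatureMoments {d : ℕ} (φ : Fin d → 𝕏 × 𝔸 → ℝ) (ν : ℝ) : Prop :=
  ∀ j, ∀ l : ℕ, 1 ≤ l →
    ∫⁻ p, ENNReal.ofReal (|M.ratio p * φ j p| ^ l) ∂M.pairLaw ≤
      ENNReal.ofReal ((ν * √(l : ℝ)) ^ l)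

end Model

/-- The `ℓ₁` norm of a vector. -/
def l1 {d : ℕ} (θ : Fin d → ℝ) : ℝ := ∑ j, |θ j|

/-- The number of non-zero coordinates of a vector. -/
def l0 {d : ℕ} (θ : Fin d → ℝ) : ℕ := {j | θ j ≠ 0}.ncard

/-- The linear function `f_θ = ⟨θ, φ⟩`. -/
def linFun {S : Type*} {d : ℕ} (φ : Fin d → S → ℝ) (θ : Fin d → ℝ) (p : S) : ℝ :=
  ∑ j, θ j * φ j p

/-- The class of linear functions with parameter in the `ℓ₁`-ball of radius `R`. -/
def l1Class {S : Type*} {d : ℕ} (φ : Fin d → S → ℝ) (R : ℝ) : Set (S → ℝ) :=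
  {f | ∃ θ : Fin d → ℝ, l1 θ ≤ R ∧ f = linFun φ θ}

end OffPolicy

end

/-! The centred estimator is an average, over all observations, of the influence function of an
oracle that knows `μ⋆`, plus corrections `aux muStar - aux μhat` with `μhat` fitted on the opposite
half. Once the fitting half is frozen, a correction is a function of `(X, A)` with conditional mean
zero given `X`. The influence function is a noise term, conditionally centred given `(X, A)`, plus a
function of `X`; so the correction has mean zero and is orthogonal to it. All cross terms with the
oracle part vanish (`lintegral_crossFit_le`), which is why `v_⋆²` appears with constant exactly one.
Conditional centring is an `L²` contraction, so a correction costs at most `‖μ⋆ - μhat‖_ω²`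
(`memLp_aux_sub`, `mse_le`).

What remains is an oracle inequality for least squares over the `ℓ₁`-ball (`lintegral_popSq_le`).
Multiplying features and noise by `g/π` turns the weighted problem into an ordinary one. A
comparison vector `θ` lies on the sphere `‖θ‖₁ = R`, so the error `δ` satisfies the cone condition
`‖δ‖₁² ≤ 4 ‖θ‖₀ ‖δ‖₂²`. The basic inequality bounds the empirical norm of `δ` by `‖δ‖₁` times the
largest of `d` empirical noise correlations, whose mean square is of order `log d / n`
(`exists_sq_mean_bound`), plus the bias of `θ`.

To pass to the population norm, the empirical norm must dominate it on the cone (`exists_badSet`).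
In one direction the small-ball condition gives this up to exponentially small probability. Maurey's
method (`exists_maurey`) approximates the normalised cone by averages of `N ≍ ν²k/λ_min` vertices,
in the population and the empirical norm at once, so a union bound over `(2d)^N` averages suffices.
On the exceptional event the error is at most `4R²λ_max`, and the logarithmic term in the
sample-size condition makes that contribution negligible. -/

noncomputable section

namespace OffPolicy

/-! ### Exponential moments and Chernoff bounds from moment growth. -/

section Subexponential

variable {Ω : Type*} [MeasurableSpace Ω] {P : Measure Ω}

/-- For negative `y` this is `u ≤ sinh u` at `u = -y`. -/
theorem exp_sub_one_sub_le_abs (y : ℝ) :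
    Real.exp y - 1 - y ≤ Real.exp |y| - 1 - |y| := by
  rcases le_total 0 y with h | h
  · rw [abs_of_nonneg h]
  · rw [abs_of_nonpos h]
    have h1 := Real.self_le_sinh_iff.2 (neg_nonneg.2 h)
    rw [Real.sinh_eq, neg_neg] at h1
    linarith

theorem exp_sub_one_sub_nonneg (y : ℝ) : 0 ≤ Real.exp y - 1 - y := by
  linarith [Real.add_one_le_exp y]

theorem hasSum_exp_remainder (x : ℝ) :
    HasSum (fun l : ℕ => x ^ (l + 2) / (l + 2).factorial) (Real.exp x - 1 - x) := by
  have h := NormedSpace.expSeries_div_hasSum_exp (𝔸 := ℝ) x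
  rw [← Real.exp_eq_exp_ℝ] at h
  have h2 := (hasSum_nat_add_iff' 2).2 h
  simpa [Finset.sum_range_succ, sub_sub] using h2

/-- Integrate the exponential series term by term. Since `l ^ l / l! ≤ e ^ l`, the term of order `l`
is at most `q ^ l` with `q = e t K ≤ 1/2`, and the geometric series starting at `l = 2` sums to at
most `2 q²`. -/
theorem lintegral_exp_remainder_le {X : Ω → ℝ} (hX : Measurable X) {K t : ℝ} (hK : 0 ≤ K)
    (ht : 0 ≤ t)
    (hmom : ∀ l : ℕ, 1 ≤ l →
      ∫⁻ z, ENNReal.ofReal (|X z| ^ l) ∂P ≤ ENNReal.ofReal ((K * l) ^ l))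
    (hsmall : Real.exp 1 * t * K ≤ 1 / 2) :
    ∫⁻ z, ENNReal.ofReal (Real.exp (t * |X z|) - 1 - t * |X z|) ∂P ≤
      ENNReal.ofReal (2 * (Real.exp 1 * t * K) ^ 2) := by
  set q := Real.exp 1 * t * K with hq
  have hq0 : 0 ≤ q := by positivity
  have hgeo : HasSum (fun l : ℕ => q ^ (l + 2)) (q ^ 2 * (1 - q)⁻¹) := by
    have := (hasSum_geometric_of_lt_one hq0 (by linarith)).mul_left (q ^ 2)
    simpa [pow_add, mul_comm] using this
  have hterm : ∀ l : ℕ,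
      ∫⁻ z, ENNReal.ofReal ((t * |X z|) ^ (l + 2) / (l + 2).factorial) ∂P ≤
        ENNReal.ofReal (q ^ (l + 2)) := by
    intro l
    have h1 : ∀ z, ENNReal.ofReal ((t * |X z|) ^ (l + 2) / (l + 2).factorial) =
        ENNReal.ofReal (t ^ (l + 2) / (l + 2).factorial) * ENNReal.ofReal (|X z| ^ (l + 2)) := by
      intro z
      rw [← ENNReal.ofReal_mul (by positivity)]
      congr 1
      ring
    simp_rw [h1]
    rw [lintegral_const_mul _ (by fun_prop)]
    refine (mul_le_mul_right (hmom (l + 2) (by omega)) _).trans ?_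
    rw [← ENNReal.ofReal_mul (by positivity)]
    apply ENNReal.ofReal_le_ofReal
    have h2 := Real.pow_div_factorial_le_exp ((l + 2 : ℕ) : ℝ) (by positivity) (l + 2)
    have h3 : Real.exp ((l + 2 : ℕ) : ℝ) = Real.exp 1 ^ (l + 2) := by
      rw [← Real.exp_nat_mul, mul_one]
    rw [h3] at h2
    calc t ^ (l + 2) / (l + 2).factorial * (K * ((l + 2 : ℕ) : ℝ)) ^ (l + 2)
        = (t * K) ^ (l + 2) * (((l + 2 : ℕ) : ℝ) ^ (l + 2) / (l + 2).factorial) := by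
          rw [mul_pow, mul_pow]; ring
      _ ≤ (t * K) ^ (l + 2) * Real.exp 1 ^ (l + 2) := by gcongr
      _ = q ^ (l + 2) := by rw [hq, ← mul_pow]; ring
  calc ∫⁻ z, ENNReal.ofReal (Real.exp (t * |X z|) - 1 - t * |X z|) ∂P
      = ∫⁻ z, ∑' l : ℕ, ENNReal.ofReal ((t * |X z|) ^ (l + 2) / (l + 2).factorial) ∂P := by
        refine lintegral_congr fun z => ?_
        rw [← (hasSum_exp_remainder (t * |X z|)).tsum_eq,
          ENNReal.ofReal_tsum_of_nonneg (fun l => by positivity)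
            (hasSum_exp_remainder (t * |X z|)).summable]
    _ = ∑' l : ℕ, ∫⁻ z, ENNReal.ofReal ((t * |X z|) ^ (l + 2) / (l + 2).factorial) ∂P :=
        lintegral_tsum fun l => by fun_prop
    _ ≤ ∑' l : ℕ, ENNReal.ofReal (q ^ (l + 2)) := ENNReal.tsum_le_tsum hterm
    _ = ENNReal.ofReal (q ^ 2 * (1 - q)⁻¹) := by
        rw [← hgeo.tsum_eq, ENNReal.ofReal_tsum_of_nonneg (fun l => by positivity) hgeo.summable]
    _ ≤ _ := by
        apply ENNReal.ofReal_le_ofReal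
        have : (1 - q)⁻¹ ≤ 2 := by
          rw [inv_le_comm₀ (by linarith) (by norm_num)]; linarith
        nlinarith [sq_nonneg q]

theorem integrable_of_lintegral_ofReal_le {X : Ω → ℝ} (hX : Measurable X) (h0 : ∀ z, 0 ≤ X z)
    {C : ℝ} (h : ∫⁻ z, ENNReal.ofReal (X z) ∂P ≤ ENNReal.ofReal C) : Integrable X P := by
  refine ⟨hX.aestronglyMeasurable, ?_⟩
  rw [hasFiniteIntegral_iff_ofReal (Filter.Eventually.of_forall h0)]
  exact h.trans_lt ENNReal.ofReal_lt_top

theorem integral_le_of_lintegral_ofReal_le {X : Ω → ℝ} (hX : Measurable X) (h0 : ∀ z, 0 ≤ X z)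
    {C : ℝ} (hC : 0 ≤ C) (h : ∫⁻ z, ENNReal.ofReal (X z) ∂P ≤ ENNReal.ofReal C) :
    ∫ z, X z ∂P ≤ C := by
  rw [integral_eq_lintegral_of_nonneg_ae (Filter.Eventually.of_forall h0)
    hX.aestronglyMeasurable]
  exact ENNReal.toReal_le_of_le_ofReal hC h

theorem integrable_of_moments {X : Ω → ℝ} (hX : Measurable X) {K : ℝ}
    (hmom : ∀ l : ℕ, 1 ≤ l →
      ∫⁻ z, ENNReal.ofReal (|X z| ^ l) ∂P ≤ ENNReal.ofReal ((K * l) ^ l)) :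
    Integrable X P := by
  have h1 := hmom 1 le_rfl
  simp only [pow_one] at h1
  exact (integrable_norm_iff hX.aestronglyMeasurable).1
    (integrable_of_lintegral_ofReal_le hX.norm (fun z => norm_nonneg _) h1)

variable [IsProbabilityMeasure P]

/-- A Bernstein-type bound on the moment generating function of a variable with
sub-exponential moments. -/
theorem integrable_exp_and_integral_exp_le {X : Ω → ℝ} (hX : Measurable X) {K t : ℝ} (hK : 0 ≤ K)
    (ht : 0 ≤ t)
    (hmom : ∀ l : ℕ, 1 ≤ l →
      ∫⁻ z, ENNReal.ofReal (|X z| ^ l) ∂P ≤ ENNReal.ofReal ((K * l) ^ l))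
    (hsmall : Real.exp 1 * t * K ≤ 1 / 2) :
    Integrable (fun z => Real.exp (t * X z)) P ∧
      ∫ z, Real.exp (t * X z) ∂P ≤
        1 + t * ∫ z, X z ∂P + 2 * (Real.exp 1 * t * K) ^ 2 := by
  have hR := lintegral_exp_remainder_le (P := P) hX hK ht hmom hsmall
  have hRm : Measurable fun z => Real.exp (t * |X z|) - 1 - t * |X z| := by fun_prop
  have hRi := integrable_of_lintegral_ofReal_le hRm (fun z => exp_sub_one_sub_nonneg _) hR
  have hRb := integral_le_of_lintegral_ofReal_le hRm (fun z => exp_sub_one_sub_nonneg _)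
    (by positivity) hR
  have hXi := integrable_of_moments hX hmom
  have hdom : Integrable
      (fun z => 1 + t * X z + (Real.exp (t * |X z|) - 1 - t * |X z|)) P :=
    ((integrable_const 1).add (hXi.const_mul t)).add hRi
  have hle : ∀ z, Real.exp (t * X z) ≤ 1 + t * X z + (Real.exp (t * |X z|) - 1 - t * |X z|) := by
    intro z
    have := exp_sub_one_sub_le_abs (t * X z)
    rw [abs_mul, abs_of_nonneg ht] at this
    linarith
  have hint : Integrable (fun z => Real.exp (t * X z)) P := by
    refine hdom.mono' (by fun_prop) (Filter.Eventually.of_forall fun z => ?_)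
    rw [Real.norm_eq_abs, abs_of_pos (Real.exp_pos _)]
    exact hle z
  refine ⟨hint, (integral_mono hint hdom hle).trans ?_⟩
  have hlin : Integrable (fun z => 1 + t * X z) P := (integrable_const 1).add (hXi.const_mul t)
  rw [integral_add hlin hRi, integral_add (integrable_const 1) (hXi.const_mul t),
    integral_const_mul]
  simp only [integral_const, probReal_univ, smul_eq_mul, mul_one]
  linarith

/-- Exponential moments of sums over an i.i.d. sample. -/
theorem integral_exp_sum_pi (m : ℕ) (X : Ω → ℝ) :
    ∫ D : Fin m → Ω, Real.exp (∑ i, X (D i)) ∂(Measure.pi fun _ => P) =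
      (∫ z, Real.exp (X z) ∂P) ^ m := by
  simp_rw [Real.exp_sum]
  have := integral_fintype_prod_eq_pow (μ := P) (ι := Fin m) (fun z => Real.exp (X z))
  simpa using this

theorem integrable_exp_sum_pi (m : ℕ) {X : Ω → ℝ} (hX : Integrable (fun z => Real.exp (X z)) P) :
    Integrable (fun D : Fin m → Ω => Real.exp (∑ i, X (D i))) (Measure.pi fun _ => P) := by
  simp_rw [Real.exp_sum]
  exact Integrable.fintype_prod (f := fun _ : Fin m => fun z => Real.exp (X z)) fun _ => hX

/-- The Chernoff bound for sums over an i.i.d. sample. -/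
theorem measure_sum_ge_le (m : ℕ) {X : Ω → ℝ} (hX : Integrable (fun z => Real.exp (X z)) P)
    {a b : ℝ} (hb : ∫ z, Real.exp (X z) ∂P ≤ Real.exp b) :
    (Measure.pi fun _ => P) {D : Fin m → Ω | m * a ≤ ∑ i, X (D i)} ≤
      ENNReal.ofReal (Real.exp (m * (b - a))) := by
  have h1 := integrable_exp_sum_pi (P := P) m hX
  have h2 := mul_meas_ge_le_integral_of_nonneg (μ := Measure.pi fun _ : Fin m => P)
    (Filter.Eventually.of_forall fun D => (Real.exp_pos (∑ i, X (D i))).le) h1 (Real.exp (m * a))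
  rw [integral_exp_sum_pi] at h2
  have h3 : (∫ z, Real.exp (X z) ∂P) ^ m ≤ Real.exp (m * b) := by
    rw [Real.exp_nat_mul]
    exact pow_le_pow_left₀ (integral_nonneg fun z => (Real.exp_pos _).le) hb m
  simp only [Real.exp_le_exp] at h2
  rw [← ENNReal.ofReal_toReal (measure_ne_top (Measure.pi fun _ : Fin m => P) _)]
  apply ENNReal.ofReal_le_ofReal
  rw [mul_sub, Real.exp_sub, le_div_iff₀ (Real.exp_pos _), mul_comm]
  exact h2.trans h3

end Subexponential

/-! ### Maximal inequality for the noise correlations. -/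

section Noise

variable {Ω : Type*} [MeasurableSpace Ω] {P : Measure Ω} [IsProbabilityMeasure P]

/-- Above the level `A` one has `x² ≤ 2A² + 2(x - A)²`, and `u²/2 ≤ exp u` handles the excess `u =
t(x - A)`. The two exponentials cover both signs of `S`. This converts control of exponential
moments into a second moment without integrating tails. -/
theorem sq_le_add_exp {t A : ℝ} (ht : 0 < t) (hA : 0 ≤ A) (S : ℝ) :
    S ^ 2 ≤ 2 * A ^ 2 + 4 / t ^ 2 * (Real.exp (-(t * A)) *
      (Real.exp (t * S) + Real.exp (t * -S))) := by
  have key : ∀ x : ℝ, 0 ≤ x →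
      x ^ 2 ≤ 2 * A ^ 2 + 4 / t ^ 2 * (Real.exp (-(t * A)) * Real.exp (t * x)) := by
    intro x hx
    rw [← Real.exp_add]
    rcases le_total x A with h | h
    · have : 0 ≤ 4 / t ^ 2 * Real.exp (-(t * A) + t * x) := by positivity
      nlinarith
    · have h1 := Real.quadratic_le_exp_of_nonneg (x := -(t * A) + t * x) (by nlinarith)
      have h2 : (t * (x - A)) ^ 2 / 2 ≤ Real.exp (-(t * A) + t * x) := by
        have : -(t * A) + t * x = t * (x - A) := by ring
        rw [this] at h1 ⊢
        nlinarith [mul_nonneg ht.le (sub_nonneg.2 h)]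
      have h3 : 2 * (x - A) ^ 2 ≤ 4 / t ^ 2 * Real.exp (-(t * A) + t * x) := by
        calc 2 * (x - A) ^ 2 = 4 / t ^ 2 * ((t * (x - A)) ^ 2 / 2) := by field_simp; ring
          _ ≤ _ := by gcongr
      nlinarith [sq_nonneg (x - 2 * A)]
  have hpos : 0 ≤ 4 / t ^ 2 := by positivity
  rcases le_total 0 S with h | h
  · refine (key S h).trans ?_
    gcongr
    linarith [Real.exp_pos (t * -S)]
  · rw [← neg_sq]
    refine (key (-S) (by linarith)).trans ?_
    gcongr
    linarith [Real.exp_pos (t * S)]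

theorem log_two_le_log {d : ℕ} (hd : 2 ≤ d) : (0.69 : ℝ) ≤ Real.log d := by
  have h1 : Real.log 2 ≤ Real.log d := Real.log_le_log (by norm_num) (by exact_mod_cast hd)
  linarith [Real.log_two_gt_d9]

/-- A maximal inequality for the empirical means of `d` centred sub-exponential variables. -/
theorem exists_sq_mean_bound {d m : ℕ} (hd : 2 ≤ d) (hm : 1 ≤ m) (hlog : Real.log d ≤ m)
    {K : ℝ} (hK : 0 < K) {X : Fin d → Ω → ℝ} (hX : ∀ j, Measurable (X j))
    (hmom : ∀ j, ∀ l : ℕ, 1 ≤ l →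
      ∫⁻ z, ENNReal.ofReal (|X j z| ^ l) ∂P ≤ ENNReal.ofReal ((K * l) ^ l))
    (hmean : ∀ j, ∫ z, X j z ∂P = 0) :
    ∃ U : (Fin m → Ω) → ℝ, Measurable U ∧
      (∀ D j, ((1 / m : ℝ) * ∑ i, X j (D i)) ^ 2 ≤ U D) ∧
      ∫⁻ D, ENNReal.ofReal (U D) ∂(Measure.pi fun _ => P) ≤
        ENNReal.ofReal (1000 * K ^ 2 * Real.log d / m) := by
  have hm0 : (0 : ℝ) < m := by exact_mod_cast hm
  have hL : (0.69 : ℝ) ≤ Real.log d := log_two_le_log hd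
  set L := Real.log d with hLdef
  have hL0 : 0 < L := by linarith
  have hd0 : (0 : ℝ) < d := by positivity
  -- With `q = e t K`, the exponential moment of a sum of `m` terms is at most `exp (2 q² m) = exp
  -- (L / 2) ≤ d`. The hypothesis `log d ≤ m` is what gives `q ≤ 1/2`.
  set q := √(L / m) / 2 with hq
  have hq2 : q ^ 2 = L / m / 4 := by
    rw [hq, div_pow, Real.sq_sqrt (by positivity)]; norm_num
  have hq0 : 0 < q := by positivity
  have hqle : q ≤ 1 / 2 := by
    have : √(L / m) ≤ 1 := by
      rw [Real.sqrt_le_one]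
      exact (div_le_one hm0).2 hlog
    linarith
  set t := q / (Real.exp 1 * K) with ht
  have ht0 : 0 < t := by positivity
  have hetK : Real.exp 1 * t * K = q := by rw [ht]; field_simp
  -- Chosen so that `exp (-tA) = d⁻²`, which cancels the sum over `d` coordinates of two
  -- exponentials of mean at most `d`.
  set A := 2 * L / t with hA
  have hA0 : 0 ≤ A := by positivity
  have htA : t * A = 2 * L := by rw [hA]; field_simp
  have hmgf : ∀ Y : Ω → ℝ, Measurable Y → (∀ l : ℕ, 1 ≤ l →
      ∫⁻ z, ENNReal.ofReal (|Y z| ^ l) ∂P ≤ ENNReal.ofReal ((K * l) ^ l)) →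
      ∫ z, Y z ∂P = 0 →
      Integrable (fun D : Fin m → Ω => Real.exp (t * ∑ i, Y (D i))) (Measure.pi fun _ => P) ∧
      ∫ D : Fin m → Ω, Real.exp (t * ∑ i, Y (D i)) ∂(Measure.pi fun _ => P) ≤ d := by
    intro Y hY hYm hY0
    obtain ⟨h1, h2⟩ := integrable_exp_and_integral_exp_le (P := P) hY hK.le ht0.le hYm
      (by rw [hetK]; exact hqle)
    rw [hY0, hetK, mul_zero, add_zero] at h2
    simp_rw [Finset.mul_sum]
    refine ⟨integrable_exp_sum_pi m (X := fun z => t * Y z) h1, ?_⟩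
    rw [integral_exp_sum_pi m (fun z => t * Y z)]
    have h3 : ∫ z, Real.exp (t * Y z) ∂P ≤ Real.exp (2 * q ^ 2) :=
      h2.trans (by linarith [Real.add_one_le_exp (2 * q ^ 2)])
    calc (∫ z, Real.exp (t * Y z) ∂P) ^ m ≤ Real.exp (2 * q ^ 2) ^ m :=
          pow_le_pow_left₀ (integral_nonneg fun z => (Real.exp_pos _).le) h3 m
      _ = Real.exp (L / 2) := by
          rw [← Real.exp_nat_mul, hq2]; congr 1; field_simp; ring
      _ ≤ Real.exp L := Real.exp_le_exp.2 (by linarith)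
      _ = d := Real.exp_log hd0
  have hplus := fun j => hmgf (X j) (hX j) (hmom j) (hmean j)
  have hminus := fun j => hmgf (fun z => -X j z) (hX j).neg
    (by simpa only [abs_neg] using hmom j) (by rw [integral_neg, hmean j, neg_zero])
  simp only [Finset.sum_neg_distrib] at hminus
  -- The maximum over coordinates is dominated by a sum of exponentials, whose integral is computed
  -- coordinate by coordinate.
  refine ⟨fun D => (1 / m : ℝ) ^ 2 * (2 * A ^ 2 + ∑ j, 4 / t ^ 2 * (Real.exp (-(t * A)) *
      (Real.exp (t * ∑ i, X j (D i)) + Real.exp (t * -∑ i, X j (D i))))), ?_, ?_, ?_⟩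
  · fun_prop
  · intro D j
    beta_reduce
    rw [mul_pow]
    refine mul_le_mul_of_nonneg_left ((sq_le_add_exp ht0 hA0 _).trans ?_) (by positivity)
    exact add_le_add_right (Finset.single_le_sum (f := fun j => 4 / t ^ 2 * (Real.exp (-(t * A)) *
      (Real.exp (t * ∑ i, X j (D i)) + Real.exp (t * -∑ i, X j (D i)))))
      (fun j _ => by positivity) (Finset.mem_univ j)) _
  · have hterm : ∀ j, Integrable (fun D : Fin m → Ω => 4 / t ^ 2 * (Real.exp (-(t * A)) *
      (Real.exp (t * ∑ i, X j (D i)) + Real.exp (t * -∑ i, X j (D i)))))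
        (Measure.pi fun _ => P) := fun j =>
      (((hplus j).1.add (hminus j).1).const_mul _).const_mul _
    have hsum := integrable_finsetSum Finset.univ fun j _ => hterm j
    beta_reduce
    rw [← ofReal_integral_eq_lintegral_ofReal]
    rotate_left
    · exact ((integrable_const (2 * A ^ 2)).add hsum).const_mul _
    · exact Filter.Eventually.of_forall fun D => by dsimp only [Pi.zero_apply]; positivity
    apply ENNReal.ofReal_le_ofReal
    rw [integral_const_mul, integral_add (integrable_const _) hsum,
      integral_finsetSum _ fun j _ => hterm j]
    simp only [integral_const, probReal_univ, smul_eq_mul, one_mul]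
    have hj : ∀ j ∈ Finset.univ, ∫ D : Fin m → Ω, 4 / t ^ 2 * (Real.exp (-(t * A)) *
        (Real.exp (t * ∑ i, X j (D i)) + Real.exp (t * -∑ i, X j (D i))))
        ∂(Measure.pi fun _ => P) ≤ 4 / t ^ 2 * (Real.exp (-(t * A)) * (d + d)) := by
      intro j _
      rw [integral_const_mul, integral_const_mul, integral_add (hplus j).1 (hminus j).1]
      gcongr
      · exact (hplus j).2
      · exact (hminus j).2
    have hexp : Real.exp (-(t * A)) = 1 / (d : ℝ) ^ 2 := by
      rw [htA, Real.exp_neg, mul_comm, Real.exp_mul, Real.exp_log hd0]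
      norm_num
    have h1 := Finset.sum_le_sum hj
    rw [Finset.sum_const, Finset.card_univ, Fintype.card_fin, nsmul_eq_mul, hexp] at h1
    have h2 : (d : ℝ) * (4 / t ^ 2 * (1 / (d : ℝ) ^ 2 * (d + d))) = 8 / t ^ 2 := by
      field_simp; ring
    rw [h2] at h1
    have ht2 : 1 / t ^ 2 = 4 * Real.exp 1 ^ 2 * K ^ 2 * m / L := by
      rw [ht, div_pow, hq2]; field_simp
    have he : Real.exp 1 ^ 2 ≤ 7.4 := by
      have := Real.exp_one_lt_d9
      nlinarith [Real.exp_pos 1]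
    -- As `d ≥ 2`, `L` is bounded below by `0.69`, so the term `8 / t²` that does not grow with `L²`
    -- is absorbed into the main one.
    have hinv : 1 / L ≤ 2.11 * L := by
      rw [div_le_iff₀ hL0]; nlinarith
    rw [hexp]
    calc (1 / m : ℝ) ^ 2 * (2 * A ^ 2 + _)
        ≤ (1 / m : ℝ) ^ 2 * (2 * A ^ 2 + 8 / t ^ 2) := by
          rw [hexp] at *
          gcongr
      _ = (1 / m : ℝ) ^ 2 * (8 * (L ^ 2 + 1) * (1 / t ^ 2)) := by rw [hA]; field_simp; ring
      _ = 32 * Real.exp 1 ^ 2 * (L + 1 / L) * (K ^ 2 / m) := by rw [ht2]; field_simp; ring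
      _ ≤ 32 * 7.4 * (L + 2.11 * L) * (K ^ 2 / m) := by gcongr
      _ = 736.448 * L * (K ^ 2 / m) := by ring
      _ ≤ 1000 * L * (K ^ 2 / m) := by gcongr; norm_num
      _ = 1000 * K ^ 2 * L / m := by ring

end Noise

/-! ### Sparse approximation of convex combinations. -/

section Maurey

/-- Maurey's empirical method: a convex combination is approximated by an average of `N` of the
points, in a semi-norm given by a positive semi-definite bilinear form. -/
theorem exists_maurey {V ι : Type*} [AddCommGroup V] [Module ℝ V] [Fintype ι]
    (B : V →ₗ[ℝ] V →ₗ[ℝ] ℝ) (hsymm : ∀ x y, B x y = B y x) (hpos : ∀ x, 0 ≤ B x x)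
    (x : ι → V) {b : ℝ} (hx : ∀ a, B (x a) (x a) ≤ b) (p : ι → ℝ) (hp : ∀ a, 0 ≤ p a)
    (hp1 : ∑ a, p a = 1) {f : V} (hf : ∑ a, p a • x a = f) (N : ℕ) :
    ∃ t : Fin N → ι, B ((N : ℝ) • f - ∑ i, x (t i)) ((N : ℝ) • f - ∑ i, x (t i)) ≤ N * b := by
  induction N with
  | zero => exact ⟨Fin.elim0, by simp⟩
  | succ N ih =>
    obtain ⟨t, ht⟩ := ih
    set w := (N : ℝ) • f - ∑ i, x (t i) with hw
    -- If `a` is drawn with probabilities `p`, then `f - x a` has mean zero, so the cross term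
    -- averages to zero and the square averages to at most `b - B f f`. Some `a` does no worse than
    -- the average; adding one point at a time makes the choice greedy.
    have hex : ∃ a, 2 * B w (f - x a) + B (f - x a) (f - x a) ≤ b := by
      by_contra! hcon
      have h1 : ∑ a, p a * b < ∑ a, p a * (2 * B w (f - x a) + B (f - x a) (f - x a)) := by
        refine Finset.sum_lt_sum (fun a _ => mul_le_mul_of_nonneg_left (hcon a).le (hp a)) ?_
        by_contra! h0
        have : ∀ a, p a = 0 := fun a => by
          by_contra hne
          exact absurd (h0 a (Finset.mem_univ a))
            (not_le.2 (mul_lt_mul_of_pos_left (hcon a) (lt_of_le_of_ne (hp a) (Ne.symm hne))))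
        simp [this] at hp1
      have hlin : ∀ v : V, ∑ a, p a * B v (x a) = B v f := by
        intro v
        rw [← hf, map_sum]
        simp
      have h2 : ∑ a, p a * (2 * B w (f - x a) + B (f - x a) (f - x a)) =
          (2 * B w f + B f f) * ∑ a, p a - 2 * ∑ a, p a * B w (x a)
            - 2 * ∑ a, p a * B f (x a) + ∑ a, p a * B (x a) (x a) := by
        rw [Finset.mul_sum, Finset.mul_sum, Finset.mul_sum, ← Finset.sum_sub_distrib,
          ← Finset.sum_sub_distrib, ← Finset.sum_add_distrib]
        refine Finset.sum_congr rfl fun a _ => ?_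
        simp only [map_sub, LinearMap.sub_apply]
        rw [hsymm (x a) f]
        ring
      rw [h2, hlin, hlin, ← Finset.sum_mul, hp1] at h1
      have h3 : ∑ a, p a * B (x a) (x a) ≤ ∑ a, p a * b :=
        Finset.sum_le_sum fun a _ => mul_le_mul_of_nonneg_left (hx a) (hp a)
      rw [← Finset.sum_mul, hp1] at h3
      linarith [hpos f]
    obtain ⟨a, ha⟩ := hex
    refine ⟨Fin.cons a t, ?_⟩
    have heq : ((N + 1 : ℕ) : ℝ) • f - ∑ i, x ((Fin.cons a t : Fin (N + 1) → ι) i) =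
        w + (f - x a) := by
      rw [Fin.sum_univ_succ, hw]
      simp only [Fin.cons_zero, Fin.cons_succ]
      push_cast
      rw [add_smul, one_smul]
      abel
    rw [heq]
    simp only [map_add, LinearMap.add_apply]
    rw [hsymm (f - x a) w]
    push_cast
    linarith

end Maurey

/-! ### Population and empirical quadratic forms, and the net of vertex averages. -/

section RestrictedIsometry

variable {Ω : Type*} [MeasurableSpace Ω] {P : Measure Ω}

/-- The population second moment of a linear combination of features. -/
def popSq (P : Measure Ω) {d : ℕ} (ψ : Fin d → Ω → ℝ) (δ : Fin d → ℝ) : ℝ :=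
  ∫ z, linFun ψ δ z ^ 2 ∂P

/-- The empirical second moment of a linear combination of features. -/
def empSq {Ω : Type*} {d m : ℕ} (ψ : Fin d → Ω → ℝ) (D : Fin m → Ω) (δ : Fin d → ℝ) : ℝ :=
  (1 / m : ℝ) * ∑ i, linFun ψ δ (D i) ^ 2

theorem linFun_add {S : Type*} {d : ℕ} (ψ : Fin d → S → ℝ) (x y : Fin d → ℝ) (z : S) :
    linFun ψ (x + y) z = linFun ψ x z + linFun ψ y z := by
  simp [linFun, add_mul, Finset.sum_add_distrib]

theorem linFun_sub {S : Type*} {d : ℕ} (ψ : Fin d → S → ℝ) (x y : Fin d → ℝ) (z : S) :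
    linFun ψ (x - y) z = linFun ψ x z - linFun ψ y z := by
  simp [linFun, sub_mul, Finset.sum_sub_distrib]

theorem linFun_smul {S : Type*} {d : ℕ} (ψ : Fin d → S → ℝ) (c : ℝ) (x : Fin d → ℝ) (z : S) :
    linFun ψ (c • x) z = c * linFun ψ x z := by
  simp [linFun, Finset.mul_sum, mul_assoc]

theorem measurable_linFun {d : ℕ} {ψ : Fin d → Ω → ℝ} (hψ : ∀ j, Measurable (ψ j))
    (δ : Fin d → ℝ) : Measurable (linFun ψ δ) := by
  unfold linFun; fun_prop

theorem memLp_linFun {d : ℕ} {ψ : Fin d → Ω → ℝ} (hψ : ∀ j, MemLp (ψ j) 2 P)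
    (δ : Fin d → ℝ) : MemLp (linFun ψ δ) 2 P := by
  have := memLp_finsetSum (μ := P) (p := 2) Finset.univ
    (f := fun j z => δ j * ψ j z) fun j _ => (hψ j).const_mul (δ j)
  exact this

theorem popSq_nonneg {d : ℕ} (ψ : Fin d → Ω → ℝ) (δ : Fin d → ℝ) : 0 ≤ popSq P ψ δ :=
  integral_nonneg fun _ => sq_nonneg _

theorem popSq_smul {d : ℕ} (ψ : Fin d → Ω → ℝ) (c : ℝ) (δ : Fin d → ℝ) :
    popSq P ψ (c • δ) = c ^ 2 * popSq P ψ δ := by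
  simp only [popSq, linFun_smul, mul_pow, integral_const_mul]

theorem empSq_smul {Ω : Type*} {d m : ℕ} (ψ : Fin d → Ω → ℝ) (D : Fin m → Ω) (c : ℝ) (δ : Fin d → ℝ) :
    empSq ψ D (c • δ) = c ^ 2 * empSq ψ D δ := by
  simp only [empSq, linFun_smul, mul_pow, ← Finset.mul_sum]
  ring

/-- Used with `x` a cone direction and `y` its net point, to keep the population norm of the net
point bounded below. `empSq_le_two_mul` goes the other way and carries the empirical lower bound
back from the net point. -/
theorem popSq_le_two_mul {d : ℕ} {ψ : Fin d → Ω → ℝ} (hψ : ∀ j, MemLp (ψ j) 2 P)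
    (x y : Fin d → ℝ) : popSq P ψ x ≤ 2 * popSq P ψ y + 2 * popSq P ψ (x - y) := by
  have hx := (memLp_linFun hψ x).integrable_sq
  have hy := (memLp_linFun hψ y).integrable_sq
  have hxy := (memLp_linFun hψ (x - y)).integrable_sq
  unfold popSq
  rw [← integral_const_mul, ← integral_const_mul, ← integral_add (hy.const_mul 2)
    (hxy.const_mul 2)]
  refine integral_mono hx ((hy.const_mul 2).add (hxy.const_mul 2)) fun z => ?_
  simp only [linFun_sub]
  nlinarith [sq_nonneg (linFun ψ x z - 2 * linFun ψ y z)]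

theorem empSq_le_two_mul {Ω : Type*} {d m : ℕ} (ψ : Fin d → Ω → ℝ) (D : Fin m → Ω) (x y : Fin d → ℝ) :
    empSq ψ D y ≤ 2 * empSq ψ D x + 2 * empSq ψ D (x - y) := by
  unfold empSq
  have : ∑ i, linFun ψ y (D i) ^ 2 ≤
      ∑ i, (2 * linFun ψ x (D i) ^ 2 + 2 * linFun ψ (x - y) (D i) ^ 2) := by
    refine Finset.sum_le_sum fun i _ => ?_
    rw [linFun_sub]
    nlinarith [sq_nonneg (2 * linFun ψ x (D i) - linFun ψ y (D i))]
  rw [Finset.sum_add_distrib, ← Finset.mul_sum, ← Finset.mul_sum] at this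
  have h0 : (0 : ℝ) ≤ 1 / m := by positivity
  nlinarith [mul_le_mul_of_nonneg_left this h0]

/-- The sum of the population and the empirical inner products of features. -/
def innerForm {d m : ℕ} {ψ : Fin d → Ω → ℝ} (hψ : ∀ j, MemLp (ψ j) 2 P) (D : Fin m → Ω) :
    (Fin d → ℝ) →ₗ[ℝ] (Fin d → ℝ) →ₗ[ℝ] ℝ :=
  have hI : ∀ x y : Fin d → ℝ, Integrable (fun z => linFun ψ x z * linFun ψ y z) P :=
    fun x y => (memLp_linFun hψ x).integrable_mul (memLp_linFun hψ y)
  LinearMap.mk₂ ℝ (fun x y => ∫ z, linFun ψ x z * linFun ψ y z ∂P +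
      (1 / m : ℝ) * ∑ i, linFun ψ x (D i) * linFun ψ y (D i))
    (fun x x' y => by
      simp only [linFun_add, add_mul, Finset.sum_add_distrib, mul_add]
      rw [integral_add (hI x y) (hI x' y)]; ring)
    (fun c x y => by
      simp only [linFun_smul, mul_assoc, ← Finset.mul_sum, integral_const_mul, smul_eq_mul]
      ring)
    (fun x y y' => by
      simp only [linFun_add, mul_add, Finset.sum_add_distrib]
      rw [integral_add (hI x y) (hI x y')]; ring)
    (fun c x y => by
      simp only [linFun_smul, mul_left_comm _ c, ← Finset.mul_sum, integral_const_mul, smul_eq_mul]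
      ring)

theorem innerForm_self {d m : ℕ} {ψ : Fin d → Ω → ℝ} (hψ : ∀ j, MemLp (ψ j) 2 P)
    (D : Fin m → Ω) (x : Fin d → ℝ) :
    innerForm hψ D x x = popSq P ψ x + empSq ψ D x := by
  simp only [innerForm, LinearMap.mk₂_apply, popSq, empSq, sq]

theorem innerForm_symm {d m : ℕ} {ψ : Fin d → Ω → ℝ} (hψ : ∀ j, MemLp (ψ j) 2 P)
    (D : Fin m → Ω) (x y : Fin d → ℝ) : innerForm hψ D x y = innerForm hψ D y x := by
  simp only [innerForm, LinearMap.mk₂_apply, mul_comm]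

theorem empSq_nonneg {Ω : Type*} {d m : ℕ} (ψ : Fin d → Ω → ℝ) (D : Fin m → Ω) (δ : Fin d → ℝ) :
    0 ≤ empSq ψ D δ := by
  unfold empSq; positivity

/-- The vertices `± ρ e_j` of the `ℓ₁`-ball of radius `ρ`. -/
def vertex {d : ℕ} (ρ : ℝ) (a : Fin d × Bool) : Fin d → ℝ :=
  Pi.single a.1 (if a.2 then ρ else -ρ)

theorem linFun_vertex_sq {S : Type*} {d : ℕ} (ψ : Fin d → S → ℝ) (ρ : ℝ) (a : Fin d × Bool)
    (z : S) : linFun ψ (vertex ρ a) z ^ 2 = ρ ^ 2 * ψ a.1 z ^ 2 := by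
  have : linFun ψ (vertex ρ a) z = (if a.2 then ρ else -ρ) * ψ a.1 z := by
    simp [linFun, vertex, Pi.single_apply]
  rw [this]
  split_ifs <;> ring

/-- Every vector of the `ℓ₁`-ball is a convex combination of the vertices. -/
theorem exists_convex_vertex {d : ℕ} (hd : 1 ≤ d) {ρ : ℝ} (hρ : 0 < ρ) (δ : Fin d → ℝ)
    (hδ : l1 δ ≤ ρ) :
    ∃ p : Fin d × Bool → ℝ, (∀ a, 0 ≤ p a) ∧ ∑ a, p a = 1 ∧ ∑ a, p a • vertex ρ a = δ := by
  have hd0 : (0 : ℝ) < d := by exact_mod_cast hd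
  have hslack : 0 ≤ 1 - l1 δ / ρ := by
    rw [sub_nonneg, div_le_one hρ]; exact hδ
  -- The positive and negative parts of each coordinate, divided by `ρ`. The missing mass is spread
  -- evenly over all vertices, where opposite signs cancel.
  refine ⟨fun a => (|δ a.1| + (if a.2 then δ a.1 else -δ a.1)) / (2 * ρ) +
    (1 - l1 δ / ρ) / (2 * d), fun a => ?_, ?_, ?_⟩
  · have : 0 ≤ |δ a.1| + (if a.2 then δ a.1 else -δ a.1) := by
      split_ifs
      · linarith [neg_abs_le (δ a.1)]
      · linarith [le_abs_self (δ a.1)]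
    positivity
  · rw [Fintype.sum_prod_type]
    simp only [Fintype.sum_bool, if_true, Bool.false_eq_true, if_false]
    have : ∀ j, (|δ j| + δ j) / (2 * ρ) + (1 - l1 δ / ρ) / (2 * d) +
        ((|δ j| + -δ j) / (2 * ρ) + (1 - l1 δ / ρ) / (2 * d)) =
        |δ j| / ρ + (1 - l1 δ / ρ) / d := fun j => by field_simp; ring
    simp_rw [this]
    rw [Finset.sum_add_distrib, ← Finset.sum_div, Finset.sum_const, Finset.card_univ,
      Fintype.card_fin, nsmul_eq_mul]
    change l1 δ / ρ + _ = 1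
    field_simp
    ring
  · rw [Fintype.sum_prod_type]
    simp only [Fintype.sum_bool, if_true, Bool.false_eq_true, if_false, vertex]
    ext i
    simp only [Finset.sum_apply, Pi.add_apply, Pi.smul_apply, Pi.single_apply, smul_eq_mul]
    rw [Finset.sum_eq_single i (fun j _ hj => by simp [hj.symm]) (by simp)]
    simp only [if_true]
    field_simp
    ring

/-- The averages of `N` vertices. -/
def netPoint {d N : ℕ} (ρ : ℝ) (t : Fin N → Fin d × Bool) : Fin d → ℝ :=
  (N : ℝ)⁻¹ • ∑ i, vertex ρ (t i)

/-- Sparse approximation in the population and the empirical norms simultaneously. -/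
theorem exists_netPoint {d m N : ℕ} (hd : 1 ≤ d) (hN : 1 ≤ N) {ψ : Fin d → Ω → ℝ}
    (hψ : ∀ j, MemLp (ψ j) 2 P) {ρ b : ℝ} (hρ : 0 < ρ) (D : Fin m → Ω)
    (hb : ∀ j, ∫ z, ψ j z ^ 2 ∂P + (1 / m : ℝ) * ∑ i, ψ j (D i) ^ 2 ≤ b)
    (δ : Fin d → ℝ) (hδ : l1 δ ≤ ρ) :
    ∃ t : Fin N → Fin d × Bool,
      popSq P ψ (δ - netPoint ρ t) + empSq ψ D (δ - netPoint ρ t) ≤ ρ ^ 2 * b / N := by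
  obtain ⟨p, hp, hp1, hpδ⟩ := exists_convex_vertex hd hρ δ hδ
  have hN0 : (0 : ℝ) < N := by exact_mod_cast hN
  have hvert : ∀ a : Fin d × Bool,
      innerForm hψ D (vertex ρ a) (vertex ρ a) ≤ ρ ^ 2 * b := by
    intro a
    rw [innerForm_self]
    simp only [popSq, empSq, linFun_vertex_sq, integral_const_mul, ← Finset.mul_sum]
    calc _ = ρ ^ 2 * (∫ z, ψ a.1 z ^ 2 ∂P + (1 / m : ℝ) * ∑ i, ψ a.1 (D i) ^ 2) := by ring
      _ ≤ _ := by gcongr; exact hb a.1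
  obtain ⟨t, ht⟩ := exists_maurey (innerForm hψ D) (innerForm_symm hψ D)
    (fun x => by rw [innerForm_self]; exact add_nonneg (popSq_nonneg _ _) (empSq_nonneg _ _ _))
    (vertex ρ) hvert p hp hp1 hpδ N
  refine ⟨t, ?_⟩
  have heq : (N : ℝ) • δ - ∑ i, vertex ρ (t i) = (N : ℝ) • (δ - netPoint ρ t) := by
    rw [smul_sub, netPoint, smul_smul, mul_inv_cancel₀ hN0.ne', one_smul]
  rw [heq, innerForm_self, popSq_smul, empSq_smul, ← mul_add] at ht
  rw [le_div_iff₀ hN0]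
  have h2 : (N : ℝ) * ((popSq P ψ (δ - netPoint ρ t) + empSq ψ D (δ - netPoint ρ t)) * N) ≤
      N * (ρ ^ 2 * b) := by nlinarith
  exact le_of_mul_le_mul_left h2 hN0

end RestrictedIsometry

/-! ### Consequences of sub-Gaussian moments and lower-tail counts. -/

section Moments

variable {Ω : Type*} [MeasurableSpace Ω] {P : Measure Ω}

/-- Sub-Gaussian growth of the moments, with parameter `ν`. -/
def SubGaussianMoments (P : Measure Ω) (f : Ω → ℝ) (ν : ℝ) : Prop :=
  ∀ l : ℕ, 1 ≤ l → ∫⁻ z, ENNReal.ofReal (|f z| ^ l) ∂P ≤ ENNReal.ofReal ((ν * √(l : ℝ)) ^ l)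

/-- The moment of order `2l` involves `√(2l) ^ (2l) = (2l) ^ l`: squares are sub-exponential with
parameter `2ν²`. -/
theorem SubGaussianMoments.lintegral_pow_two_mul_le {f : Ω → ℝ} {ν : ℝ}
    (h : SubGaussianMoments P f ν) (l : ℕ) (hl : 1 ≤ l) :
    ∫⁻ z, ENNReal.ofReal ((f z ^ 2) ^ l) ∂P ≤ ENNReal.ofReal ((2 * ν ^ 2 * l) ^ l) := by
  have := h (2 * l) (by omega)
  simp only [pow_mul, sq_abs, mul_pow _ _ 2] at this
  rw [Real.sq_sqrt (by positivity)] at this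
  refine this.trans_eq ?_
  push_cast
  ring_nf

theorem SubGaussianMoments.lintegral_sq_le {f : Ω → ℝ} {ν : ℝ}
    (h : SubGaussianMoments P f ν) :
    ∫⁻ z, ENNReal.ofReal (f z ^ 2) ∂P ≤ ENNReal.ofReal (2 * ν ^ 2) := by
  simpa using h.lintegral_pow_two_mul_le 1 le_rfl

theorem SubGaussianMoments.memLp {f : Ω → ℝ} {ν : ℝ} (h : SubGaussianMoments P f ν)
    (hf : Measurable f) : MemLp f 2 P :=
  (memLp_two_iff_integrable_sq hf.aestronglyMeasurable).2
    (integrable_of_lintegral_ofReal_le (hf.pow_const 2) (fun _ => sq_nonneg _) h.lintegral_sq_le)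

theorem SubGaussianMoments.integral_sq_le {f : Ω → ℝ} {ν : ℝ} (h : SubGaussianMoments P f ν)
    (hf : Measurable f) : ∫ z, f z ^ 2 ∂P ≤ 2 * ν ^ 2 :=
  integral_le_of_lintegral_ofReal_le (hf.pow_const 2) (fun _ => sq_nonneg _) (by positivity)
    h.lintegral_sq_le

/-- A product of two variables with sub-Gaussian moments has sub-exponential moments. -/
theorem SubGaussianMoments.lintegral_mul_le {e f : Ω → ℝ} {σ ν : ℝ} (hσ : 0 < σ) (hν : 0 < ν)
    (he : SubGaussianMoments P e σ) (hf : SubGaussianMoments P f ν)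
    (hem : Measurable e) (hfm : Measurable f) (l : ℕ) (hl : 1 ≤ l) :
    ∫⁻ z, ENNReal.ofReal (|e z * f z| ^ l) ∂P ≤ ENNReal.ofReal ((2 * σ * ν * l) ^ l) := by
  -- Weighted AM-GM; the weights `ν/σ` and `σ/ν` make the two moment bounds equal.
  have h1 : ∀ z, ENNReal.ofReal (|e z * f z| ^ l) ≤
      ENNReal.ofReal ((ν / σ) ^ l / 2) * ENNReal.ofReal ((e z ^ 2) ^ l) +
        ENNReal.ofReal ((σ / ν) ^ l / 2) * ENNReal.ofReal ((f z ^ 2) ^ l) := by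
    intro z
    rw [← ENNReal.ofReal_mul (by positivity), ← ENNReal.ofReal_mul (by positivity),
      ← ENNReal.ofReal_add (by positivity) (by positivity)]
    apply ENNReal.ofReal_le_ofReal
    have h2 := sq_nonneg (ν ^ l * |e z| ^ l - σ ^ l * |f z| ^ l)
    have hσl : 0 < σ ^ l := by positivity
    have hνl : 0 < ν ^ l := by positivity
    have e2 : (e z ^ 2) ^ l = (|e z| ^ l) ^ 2 := by rw [← sq_abs, pow_right_comm]
    have f2 : (f z ^ 2) ^ l = (|f z| ^ l) ^ 2 := by rw [← sq_abs, pow_right_comm]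
    rw [abs_mul, mul_pow, e2, f2, div_pow, div_pow]
    have h3 : ν ^ l / σ ^ l / 2 * (|e z| ^ l) ^ 2 + σ ^ l / ν ^ l / 2 * (|f z| ^ l) ^ 2 -
        |e z| ^ l * |f z| ^ l =
        (ν ^ l * |e z| ^ l - σ ^ l * |f z| ^ l) ^ 2 / (2 * σ ^ l * ν ^ l) := by
      field_simp; ring
    have h4 : 0 ≤ (ν ^ l * |e z| ^ l - σ ^ l * |f z| ^ l) ^ 2 / (2 * σ ^ l * ν ^ l) := by
      positivity
    linarith
  refine (lintegral_mono h1).trans ?_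
  rw [lintegral_add_left (by fun_prop), lintegral_const_mul _ (by fun_prop),
    lintegral_const_mul _ (by fun_prop)]
  refine (add_le_add (mul_le_mul_right (he.lintegral_pow_two_mul_le l hl) _)
    (mul_le_mul_right (hf.lintegral_pow_two_mul_le l hl) _)).trans_eq ?_
  rw [← ENNReal.ofReal_mul (by positivity), ← ENNReal.ofReal_mul (by positivity),
    ← ENNReal.ofReal_add (by positivity) (by positivity)]
  congr 1
  have e1 : (ν / σ) ^ l / 2 * (2 * σ ^ 2 * l) ^ l = (2 * σ * ν * l) ^ l / 2 := by
    rw [div_mul_eq_mul_div, ← mul_pow]; congr 2; field_simp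
  have e2 : (σ / ν) ^ l / 2 * (2 * ν ^ 2 * l) ^ l = (2 * σ * ν * l) ^ l / 2 := by
    rw [div_mul_eq_mul_div, ← mul_pow]; congr 2; field_simp
  rw [e1, e2]
  ring

variable [IsProbabilityMeasure P]

/-- Chernoff for `f²` at the largest admissible `t`, where `tK = 1/(2e)`. The exponential moment is
at most `1 + 0.19 + 0.5 ≤ exp 0.7`, and the threshold `24ν² = 12K` scales to `6/e ≥ 2.2`, leaving
the rate `1.5`. -/
theorem SubGaussianMoments.measure_sum_sq_ge_le {f : Ω → ℝ} {ν : ℝ} (hν : 0 < ν)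
    (h : SubGaussianMoments P f ν) (hf : Measurable f) (m : ℕ) :
    (Measure.pi fun _ => P) {D : Fin m → Ω | m * (24 * ν ^ 2) ≤ ∑ i, f (D i) ^ 2} ≤
      ENNReal.ofReal (Real.exp (m * (-1.5))) := by
  set K := 2 * ν ^ 2 with hK
  have hK0 : 0 < K := by positivity
  set t := 1 / (2 * Real.exp 1 * K) with ht
  have ht0 : 0 < t := by positivity
  have hetK : Real.exp 1 * t * K = 1 / 2 := by rw [ht]; field_simp
  obtain ⟨h1, h2⟩ := integrable_exp_and_integral_exp_le (P := P) (X := fun z => f z ^ 2)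
    (hf.pow_const 2) hK0.le ht0.le
    (fun l hl => by simpa only [abs_sq] using h.lintegral_pow_two_mul_le l hl)
    hetK.le
  have he := Real.exp_one_lt_d9
  have he' := Real.exp_one_gt_d9
  have htK : t * K = 1 / (2 * Real.exp 1) := by rw [ht]; field_simp
  have hb : ∫ z, Real.exp (t * f z ^ 2) ∂P ≤ Real.exp 0.7 := by
    refine h2.trans (le_trans ?_ (Real.add_one_le_exp _))
    rw [hetK]
    have h3 : t * ∫ z, f z ^ 2 ∂P ≤ t * K := by gcongr; exact h.integral_sq_le hf
    have h4 : t * K ≤ 0.19 := by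
      rw [htK, div_le_iff₀ (by positivity)]; linarith
    linarith
  refine le_trans ?_ ((measure_sum_ge_le (P := P) m (X := fun z => t * f z ^ 2) h1 (a := 2.2)
    hb).trans ?_)
  · refine measure_mono fun D hD => ?_
    simp only [Set.mem_ofPred_eq] at hD ⊢
    rw [← Finset.mul_sum]
    have h5 : t * (m * (24 * ν ^ 2)) = m * (12 * (t * K)) := by rw [hK]; ring
    have h6 : (2.2 : ℝ) ≤ 12 * (t * K) := by
      rw [htK, mul_one_div, le_div_iff₀ (by positivity)]; linarith
    calc (m : ℝ) * 2.2 ≤ m * (12 * (t * K)) := by gcongr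
      _ = t * (m * (24 * ν ^ 2)) := h5.symm
      _ ≤ _ := by gcongr
  · norm_num

/-- The number of visits of an i.i.d. sample to a set of probability at least `q` is at least
`m q / 4`, with high probability. -/
theorem measure_count_le_le {A : Set Ω} (hA : MeasurableSet A) {q : ℝ} (hq : 0 ≤ q)
    (hP : ENNReal.ofReal q ≤ P A) (m : ℕ) :
    (Measure.pi fun _ => P)
        {D : Fin m → Ω | m * (-(q / 4)) ≤ ∑ i, -A.indicator (fun _ => (1 : ℝ)) (D i)} ≤
      ENNReal.ofReal (Real.exp (-(q * m / 4))) := by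
  have hexp : ∀ z, Real.exp (-A.indicator (fun _ => (1 : ℝ)) z) =
      1 - (1 - Real.exp (-1)) * A.indicator (fun _ => (1 : ℝ)) z := by
    intro z
    by_cases hz : z ∈ A <;> simp [hz]
  have hind : Integrable (A.indicator fun _ => (1 : ℝ)) P := (integrable_const 1).indicator hA
  have hi : Integrable (fun z => Real.exp (-A.indicator (fun _ => (1 : ℝ)) z)) P := by
    simp_rw [hexp]
    exact (integrable_const 1).sub (hind.const_mul _)
  have hq' : q ≤ P.real A := by
    rw [Measure.real, ← ENNReal.ofReal_le_iff_le_toReal (measure_ne_top _ _)]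
    exact hP
  -- Since `1 - e⁻¹ ≥ 1/2`, the mean is at most `1 - q/2`. Against the threshold `q/4` this leaves
  -- the rate `q/2 - q/4`.
  have hb : ∫ z, Real.exp (-A.indicator (fun _ => (1 : ℝ)) z) ∂P ≤ Real.exp (-(q / 2)) := by
    simp_rw [hexp]
    rw [integral_sub (integrable_const 1) (hind.const_mul _), integral_const_mul,
      integral_indicator_const _ hA]
    simp only [integral_const, probReal_univ, smul_eq_mul, mul_one]
    have h1 : Real.exp (-1) ≤ 1 / 2 := by
      rw [Real.exp_neg, inv_le_comm₀ (Real.exp_pos _) (by norm_num)]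
      linarith [Real.exp_one_gt_d9]
    have h2 := Real.add_one_le_exp (-(q / 2))
    nlinarith
  refine (measure_sum_ge_le m (X := fun z => -A.indicator (fun _ => (1 : ℝ)) z) hi hb).trans_eq ?_
  congr 2
  ring

end Moments

/-! ### Empirical norm dominates population norm on a cone. -/

section RestrictedLowerBound

variable {Ω : Type*} [MeasurableSpace Ω] {P : Measure Ω}

/-- The lower bound on empirical second moments over the cone. -/
def kappa (α₁ α₂ : ℝ) : ℝ := α₂ * α₁ ^ 2 / 64

/-- The squared approximation accuracy of the net. -/
def epsSq (α₁ α₂ : ℝ) : ℝ := min (1 / 4) (kappa α₁ α₂)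

/-- The sample-size constant. -/
def sizeConst (α₁ α₂ : ℝ) : ℝ := 16 * (104 / epsSq α₁ α₂ + 2) / α₂

theorem epsSq_pos {α₁ α₂ : ℝ} (h₁ : 0 < α₁) (h₂ : 0 < α₂) : 0 < epsSq α₁ α₂ := by
  unfold epsSq kappa; positivity

/-- The samples on which the restricted lower bound may fail. -/
def badSet (P : Measure Ω) {d : ℕ} (m N : ℕ) (ψ : Fin d → Ω → ℝ) (ν α₁ α₂ ρ : ℝ) :
    Set (Fin m → Ω) :=
  (⋃ j, {D | m * (24 * ν ^ 2) ≤ ∑ i, ψ j (D i) ^ 2}) ∪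
    ⋃ t : Fin N → Fin d × Bool, {D | m * (-(α₂ / 4)) ≤ ∑ i,
      -({z | α₁ * √(popSq P ψ (netPoint ρ t)) ≤ |linFun ψ (netPoint ρ t) z|} : Set Ω).indicator
        (fun _ => (1 : ℝ)) (D i)}

theorem measurableSet_badSet {d : ℕ} (m N : ℕ) {ψ : Fin d → Ω → ℝ} (hψ : ∀ j, Measurable (ψ j))
    (ν α₁ α₂ ρ : ℝ) : MeasurableSet (badSet P m N ψ ν α₁ α₂ ρ) := by
  refine (MeasurableSet.iUnion fun j => ?_).union (MeasurableSet.iUnion fun t => ?_)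
  · exact measurableSet_le measurable_const (by fun_prop)
  · refine measurableSet_le measurable_const (Finset.measurable_fun_sum _ fun i _ => ?_)
    exact ((measurable_const.indicator (measurableSet_le measurable_const
      (measurable_linFun hψ _).abs)).comp (measurable_pi_apply i)).neg

/-- Union bound over the `d` features and the `(2d)^N` tuples of vertices. The net does not depend
on the sample, so each of its points is a fixed direction. -/
theorem measure_badSet_le [IsProbabilityMeasure P] {d : ℕ} (m N : ℕ) {ψ : Fin d → Ω → ℝ} (hψ : ∀ j, Measurable (ψ j))
    {ν α₁ α₂ ρ : ℝ} (hν : 0 < ν) (hα₂ : 0 < α₂) (hmom : ∀ j, SubGaussianMoments P (ψ j) ν)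
    (hball : ∀ δ, ENNReal.ofReal α₂ ≤ P {z | α₁ * √(popSq P ψ δ) ≤ |linFun ψ δ z|}) :
    (Measure.pi fun _ => P) (badSet P m N ψ ν α₁ α₂ ρ) ≤
      ENNReal.ofReal (d * Real.exp (m * (-1.5)) + (2 * d) ^ N * Real.exp (-(α₂ * m / 4))) := by
  refine (measure_union_le _ _).trans ?_
  rw [ENNReal.ofReal_add (by positivity) (by positivity)]
  refine add_le_add ((measure_iUnion_fintype_le _ _).trans ?_)
    ((measure_iUnion_fintype_le _ _).trans ?_)
  · refine (Finset.sum_le_sum fun j _ => (hmom j).measure_sum_sq_ge_le hν (hψ j) m).trans_eq ?_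
    rw [Finset.sum_const, Finset.card_univ, Fintype.card_fin, nsmul_eq_mul,
      ENNReal.ofReal_mul (by positivity), ENNReal.ofReal_natCast]
  · refine (Finset.sum_le_sum fun t _ => measure_count_le_le
      (measurableSet_le measurable_const (measurable_linFun hψ _).abs) hα₂.le
      (hball (netPoint ρ t)) m).trans_eq ?_
    rw [Finset.sum_const, Finset.card_univ, nsmul_eq_mul, ENNReal.ofReal_mul (by positivity)]
    congr 1
    rw [← ENNReal.ofReal_natCast]
    congr 1
    simp [mul_comm]

/-- More than a fraction `α₂ / 4` of the sample lands where the squared linear form is at least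
`α₁²` times its population mean; all other terms are dropped. -/
theorem empSq_ge_of_notMem_badSet {d m N : ℕ} (hm : 1 ≤ m) {ψ : Fin d → Ω → ℝ}
    {ν α₁ α₂ ρ : ℝ} (hα₁ : 0 < α₁)
    {D : Fin m → Ω} (hD : D ∉ badSet P m N ψ ν α₁ α₂ ρ) (t : Fin N → Fin d × Bool) :
    α₂ / 4 * (α₁ ^ 2 * popSq P ψ (netPoint ρ t)) ≤ empSq ψ D (netPoint ρ t) := by
  have hm0 : (0 : ℝ) < m := by exact_mod_cast hm
  set x := netPoint ρ t with hx
  set A : Set Ω := {z | α₁ * √(popSq P ψ x) ≤ |linFun ψ x z|} with hA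
  have hcount : ∑ i, -A.indicator (fun _ => (1 : ℝ)) (D i) < m * (-(α₂ / 4)) := by
    by_contra! hcon
    exact hD (Or.inr (Set.mem_iUnion.2 ⟨t, hcon⟩))
  rw [Finset.sum_neg_distrib] at hcount
  have hpt : ∀ i, α₁ ^ 2 * popSq P ψ x * A.indicator (fun _ => (1 : ℝ)) (D i) ≤
      linFun ψ x (D i) ^ 2 := by
    intro i
    by_cases hi : D i ∈ A
    · rw [Set.indicator_of_mem hi, mul_one, ← Real.sq_sqrt (popSq_nonneg ψ x), ← mul_pow,
        ← sq_abs (linFun ψ x (D i))]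
      exact pow_le_pow_left₀ (by positivity) hi 2
    · rw [Set.indicator_of_notMem hi, mul_zero]; positivity
  have hsum := Finset.sum_le_sum fun i (_ : i ∈ Finset.univ) => hpt i
  rw [← Finset.mul_sum] at hsum
  unfold empSq
  rw [one_div, inv_mul_eq_div, le_div_iff₀ hm0]
  have h0 : 0 ≤ α₁ ^ 2 * popSq P ψ x := mul_nonneg (sq_nonneg _) (popSq_nonneg _ _)
  nlinarith

/-- The restricted lower bound holds deterministically off the bad set. -/
theorem kappa_mul_popSq_le_empSq {d m N : ℕ} (hd : 1 ≤ d) (hm : 1 ≤ m) (hN : 1 ≤ N)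
    {ψ : Fin d → Ω → ℝ} (hψ : ∀ j, Measurable (ψ j)) {ν α₁ α₂ lam K : ℝ}
    (hα₁ : 0 < α₁) (hα₂ : 0 < α₂) (hlam : 0 < lam) (hK : 0 < K)
    (hmom : ∀ j, SubGaussianMoments P (ψ j) ν)
    (hlow : ∀ δ, lam * ∑ j, δ j ^ 2 ≤ popSq P ψ δ)
    (hNle : 104 * (ν ^ 2 * K / lam) / epsSq α₁ α₂ ≤ N)
    {D : Fin m → Ω} (hD : D ∉ badSet P m N ψ ν α₁ α₂ (2 * √(K / lam)))
    {δ : Fin d → ℝ} (hδ : l1 δ ^ 2 ≤ 4 * K * ∑ j, δ j ^ 2) :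
    kappa α₁ α₂ * popSq P ψ δ ≤ empSq ψ D δ := by
  have hm0 : (0 : ℝ) < m := by exact_mod_cast hm
  have hN0 : (0 : ℝ) < N := by exact_mod_cast hN
  have heps := epsSq_pos hα₁ hα₂
  have hψ2 : ∀ j, MemLp (ψ j) 2 P := fun j => (hmom j).memLp (hψ j)
  -- After scaling to `popSq = 1`, the eigenvalue bound gives `∑ δ j ^ 2 ≤ 1 / lam`, and the cone
  -- condition puts `δ` in the `ℓ₁`-ball of squared radius `4K / lam`.
  set ρ := 2 * √(K / lam) with hρ
  have hρ0 : 0 < ρ := by positivity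
  have hρ2 : ρ ^ 2 = 4 * K / lam := by
    rw [hρ, mul_pow, Real.sq_sqrt (by positivity)]; ring
  rcases (popSq_nonneg (P := P) ψ δ).eq_or_lt with h0 | hpos
  · rw [← h0, mul_zero]; exact empSq_nonneg _ _ _
  set c := (√(popSq P ψ δ))⁻¹ with hc
  have hc0 : 0 < c := by positivity
  have hc2 : c ^ 2 * popSq P ψ δ = 1 := by
    rw [hc, inv_pow, Real.sq_sqrt hpos.le, inv_mul_cancel₀ hpos.ne']
  have hl1 : l1 (c • δ) ≤ ρ := by
    have e1 : l1 (c • δ) = c * l1 δ := by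
      simp [l1, abs_mul, abs_of_pos hc0, Finset.mul_sum]
    refine abs_le_of_sq_le_sq' ?_ hρ0.le |>.2
    rw [e1, mul_pow, hρ2, le_div_iff₀ hlam]
    have h1 := hlow δ
    have h2 : c ^ 2 * l1 δ ^ 2 * lam ≤ c ^ 2 * (4 * K * ∑ j, δ j ^ 2) * lam := by gcongr
    calc _ ≤ _ := h2
      _ = c ^ 2 * (4 * K * (lam * ∑ j, δ j ^ 2)) := by ring
      _ ≤ c ^ 2 * (4 * K * popSq P ψ δ) := by gcongr
      _ = 4 * K * (c ^ 2 * popSq P ψ δ) := by ring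
      _ = 4 * K := by rw [hc2, mul_one]
  -- The population part contributes `2ν²`, the empirical part `24ν²`. Multiplied by `ρ²` this
  -- produces the `104 = 4 * 26` of `hNle`.
  have hb : ∀ j, ∫ z, ψ j z ^ 2 ∂P + (1 / m : ℝ) * ∑ i, ψ j (D i) ^ 2 ≤ 26 * ν ^ 2 := by
    intro j
    have h1 := (hmom j).integral_sq_le (hψ j)
    have h2 : ∑ i, ψ j (D i) ^ 2 < m * (24 * ν ^ 2) := by
      by_contra! hcon
      exact hD (Or.inl (Set.mem_iUnion.2 ⟨j, hcon⟩))
    have h3 : (1 / m : ℝ) * ∑ i, ψ j (D i) ^ 2 ≤ 24 * ν ^ 2 := by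
      rw [one_div, inv_mul_eq_div, div_le_iff₀ hm0]; linarith
    linarith
  obtain ⟨t, ht⟩ := exists_netPoint hd hN hψ2 hρ0 D hb (c • δ) hl1
  have hε : ρ ^ 2 * (26 * ν ^ 2) / N ≤ epsSq α₁ α₂ := by
    rw [div_le_iff₀ heps] at hNle
    rw [div_le_iff₀ hN0, hρ2]
    calc _ = 104 * (ν ^ 2 * K / lam) := by ring
      _ ≤ _ := by linarith
  have hp := popSq_nonneg (P := P) ψ (c • δ - netPoint ρ t)
  have he := empSq_nonneg ψ D (c • δ - netPoint ρ t)
  have h4 : epsSq α₁ α₂ ≤ 1 / 4 := min_le_left _ _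
  have h5 : epsSq α₁ α₂ ≤ kappa α₁ α₂ := min_le_right _ _
  have h6 := popSq_le_two_mul hψ2 (c • δ) (netPoint ρ t)
  have h7 := empSq_le_two_mul ψ D (c • δ) (netPoint ρ t)
  have h8 := empSq_ge_of_notMem_badSet hm hα₁ hD t
  rw [popSq_smul, hc2] at h6
  -- From `1 ≤ 2 popSq + 2 * (1/4)`. The net point then has empirical norm at least `α₂α₁²/16 = 4κ`,
  -- and subtracting `2κ` and halving leaves `κ`: hence the `64` in `kappa` and both entries of the
  -- minimum in `epsSq`.
  have h9 : 1 / 4 ≤ popSq P ψ (netPoint ρ t) := by linarith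
  have h10 : kappa α₁ α₂ ≤ empSq ψ D (c • δ) := by
    have : α₂ / 4 * (α₁ ^ 2 * (1 / 4)) ≤ α₂ / 4 * (α₁ ^ 2 * popSq P ψ (netPoint ρ t)) := by
      gcongr
    have hk : α₂ / 4 * (α₁ ^ 2 * (1 / 4)) = 4 * kappa α₁ α₂ := by unfold kappa; ring
    linarith
  rw [empSq_smul] at h10
  have h11 : kappa α₁ α₂ * popSq P ψ δ ≤ c ^ 2 * empSq ψ D δ * popSq P ψ δ := by gcongr
  calc _ ≤ _ := h11
    _ = c ^ 2 * popSq P ψ δ * empSq ψ D δ := by ring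
    _ = _ := by rw [hc2, one_mul]

/-- The restricted lower bound: with high probability the empirical second moments dominate the
population ones over a cone of approximately sparse directions. -/
theorem exists_badSet [IsProbabilityMeasure P] {d m k : ℕ} (hd : 2 ≤ d) (hm : 1 ≤ m) (hk : 1 ≤ k)
    {ψ : Fin d → Ω → ℝ} (hψ : ∀ j, Measurable (ψ j)) {ν α₁ α₂ lam : ℝ} (hν : 0 < ν)
    (hα₁ : 0 < α₁) (hα₂ : 0 < α₂) (hlam : 0 < lam)
    (hmom : ∀ j, SubGaussianMoments P (ψ j) ν)
    (hlow : ∀ δ, lam * ∑ j, δ j ^ 2 ≤ popSq P ψ δ)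
    (hball : ∀ δ, ENNReal.ofReal α₂ ≤ P {z | α₁ * √(popSq P ψ δ) ≤ |linFun ψ δ z|})
    (hlog : 2 * Real.log d ≤ m)
    (hsize : sizeConst α₁ α₂ * (ν ^ 2 * k * Real.log d / lam) ≤ m) :
    ∃ bad : Set (Fin m → Ω), MeasurableSet bad ∧
      (Measure.pi fun _ => P) bad ≤ ENNReal.ofReal (2 * Real.exp (-(α₂ * m / 8))) ∧
      ∀ D ∉ bad, ∀ δ : Fin d → ℝ, l1 δ ^ 2 ≤ 4 * k * ∑ j, δ j ^ 2 →
        kappa α₁ α₂ * popSq P ψ δ ≤ empSq ψ D δ := by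
  have hm0 : (0 : ℝ) < m := by exact_mod_cast hm
  have hk0 : (1 : ℝ) ≤ k := by exact_mod_cast hk
  have hd0 : (2 : ℝ) ≤ d := by exact_mod_cast hd
  have hL := log_two_le_log hd
  have heps := epsSq_pos hα₁ hα₂
  have hα₂1 : α₂ ≤ 1 := by
    have := (hball 0).trans prob_le_one
    simpa using this
  -- Testing on a coordinate vector. It gives `a ≥ 1/2`, so rounding `N` up costs at most `2a`, the
  -- `+ 2` in `sizeConst`.
  have hlamν : lam ≤ 2 * ν ^ 2 := by
    have h1 := hlow (vertex 1 (⟨0, by omega⟩, true))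
    have h2 := (hmom ⟨0, by omega⟩).integral_sq_le (hψ _)
    simp only [popSq, linFun_vertex_sq, one_pow, one_mul] at h1
    have h3 : ∑ j, (vertex (d := d) 1 (⟨0, by omega⟩, true)) j ^ 2 = 1 := by
      simp [vertex, Pi.single_apply]
    rw [h3] at h1
    linarith
  set a := ν ^ 2 * k / lam with ha
  have ha2 : 1 / 2 ≤ a := by
    rw [ha, le_div_iff₀ hlam]
    nlinarith [sq_nonneg ν]
  set N := ⌈104 * a / epsSq α₁ α₂⌉₊ with hNdef
  have hN1 : 1 ≤ N := Nat.one_le_ceil_iff.2 (by positivity)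
  have hNle : 104 * a / epsSq α₁ α₂ ≤ N := Nat.le_ceil _
  have hNup : (N : ℝ) ≤ (104 / epsSq α₁ α₂ + 2) * a := by
    have := (Nat.ceil_lt_add_one (show 0 ≤ 104 * a / epsSq α₁ α₂ by positivity)).le
    calc (N : ℝ) ≤ _ := this
      _ ≤ 104 * a / epsSq α₁ α₂ + 2 * a := by linarith
      _ = _ := by ring
  refine ⟨badSet P m N ψ ν α₁ α₂ (2 * √(k / lam)), measurableSet_badSet m N hψ _ _ _ _,
    (measure_badSet_le m N hψ hν hα₂ hmom hball).trans (ENNReal.ofReal_le_ofReal ?_),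
    fun D hD δ hδ => kappa_mul_popSq_le_empSq (by omega) hm hN1 hψ hα₁ hα₂ hlam (by positivity)
      hmom hlow hNle hD hδ⟩
  -- The net has `(2d)^N ≤ exp (2 N log d)` points because `2d ≤ d²`; the factor `16 / α₂` in
  -- `sizeConst` lets this use at most half of the exponent `α₂ m / 4`.
  have hNL : 2 * (N * Real.log d) ≤ α₂ * m / 8 := by
    have h1 : (N : ℝ) * Real.log d ≤ (104 / epsSq α₁ α₂ + 2) * a * Real.log d := by gcongr
    have h2 : sizeConst α₁ α₂ * (ν ^ 2 * k * Real.log d / lam) =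
        16 / α₂ * ((104 / epsSq α₁ α₂ + 2) * a * Real.log d) := by
      unfold sizeConst; rw [ha]; ring
    rw [h2, div_mul_eq_mul_div, div_le_iff₀ hα₂] at hsize
    linarith
  have e1 : (d : ℝ) * Real.exp (m * (-1.5)) ≤ Real.exp (-(α₂ * m / 8)) := by
    calc (d : ℝ) * Real.exp (m * (-1.5)) = Real.exp (Real.log d + m * (-1.5)) := by
          rw [Real.exp_add, Real.exp_log (by linarith)]
      _ ≤ _ := Real.exp_le_exp.2 (by nlinarith)
  have e2 : (2 * d : ℝ) ^ N * Real.exp (-(α₂ * m / 4)) ≤ Real.exp (-(α₂ * m / 8)) := by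
    have h1 : (2 * d : ℝ) ^ N ≤ Real.exp (2 * (N * Real.log d)) := by
      calc (2 * d : ℝ) ^ N ≤ (d ^ 2 : ℝ) ^ N := by
            gcongr; nlinarith
        _ = Real.exp (N * (2 * Real.log d)) := by
            rw [Real.exp_nat_mul, mul_comm 2, Real.exp_mul, Real.exp_log (by linarith)]
            norm_num
        _ = _ := by congr 1; ring
    calc _ ≤ Real.exp (2 * (N * Real.log d)) * Real.exp (-(α₂ * m / 4)) := by gcongr
      _ = Real.exp (2 * (N * Real.log d) + -(α₂ * m / 4)) := by rw [Real.exp_add]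
      _ ≤ _ := Real.exp_le_exp.2 (by linarith)
  linarith

end RestrictedLowerBound

/-! ### Oracle inequality for `ℓ₁`-constrained least squares. -/

section Regression

theorem l0_eq_card {d : ℕ} (θ : Fin d → ℝ) :
    l0 θ = (Finset.univ.filter fun j => θ j ≠ 0).card := by
  rw [l0, Set.ncard_eq_toFinset_card']
  congr 1
  ext j
  simp

theorem l1_nonneg {d : ℕ} (θ : Fin d → ℝ) : 0 ≤ l1 θ :=
  Finset.sum_nonneg fun _ _ => abs_nonneg _

theorem sum_sq_le_l1_sq {d : ℕ} (θ : Fin d → ℝ) : ∑ j, θ j ^ 2 ≤ l1 θ ^ 2 := by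
  have h := Finset.sum_sq_le_sq_sum_of_nonneg (s := Finset.univ) (f := fun j => |θ j|)
    fun j _ => abs_nonneg _
  simp only [sq_abs] at h
  exact h

theorem l1_le_of_add_le {d : ℕ} {θ δ : Fin d → ℝ} {R : ℝ} (hθ : l1 θ = R)
    (h : l1 (θ + δ) ≤ R) : l1 δ ≤ 2 * R := by
  have h1 : l1 δ ≤ l1 (θ + δ) + l1 θ := by
    unfold l1
    rw [← Finset.sum_add_distrib]
    refine Finset.sum_le_sum fun j _ => ?_
    have := abs_sub (θ j + δ j) (θ j)
    simpa using this
  linarith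

/-- The error of an estimator in the `ℓ₁`-ball lies in a cone of approximately sparse vectors. -/
theorem l1_sq_le_of_add_le {d : ℕ} {θ δ : Fin d → ℝ} (h : l1 (θ + δ) ≤ l1 θ) :
    l1 δ ^ 2 ≤ 4 * l0 θ * ∑ j, δ j ^ 2 := by
  classical
  set S := Finset.univ.filter fun j => θ j ≠ 0 with hS
  have hsplit : ∀ f : Fin d → ℝ, ∑ j, f j = ∑ j ∈ S, f j + ∑ j ∈ Sᶜ, f j :=
    fun f => (Finset.sum_add_sum_compl S f).symm
  have hc : ∀ j ∈ Sᶜ, θ j = 0 := by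
    intro j hj
    by_contra hne
    simp [hS, hne] at hj
  have e1 : ∑ j ∈ Sᶜ, |θ j| = 0 := Finset.sum_eq_zero fun j hj => by rw [hc j hj, abs_zero]
  have e2 : ∑ j ∈ Sᶜ, |(θ + δ) j| = ∑ j ∈ Sᶜ, |δ j| :=
    Finset.sum_congr rfl fun j hj => by rw [Pi.add_apply, hc j hj, zero_add]
  have e3 : ∑ j ∈ S, |θ j| ≤ ∑ j ∈ S, |(θ + δ) j| + ∑ j ∈ S, |δ j| := by
    rw [← Finset.sum_add_distrib]
    refine Finset.sum_le_sum fun j _ => ?_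
    have := abs_sub ((θ + δ) j) (δ j)
    simpa using this
  have hl : l1 δ ≤ 2 * ∑ j ∈ S, |δ j| := by
    unfold l1 at h ⊢
    rw [hsplit, hsplit (fun j => |θ j|), e1, e2] at h
    rw [hsplit]
    linarith
  have hcs := sq_sum_le_card_mul_sum_sq (s := S) (f := fun j => |δ j|)
  simp only [sq_abs] at hcs
  have hsub : ∑ j ∈ S, δ j ^ 2 ≤ ∑ j, δ j ^ 2 :=
    Finset.sum_le_sum_of_subset_of_nonneg (Finset.subset_univ _) fun _ _ _ => sq_nonneg _
  rw [l0_eq_card]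
  calc l1 δ ^ 2 ≤ (2 * ∑ j ∈ S, |δ j|) ^ 2 := pow_le_pow_left₀ (l1_nonneg δ) hl 2
    _ = 4 * (∑ j ∈ S, |δ j|) ^ 2 := by ring
    _ ≤ 4 * (S.card * ∑ j ∈ S, δ j ^ 2) := by gcongr
    _ ≤ 4 * (S.card * ∑ j, δ j ^ 2) := by gcongr
    _ = _ := by ring

theorem one_le_l0 {d : ℕ} {θ : Fin d → ℝ} {R : ℝ} (hR : 0 < R) (hθ : l1 θ = R) : 1 ≤ l0 θ := by
  rw [l0_eq_card, Nat.one_le_iff_ne_zero, Finset.card_ne_zero]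
  by_contra hne
  rw [Finset.not_nonempty_iff_eq_empty, Finset.filter_eq_empty_iff] at hne
  have : l1 θ = 0 := Finset.sum_eq_zero fun j hj => by simpa using hne hj
  linarith

/-- The basic inequality of least squares, combined with a restricted lower bound. -/
theorem popSq_le_of_basic_inequality {d m : ℕ} (hd : 0 < d) {S : Type*} {ψ : Fin d → S → ℝ}
    (D : Fin m → S) (e b : S → ℝ) {δ : Fin d → ℝ} {κ lam G U : ℝ} {s : ℕ} (hκ : 0 < κ)
    (hlam : 0 < lam) (hs : 1 ≤ s)
    (hlow : lam * ∑ j, δ j ^ 2 ≤ G) (hcone : l1 δ ^ 2 ≤ 4 * s * ∑ j, δ j ^ 2)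
    (hrest : κ * G ≤ empSq ψ D δ)
    (hU : ∀ j, ((1 / m : ℝ) * ∑ i, e (D i) * ψ j (D i)) ^ 2 ≤ U)
    (hmin : ∑ i, (linFun ψ δ (D i) - (e (D i) + b (D i))) ^ 2 ≤ ∑ i, (e (D i) + b (D i)) ^ 2) :
    G ≤ 64 * s / (κ ^ 2 * lam) * U + 8 / κ * ((1 / m : ℝ) * ∑ i, b (D i) ^ 2) := by
  have hs0 : (0 : ℝ) < s := by exact_mod_cast hs
  have hU0 : 0 ≤ U := (sq_nonneg _).trans (hU ⟨0, hd⟩)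
  have hm0 : (0 : ℝ) ≤ 1 / m := by positivity
  -- The bias `b` need not be orthogonal to the features, so its cross term is absorbed by `2xb ≤
  -- x²/2 + 2b²`; only the noise cross term is kept for `ℓ₁`-`ℓ_∞` duality.
  have h1 : ∑ i, linFun ψ δ (D i) ^ 2 ≤
      4 * ∑ i, linFun ψ δ (D i) * e (D i) + 4 * ∑ i, b (D i) ^ 2 := by
    have hpt : ∑ i, (linFun ψ δ (D i) ^ 2 - 4 * (linFun ψ δ (D i) * e (D i)) - 4 * b (D i) ^ 2) ≤
        2 * ∑ i, ((linFun ψ δ (D i) - (e (D i) + b (D i))) ^ 2 - (e (D i) + b (D i)) ^ 2) := by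
      rw [Finset.mul_sum]
      refine Finset.sum_le_sum fun i _ => ?_
      nlinarith [sq_nonneg (linFun ψ δ (D i) - 2 * b (D i))]
    rw [Finset.sum_sub_distrib, Finset.sum_sub_distrib, Finset.sum_sub_distrib,
      ← Finset.mul_sum, ← Finset.mul_sum] at hpt
    linarith
  have h2 : (1 / m : ℝ) * ∑ i, linFun ψ δ (D i) * e (D i) ≤ l1 δ * √U := by
    have : (1 / m : ℝ) * ∑ i, linFun ψ δ (D i) * e (D i) =
        ∑ j, δ j * ((1 / m : ℝ) * ∑ i, e (D i) * ψ j (D i)) := by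
      simp only [linFun, Finset.sum_mul, Finset.mul_sum]
      rw [Finset.sum_comm]
      refine Finset.sum_congr rfl fun j _ => Finset.sum_congr rfl fun i _ => by ring
    rw [this, l1, Finset.sum_mul]
    refine Finset.sum_le_sum fun j _ => ?_
    refine (le_abs_self _).trans ?_
    rw [abs_mul]
    gcongr
    exact Real.abs_le_sqrt (hU j)
  have h3 : κ * G ≤ 4 * (l1 δ * √U) + 4 * ((1 / m : ℝ) * ∑ i, b (D i) ^ 2) := by
    refine hrest.trans ?_
    unfold empSq
    have := mul_le_mul_of_nonneg_left h1 hm0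
    linarith
  have h4 : l1 δ ^ 2 ≤ 4 * s * (G / lam) := by
    refine hcone.trans ?_
    gcongr
    rw [le_div_iff₀ hlam]; linarith
  have h5 : 4 * (l1 δ * √U) ≤ κ / 2 * G + 32 * s / (κ * lam) * U := by
    have hsq : √U ^ 2 = U := Real.sq_sqrt hU0
    -- The AM-GM weight for which the cone condition turns `a * l1 δ ^ 2` into exactly half of `κ *
    -- G`.
    set a := κ * lam / (8 * s) with ha
    have ha0 : 0 < a := by positivity
    have h6 : 4 * (l1 δ * √U) ≤ a * l1 δ ^ 2 + 4 / a * √U ^ 2 := by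
      have h7 : a * l1 δ ^ 2 + 4 / a * √U ^ 2 - 4 * (l1 δ * √U) = (a * l1 δ - 2 * √U) ^ 2 / a := by
        field_simp; ring
      have : 0 ≤ (a * l1 δ - 2 * √U) ^ 2 / a := by positivity
      linarith
    have h8 : a * l1 δ ^ 2 ≤ κ / 2 * G := by
      calc a * l1 δ ^ 2 ≤ a * (4 * s * (G / lam)) := by gcongr
        _ = _ := by rw [ha]; field_simp; ring
    have h9 : 4 / a * √U ^ 2 = 32 * s / (κ * lam) * U := by
      rw [hsq, ha]; field_simp; ring
    linarith
  have h10 : κ / 2 * G ≤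
      κ / 2 * (64 * s / (κ ^ 2 * lam) * U + 8 / κ * ((1 / m : ℝ) * ∑ i, b (D i) ^ 2)) := by
    have : κ / 2 * (64 * s / (κ ^ 2 * lam) * U + 8 / κ * ((1 / m : ℝ) * ∑ i, b (D i) ^ 2)) =
        32 * s / (κ * lam) * U + 4 * ((1 / m : ℝ) * ∑ i, b (D i) ^ 2) := by
      field_simp; ring
    linarith
  exact le_of_mul_le_mul_left h10 (by positivity)

variable {Ω : Type*} [MeasurableSpace Ω] {P : Measure Ω} [IsProbabilityMeasure P]

theorem lintegral_mean_pi {m : ℕ} (hm : 1 ≤ m) {f : Ω → ℝ} (hf : Measurable f)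
    (h0 : ∀ z, 0 ≤ f z) :
    ∫⁻ D : Fin m → Ω, ENNReal.ofReal ((1 / m : ℝ) * ∑ i, f (D i)) ∂(Measure.pi fun _ => P) =
      ∫⁻ z, ENNReal.ofReal (f z) ∂P := by
  have hm0 : (0 : ℝ) < m := by exact_mod_cast hm
  have h1 : ∀ D : Fin m → Ω, ENNReal.ofReal ((1 / m : ℝ) * ∑ i, f (D i)) =
      ENNReal.ofReal (1 / m) * ∑ i, ENNReal.ofReal (f (D i)) := fun D => by
    rw [ENNReal.ofReal_mul (by positivity), ENNReal.ofReal_sum_of_nonneg fun i _ => h0 _]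
  have h2 : ∀ i : Fin m, ∫⁻ D : Fin m → Ω, ENNReal.ofReal (f (D i)) ∂(Measure.pi fun _ => P) =
      ∫⁻ z, ENNReal.ofReal (f z) ∂P := fun i =>
    (measurePreserving_eval (fun _ : Fin m => P) i).lintegral_comp
      (f := fun z => ENNReal.ofReal (f z)) (by fun_prop)
  simp_rw [h1]
  rw [lintegral_const_mul _ (by fun_prop), lintegral_finsetSum _ fun i _ => by fun_prop]
  simp_rw [h2]
  rw [Finset.sum_const, Finset.card_univ, Fintype.card_fin, nsmul_eq_mul, ← mul_assoc,
    ← ENNReal.ofReal_natCast, ← ENNReal.ofReal_mul (by positivity), one_div,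
    inv_mul_cancel₀ hm0.ne', ENNReal.ofReal_one, one_mul]

/-- The constant in the sample-size condition. -/
def sampleConst (α₁ α₂ : ℝ) : ℝ := 3 * sizeConst α₁ α₂

/-- The constant in the oracle inequality. -/
def oracleConst (α₁ α₂ : ℝ) : ℝ :=
  8 / kappa α₁ α₂ + (512000 / kappa α₁ α₂ ^ 2 + 400 / α₂ + 6 * sampleConst α₁ α₂)

/-- A dichotomy on the scale: either the trivial bound on the error is sufficient, or the sample
size is large in comparison with every term of the sample-size condition. -/
theorem scale_dichotomy {c₀ A w n : ℝ} (hc₀ : 0 < c₀) (hA : 0 ≤ A) (hw : 0 < w) (hn : 0 < n)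
    (h : c₀ * (A + Real.log w) ≤ n) :
    n * w ^ 2 ≤ c₀ ∨ (c₀ * A ≤ 3 / 2 * n ∧ w ^ 2 ≤ Real.exp (2 * n / c₀)) := by
  rcases le_or_gt (n * w ^ 2) c₀ with h1 | h1
  · exact Or.inl h1
  · right
    -- `log w` may be negative and offset `A` in the hypothesis. But `n w² > c₀` forces `log w ≥ -n
    -- / (2c₀)`, so it offsets at most half of `n`.
    have h2 : Real.log (c₀ / n) ≤ 2 * Real.log w := by
      have : c₀ / n ≤ w ^ 2 := by rw [div_le_iff₀ hn]; linarith
      have h3 := Real.log_le_log (by positivity) this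
      rwa [Real.log_pow] at h3
    have h4 : Real.log (n / c₀) ≤ n / c₀ := Real.log_le_self (by positivity)
    have h5 : Real.log (c₀ / n) = -Real.log (n / c₀) := by rw [← Real.log_inv, inv_div]
    have h6 : c₀ * (n / c₀) = n := by field_simp
    constructor
    · nlinarith
    · rw [← Real.exp_log hw, ← Real.exp_nat_mul]
      apply Real.exp_le_exp.2
      rw [le_div_iff₀ hc₀]
      push_cast
      nlinarith

/-- The exceptional event: the scale `w²` uses at most half of the exponent of its probability, and
`exp (-u) ≤ 1 / u` turns the other half into the rate `1 / n`. -/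
theorem sq_mul_exp_le {α₂ S c₀ w n x : ℝ} (hα₂ : 0 < α₂) (hS : 32 / α₂ ≤ S) (hc₀ : c₀ = 3 * S)
    (hx : 0 < x) (hn : n = 2 * x) (hw : w ^ 2 ≤ Real.exp (2 * n / c₀)) :
    w ^ 2 * Real.exp (-(α₂ * x / 8)) ≤ 32 / α₂ / n := by
  have hS0 : 0 < S := lt_of_lt_of_le (by positivity) hS
  have h1 : 2 * n / c₀ ≤ α₂ * x / 16 := by
    rw [div_le_iff₀ (by positivity)] at hS
    rw [hc₀, hn, div_le_iff₀ (by positivity)]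
    have h2 : 32 * x ≤ S * α₂ * x := by gcongr
    linarith
  have h3 : w ^ 2 ≤ Real.exp (α₂ * x / 16) := hw.trans (Real.exp_le_exp.2 h1)
  calc w ^ 2 * Real.exp (-(α₂ * x / 8))
      ≤ Real.exp (α₂ * x / 16) * Real.exp (-(α₂ * x / 8)) := by gcongr
    _ = (Real.exp (α₂ * x / 16))⁻¹ := by
        rw [← Real.exp_add, ← Real.exp_neg]
        congr 1
        ring
    _ ≤ (α₂ * x / 16)⁻¹ := by
        gcongr
        linarith [Real.add_one_le_exp (α₂ * x / 16)]
    _ = 32 / α₂ / n := by rw [hn]; field_simp; norm_num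

set_option maxHeartbeats 800000 in
/-- The oracle inequality for least squares over an `ℓ₁`-ball, under the small-ball condition. -/
theorem lintegral_popSq_le {d m k : ℕ} (hd : 2 ≤ d) (hm : 1 ≤ m) (hk : 1 ≤ k)
    {ψ : Fin d → Ω → ℝ} (hψ : ∀ j, Measurable (ψ j)) {e b : Ω → ℝ} (he : Measurable e)
    (hb : Measurable b) {σ ν α₁ α₂ lam Lam R : ℝ} (hσ : 0 < σ) (hν : 0 < ν)
    (hα₁ : 0 < α₁) (hα₂ : 0 < α₂) (hlam : 0 < lam) (hR : 0 < R)
    (hmom : ∀ j, SubGaussianMoments P (ψ j) ν) (hmome : SubGaussianMoments P e σ)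
    (horth : ∀ j, ∫ z, e z * ψ j z ∂P = 0)
    (hlow : ∀ δ, lam * ∑ j, δ j ^ 2 ≤ popSq P ψ δ)
    (hup : ∀ δ, popSq P ψ δ ≤ Lam * ∑ j, δ j ^ 2)
    (hball : ∀ δ, ENNReal.ofReal α₂ ≤ P {z | α₁ * √(popSq P ψ δ) ≤ |linFun ψ δ z|})
    (hsize : sampleConst α₁ α₂ * (ν ^ 2 * k * Real.log d / lam + Real.log d ^ 2 +
      Real.log (R * Lam / (σ * ν))) ≤ ((m + m : ℕ) : ℝ))
    {θ : Fin d → ℝ} (hθ : l1 θ = R) (hθk : l0 θ ≤ k) {δ : (Fin m → Ω) → Fin d → ℝ}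
    (hδ : ∀ D, l1 (θ + δ D) ≤ R)
    (hmin : ∀ D, ∑ i, (linFun ψ (δ D) (D i) - (e (D i) + b (D i))) ^ 2 ≤
      ∑ i, (e (D i) + b (D i)) ^ 2) :
    ∫⁻ D, ENNReal.ofReal (popSq P ψ (δ D)) ∂(Measure.pi fun _ => P) ≤
      ENNReal.ofReal (oracleConst α₁ α₂) * (∫⁻ z, ENNReal.ofReal (b z ^ 2) ∂P +
        ENNReal.ofReal (σ ^ 2 * l0 θ * Real.log d / ((m + m : ℕ) : ℝ) * (ν ^ 2 / lam))) := by
  have hm0 : (0 : ℝ) < m := by exact_mod_cast hm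
  have hL := log_two_le_log hd
  have hs1 := one_le_l0 hR hθ
  have hs : (1 : ℝ) ≤ l0 θ := by exact_mod_cast hs1
  have heps := epsSq_pos hα₁ hα₂
  have hκ : 0 < kappa α₁ α₂ := by unfold kappa; positivity
  have hα₂1 : α₂ ≤ 1 := by simpa using (hball 0).trans prob_le_one
  set s := l0 θ
  set L := Real.log d with hLdef
  set κ := kappa α₁ α₂ with hκdef
  have hsc : 32 / α₂ ≤ sizeConst α₁ α₂ := by
    unfold sizeConst
    have : 0 ≤ 104 / epsSq α₁ α₂ := by positivity
    gcongr
    linarith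
  have hsc32 : (32 : ℝ) ≤ sizeConst α₁ α₂ := by
    refine le_trans ?_ hsc
    rw [le_div_iff₀ hα₂]; linarith
  set c₀ := sampleConst α₁ α₂ with hc₀
  have hc₀' : c₀ = 3 * sizeConst α₁ α₂ := rfl
  have hc₀pos : 0 < c₀ := by linarith
  have hLam : lam ≤ Lam := by
    have h1 := (hlow (vertex 1 (⟨0, by omega⟩, true))).trans (hup _)
    have h3 : ∑ j, (vertex (d := d) 1 (⟨0, by omega⟩, true)) j ^ 2 = 1 := by
      simp [vertex, Pi.single_apply]
    rwa [h3, mul_one, mul_one] at h1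
  have hLam0 : 0 < Lam := hlam.trans_le hLam
  set n : ℝ := ((m + m : ℕ) : ℝ) with hn
  have hnm : n = 2 * m := by rw [hn]; push_cast; ring
  have hn0 : 0 < n := by rw [hnm]; positivity
  set w := R * Lam / (σ * ν) with hw
  have hw0 : 0 < w := by positivity
  have hRw : R ^ 2 * Lam ≤ w ^ 2 * (σ ^ 2 * (ν ^ 2 / lam)) := by
    have : R ^ 2 * Lam = w ^ 2 * (σ ^ 2 * (ν ^ 2 / Lam)) := by rw [hw]; field_simp
    rw [this]
    gcongr
  set rate := σ ^ 2 * s * L / n * (ν ^ 2 / lam) with hrate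
  have hrate0 : 0 ≤ rate := by positivity
  -- `s ≥ 1` and `L ≥ 0.69` give `1.5 * s * L ≥ 1`, so terms lacking the factor `s * L` are still of
  -- the order of `rate`.
  have hrate1 : σ ^ 2 * (ν ^ 2 / lam) / n ≤ 1.5 * rate := by
    have h1 : 1 ≤ 1.5 * (s * L) := by nlinarith
    calc σ ^ 2 * (ν ^ 2 / lam) / n = 1 * (σ ^ 2 * (ν ^ 2 / lam) / n) := by ring
      _ ≤ 1.5 * (s * L) * (σ ^ 2 * (ν ^ 2 / lam) / n) := by gcongr
      _ = _ := by rw [hrate]; ring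
  have htriv : ∀ D, popSq P ψ (δ D) ≤ 4 * (R ^ 2 * Lam) := by
    intro D
    have h1 := l1_le_of_add_le hθ (hδ D)
    have h2 := pow_le_pow_left₀ (l1_nonneg _) h1 2
    calc popSq P ψ (δ D) ≤ Lam * ∑ j, δ D j ^ 2 := hup _
      _ ≤ Lam * l1 (δ D) ^ 2 := by gcongr; exact sum_sq_le_l1_sq _
      _ ≤ Lam * (2 * R) ^ 2 := by gcongr
      _ = _ := by ring
  rw [mul_add, ← ENNReal.ofReal_mul (by unfold oracleConst; positivity)]
  -- In the first case the trivial bound `4R²Lam` is already at most `6 c₀ rate`, the source of the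
  -- last term of `oracleConst`. In the second, `3n/2 = 3m` explains the factor three in
  -- `sampleConst`.
  rcases scale_dichotomy hc₀pos (by positivity) hw0 hn0 hsize with hcase | ⟨hcase1, hcase2⟩
  · refine le_trans ?_ (le_add_left le_rfl)
    refine (lintegral_mono (g := fun _ => ENNReal.ofReal (oracleConst α₁ α₂ * rate))
      fun D => ENNReal.ofReal_le_ofReal ((htriv D).trans ?_)).trans_eq (by simp)
    have h1 : w ^ 2 * (σ ^ 2 * (ν ^ 2 / lam)) ≤ c₀ * (1.5 * rate) := by
      calc _ = (n * w ^ 2) * (σ ^ 2 * (ν ^ 2 / lam) / n) := by field_simp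
        _ ≤ c₀ * (1.5 * rate) := by gcongr
    have h2 : 6 * c₀ * rate ≤ oracleConst α₁ α₂ * rate := by
      gcongr
      unfold oracleConst
      have : 0 ≤ 8 / kappa α₁ α₂ := by positivity
      have : 0 ≤ 512000 / kappa α₁ α₂ ^ 2 := by positivity
      have : 0 ≤ 400 / α₂ := by positivity
      linarith
    linarith
  · have hA : 0 ≤ ν ^ 2 * k * L / lam := by positivity
    have hsize1 : sizeConst α₁ α₂ * (ν ^ 2 * k * L / lam) ≤ m := by
      have : 0 ≤ sizeConst α₁ α₂ * L ^ 2 := by positivity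
      rw [hc₀', hnm] at hcase1
      linarith
    -- Here the `log² d` term of the sample-size condition is used, with one factor `L` bounded
    -- below.
    have hlog2 : 2 * L ≤ m := by
      have h1 : 0 ≤ sizeConst α₁ α₂ * (ν ^ 2 * k * L / lam) := by positivity
      have h2 : 32 * L ^ 2 ≤ sizeConst α₁ α₂ * L ^ 2 := by gcongr
      rw [hc₀', hnm] at hcase1
      nlinarith
    obtain ⟨bad, hbadm, hbad, hgood⟩ := exists_badSet hd hm hk hψ hν hα₁ hα₂ hlam hmom hlow hball
      hlog2 hsize1
    obtain ⟨U, hUm, hU, hUint⟩ := exists_sq_mean_bound (P := P) (m := m) hd hm (by linarith)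
      (K := 2 * σ * ν) (by positivity) (X := fun j z => e z * ψ j z) (fun j => he.mul (hψ j))
      (fun j => hmome.lintegral_mul_le hσ hν (hmom j) he (hψ j)) horth
    have hpt : ∀ D, ENNReal.ofReal (popSq P ψ (δ D)) ≤
        ENNReal.ofReal (64 * s / (κ ^ 2 * lam)) * ENNReal.ofReal (U D) +
          ENNReal.ofReal (8 / κ) * ENNReal.ofReal ((1 / m : ℝ) * ∑ i, b (D i) ^ 2) +
          bad.indicator (fun _ => ENNReal.ofReal (4 * (R ^ 2 * Lam))) D := by
      intro D
      by_cases hD : D ∈ bad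
      · rw [Set.indicator_of_mem hD]
        exact (ENNReal.ofReal_le_ofReal (htriv D)).trans le_add_self
      · rw [Set.indicator_of_notMem hD, add_zero]
        have hU0 : 0 ≤ U D := (sq_nonneg _).trans (hU D ⟨0, by omega⟩)
        rw [← ENNReal.ofReal_mul (by positivity), ← ENNReal.ofReal_mul (by positivity),
          ← ENNReal.ofReal_add (by positivity) (by positivity)]
        apply ENNReal.ofReal_le_ofReal
        have hcone := l1_sq_le_of_add_le ((hδ D).trans_eq hθ.symm)
        refine popSq_le_of_basic_inequality (by omega) D e b hκ hlam hs1 (hlow _) hcone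
          (hgood D hD _ (hcone.trans ?_)) (hU D) (hmin D)
        gcongr
    refine (lintegral_mono hpt).trans ?_
    rw [lintegral_add_left (by fun_prop), lintegral_add_left (by fun_prop),
      lintegral_const_mul _ (by fun_prop), lintegral_const_mul _ (by fun_prop),
      lintegral_mean_pi hm (f := fun z => b z ^ 2) (by fun_prop) fun _ => sq_nonneg _,
      lintegral_indicator_const hbadm]
    have hT1 : ENNReal.ofReal (64 * s / (κ ^ 2 * lam)) *
        ∫⁻ D, ENNReal.ofReal (U D) ∂(Measure.pi fun _ => P) ≤
        ENNReal.ofReal (512000 / κ ^ 2 * rate) := by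
      refine (mul_le_mul_right hUint _).trans_eq ?_
      rw [← ENNReal.ofReal_mul (by positivity)]
      congr 1
      rw [hrate, hnm]
      field_simp
      ring
    have hT3 : ENNReal.ofReal (4 * (R ^ 2 * Lam)) * (Measure.pi fun _ => P) bad ≤
        ENNReal.ofReal (400 / α₂ * rate) := by
      refine (mul_le_mul_right hbad _).trans ?_
      rw [← ENNReal.ofReal_mul (by positivity)]
      apply ENNReal.ofReal_le_ofReal
      have h3 : w ^ 2 * Real.exp (-(α₂ * m / 8)) ≤ 32 / α₂ / n :=
        sq_mul_exp_le hα₂ hsc hc₀' hm0 hnm hcase2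
      calc 4 * (R ^ 2 * Lam) * (2 * Real.exp (-(α₂ * m / 8)))
          ≤ 4 * (w ^ 2 * (σ ^ 2 * (ν ^ 2 / lam))) * (2 * Real.exp (-(α₂ * m / 8))) := by gcongr
        _ = 8 * (σ ^ 2 * (ν ^ 2 / lam)) * (w ^ 2 * Real.exp (-(α₂ * m / 8))) := by ring
        _ ≤ 8 * (σ ^ 2 * (ν ^ 2 / lam)) * (32 / α₂ / n) := by gcongr
        _ = 256 / α₂ * (σ ^ 2 * (ν ^ 2 / lam) / n) := by ring
        _ ≤ 256 / α₂ * (1.5 * rate) := by gcongr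
        _ = 384 / α₂ * rate := by ring
        _ ≤ 400 / α₂ * rate := by gcongr; norm_num
    have hT2 : ENNReal.ofReal (8 / κ) ≤ ENNReal.ofReal (oracleConst α₁ α₂) := by
      apply ENNReal.ofReal_le_ofReal
      unfold oracleConst
      rw [← hκdef, le_add_iff_nonneg_right]
      positivity
    calc _ ≤ ENNReal.ofReal (512000 / κ ^ 2 * rate) +
          ENNReal.ofReal (oracleConst α₁ α₂) * ∫⁻ z, ENNReal.ofReal (b z ^ 2) ∂P +
          ENNReal.ofReal (400 / α₂ * rate) := by gcongr
      _ = ENNReal.ofReal (oracleConst α₁ α₂) * ∫⁻ z, ENNReal.ofReal (b z ^ 2) ∂P +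
          ENNReal.ofReal (512000 / κ ^ 2 * rate + 400 / α₂ * rate) := by
          rw [ENNReal.ofReal_add (by positivity) (by positivity)]; ring
      _ ≤ _ := by
          gcongr
          have h1 : 0 ≤ 8 / κ * rate := by positivity
          have h2 : 0 ≤ 6 * c₀ * rate := by positivity
          unfold oracleConst
          rw [← hκdef, ← hc₀]
          linarith

end Regression

/-! ### Second moment of a cross-fitted sum. -/

section CrossFitting

variable {Ω : Type*} [MeasurableSpace Ω] {P : Measure Ω}

/-- The error terms produced by a correction `V` that is fitted on an independent sample. -/
structure IsCentredCorrection (P : Measure Ω) (W : Ω → ℝ) {m : ℕ} (V : (Fin m → Ω) → Ω → ℝ) :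
    Prop where
  measurable : Measurable fun q : (Fin m → Ω) × Ω => V q.1 q.2
  memLp : ∀ D, MemLp (V D) 2 P
  integral_eq_zero : ∀ D, ∫ z, V D z ∂P = 0
  integral_mul_eq_zero : ∀ D, ∫ z, V D z * W z ∂P = 0
  lintegral_lt_top : ∫⁻ D, ∫⁻ z, ENNReal.ofReal (V D z ^ 2) ∂P ∂(Measure.pi fun _ => P) < ⊤

variable {W : Ω → ℝ} {m : ℕ} {V : (Fin m → Ω) → Ω → ℝ}

theorem IsCentredCorrection.measurable_sum (hV : IsCentredCorrection P W V) :
    Measurable fun q : (Fin m → Ω) × (Fin m → Ω) => ∑ i, V q.1 (q.2 i) :=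
  Finset.measurable_fun_sum _ fun i _ =>
    hV.measurable.comp (measurable_fst.prodMk ((measurable_pi_apply i).comp measurable_snd))

variable [IsProbabilityMeasure P]

theorem memLp_comp_eval {u : Ω → ℝ} (hu : MemLp u 2 P) (i : Fin m) :
    MemLp (fun D : Fin m → Ω => u (D i)) 2 (Measure.pi fun _ => P) :=
  hu.comp_measurePreserving (measurePreserving_eval (fun _ : Fin m => P) i)

theorem integral_comp_eval_pi {u : Ω → ℝ} (hu : AEStronglyMeasurable u P) (i : Fin m) :
    ∫ D : Fin m → Ω, u (D i) ∂(Measure.pi fun _ => P) = ∫ z, u z ∂P := by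
  have h := measurePreserving_eval (fun _ : Fin m => P) i
  rw [← h.map_eq] at hu
  have := integral_map h.measurable.aemeasurable hu
  rw [h.map_eq] at this
  exact this.symm

/-- The covariance of two sums over an i.i.d. sample. -/
theorem integral_sum_mul_sum_pi {u v : Ω → ℝ} (hu : MemLp u 2 P) (hv : MemLp v 2 P)
    (hu0 : ∫ z, u z ∂P = 0) :
    ∫ D : Fin m → Ω, (∑ i, u (D i)) * ∑ j, v (D j) ∂(Measure.pi fun _ => P) =
      m * ∫ z, u z * v z ∂P := by
  have hij : ∀ i j : Fin m, ∫ D : Fin m → Ω, u (D i) * v (D j) ∂(Measure.pi fun _ => P) =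
      if i = j then ∫ z, u z * v z ∂P else 0 := by
    intro i j
    split_ifs with h
    · subst h
      exact integral_comp_eval_pi (u := fun z => u z * v z)
        (hu.aestronglyMeasurable.mul hv.aestronglyMeasurable) i
    · have hind := (iIndepFun_pi (μ := fun _ : Fin m => P) (X := fun _ z => z)
        (fun _ => aemeasurable_id)).indepFun h
      have hmap : ∀ i : Fin m, Measure.map (fun D : Fin m → Ω => D i) (Measure.pi fun _ => P) = P :=
        fun i => (measurePreserving_eval (fun _ : Fin m => P) i).map_eq
      have h2 := hind.comp₀ (measurable_pi_apply i).aemeasurable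
        (measurable_pi_apply j).aemeasurable (φ := u) (ψ := v)
        (by rw [hmap]; exact hu.aestronglyMeasurable.aemeasurable)
        (by rw [hmap]; exact hv.aestronglyMeasurable.aemeasurable)
      have h3 := h2.integral_mul_eq_mul_integral
        (memLp_comp_eval hu i).aestronglyMeasurable (memLp_comp_eval hv j).aestronglyMeasurable
      have h4 := integral_comp_eval_pi hu.aestronglyMeasurable i
      simp only [Pi.mul_apply, Function.comp_apply] at h3
      rw [h3, h4, hu0, zero_mul]
  have hint : ∀ i j : Fin m, Integrable (fun D : Fin m → Ω => u (D i) * v (D j))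
      (Measure.pi fun _ => P) := fun i j =>
    (memLp_comp_eval hu i).integrable_mul (memLp_comp_eval hv j)
  simp_rw [Finset.sum_mul_sum]
  rw [integral_finsetSum _ fun i _ => integrable_finsetSum _ fun j _ => hint i j]
  simp_rw [integral_finsetSum _ fun j _ => hint _ j, hij]
  simp

theorem memLp_sum_pi {u : Ω → ℝ} (hu : MemLp u 2 P) :
    MemLp (fun D : Fin m → Ω => ∑ i, u (D i)) 2 (Measure.pi fun _ => P) :=
  memLp_finsetSum Finset.univ fun i _ => memLp_comp_eval hu i

theorem integral_sum_pi_eq_zero {u : Ω → ℝ} (hu : MemLp u 2 P)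
    (hu0 : ∫ z, u z ∂P = 0) :
    ∫ D : Fin m → Ω, ∑ i, u (D i) ∂(Measure.pi fun _ => P) = 0 := by
  rw [integral_finsetSum _ fun i _ => (memLp_comp_eval hu i).integrable one_le_two]
  refine Finset.sum_eq_zero fun i _ => ?_
  rw [integral_comp_eval_pi hu.aestronglyMeasurable, hu0]

theorem lintegral_sum_sq_pi {u : Ω → ℝ} (hu : MemLp u 2 P) (hu0 : ∫ z, u z ∂P = 0) :
    ∫⁻ D : Fin m → Ω, ENNReal.ofReal ((∑ i, u (D i)) ^ 2) ∂(Measure.pi fun _ => P) =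
      m * ∫⁻ z, ENNReal.ofReal (u z ^ 2) ∂P := by
  rw [← ofReal_integral_eq_lintegral_ofReal (memLp_sum_pi hu).integrable_sq
    (Filter.Eventually.of_forall fun _ => sq_nonneg _),
    ← ofReal_integral_eq_lintegral_ofReal hu.integrable_sq
    (Filter.Eventually.of_forall fun _ => sq_nonneg _), ← ENNReal.ofReal_natCast,
    ← ENNReal.ofReal_mul (by positivity)]
  congr 1
  simp_rw [sq]
  exact integral_sum_mul_sum_pi hu hu hu0

theorem IsCentredCorrection.lintegral_sum_sq (hV : IsCentredCorrection P W V) :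
    ∫⁻ q : (Fin m → Ω) × (Fin m → Ω), ENNReal.ofReal ((∑ i, V q.1 (q.2 i)) ^ 2)
        ∂((Measure.pi fun _ => P).prod (Measure.pi fun _ => P)) =
      m * ∫⁻ D, ∫⁻ z, ENNReal.ofReal (V D z ^ 2) ∂P ∂(Measure.pi fun _ => P) := by
  rw [lintegral_prod _ (hV.measurable_sum.pow_const 2).ennreal_ofReal.aemeasurable]
  simp_rw [lintegral_sum_sq_pi (hV.memLp _) (hV.integral_eq_zero _)]
  rw [lintegral_const_mul]
  exact (hV.measurable.pow_const 2).ennreal_ofReal.lintegral_prod_right'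

theorem IsCentredCorrection.memLp_sum (hV : IsCentredCorrection P W V) :
    MemLp (fun q : (Fin m → Ω) × (Fin m → Ω) => ∑ i, V q.1 (q.2 i)) 2
      ((Measure.pi fun _ => P).prod (Measure.pi fun _ => P)) := by
  rw [memLp_two_iff_integrable_sq hV.measurable_sum.aestronglyMeasurable]
  refine ⟨(hV.measurable_sum.pow_const 2).aestronglyMeasurable, ?_⟩
  rw [hasFiniteIntegral_iff_ofReal (Filter.Eventually.of_forall fun _ => sq_nonneg _),
    hV.lintegral_sum_sq]
  exact ENNReal.mul_lt_top (ENNReal.natCast_lt_top m) hV.lintegral_lt_top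

theorem memLp_sum_add_sum (hW : MemLp W 2 P) :
    MemLp (fun q : (Fin m → Ω) × (Fin m → Ω) => ∑ i, W (q.1 i) + ∑ i, W (q.2 i)) 2
      ((Measure.pi fun _ => P).prod (Measure.pi fun _ => P)) :=
  ((memLp_sum_pi hW).comp_measurePreserving measurePreserving_fst).add
    ((memLp_sum_pi hW).comp_measurePreserving measurePreserving_snd)

/-- Freeze the fitting half. Its own sum of `W` is then a constant multiplying a mean-zero sum, and
the other half contributes `m` times the inner product of `V` and `W`, which is zero. -/
theorem IsCentredCorrection.integral_mul_sum (hV : IsCentredCorrection P W V) (hW : MemLp W 2 P) :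
    ∫ q : (Fin m → Ω) × (Fin m → Ω),
      (∑ i, V q.1 (q.2 i)) * (∑ i, W (q.1 i) + ∑ i, W (q.2 i))
        ∂((Measure.pi fun _ => P).prod (Measure.pi fun _ => P)) = 0 := by
  have hint : Integrable (fun q : (Fin m → Ω) × (Fin m → Ω) =>
      (∑ i, V q.1 (q.2 i)) * (∑ i, W (q.1 i) + ∑ i, W (q.2 i)))
      ((Measure.pi fun _ => P).prod (Measure.pi fun _ => P)) :=
    hV.memLp_sum.integrable_mul (memLp_sum_add_sum hW)
  rw [integral_prod _ hint]
  refine integral_eq_zero_of_ae (Filter.Eventually.of_forall fun D => ?_)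
  simp only [mul_add, Pi.zero_apply]
  have h1 := memLp_sum_pi (m := m) (hV.memLp D)
  have h2 : Integrable (fun D' : Fin m → Ω => (∑ i, V D (D' i)) * ∑ i, W (D' i))
      (Measure.pi fun _ => P) := h1.integrable_mul (memLp_sum_pi hW)
  rw [integral_add ((h1.integrable one_le_two).mul_const _)
    h2, integral_mul_const,
    integral_sum_pi_eq_zero (hV.memLp D) (hV.integral_eq_zero D),
    integral_sum_mul_sum_pi (hV.memLp D) hW (hV.integral_eq_zero D), hV.integral_mul_eq_zero]
  simp

theorem integral_sum_add_sum_sq (hW : MemLp W 2 P) (hW0 : ∫ z, W z ∂P = 0) :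
    ∫ q : (Fin m → Ω) × (Fin m → Ω), (∑ i, W (q.1 i) + ∑ i, W (q.2 i)) ^ 2
        ∂((Measure.pi fun _ => P).prod (Measure.pi fun _ => P)) =
      (m + m) * ∫ z, W z ^ 2 ∂P := by
  have hS := memLp_sum_pi (m := m) hW
  have hsq : ∫ D : Fin m → Ω, (∑ i, W (D i)) ^ 2 ∂(Measure.pi fun _ => P) =
      m * ∫ z, W z ^ 2 ∂P := by
    simp_rw [sq]
    exact integral_sum_mul_sum_pi hW hW hW0
  have hinner : ∀ D : Fin m → Ω, ∫ D' : Fin m → Ω, (∑ i, W (D i) + ∑ i, W (D' i)) ^ 2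
      ∂(Measure.pi fun _ => P) = (∑ i, W (D i)) ^ 2 + m * ∫ z, W z ^ 2 ∂P := by
    intro D
    have hexp : ∀ D' : Fin m → Ω, (∑ i, W (D i) + ∑ i, W (D' i)) ^ 2 =
        (∑ i, W (D i)) ^ 2 + (2 * (∑ i, W (D i)) * ∑ i, W (D' i) + (∑ i, W (D' i)) ^ 2) :=
      fun D' => by ring
    simp_rw [hexp]
    have hi1 : Integrable (fun D' : Fin m → Ω => 2 * (∑ i, W (D i)) * ∑ i, W (D' i))
      (Measure.pi fun _ => P) := (hS.integrable one_le_two).const_mul _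
    have hi2 : Integrable (fun D' : Fin m → Ω => 2 * (∑ i, W (D i)) * ∑ i, W (D' i) +
      (∑ i, W (D' i)) ^ 2) (Measure.pi fun _ => P) := hi1.add hS.integrable_sq
    rw [integral_add (integrable_const _) hi2,
      integral_add hi1 hS.integrable_sq, integral_const_mul,
      integral_sum_pi_eq_zero hW hW0, hsq]
    simp
  rw [integral_prod _ (memLp_sum_add_sum hW).integrable_sq]
  simp_rw [hinner]
  rw [integral_add hS.integrable_sq (integrable_const _), hsq]
  simp
  ring

/-- The second moment of the cross-fitted error. -/
theorem lintegral_crossFit_le {V₁ V₂ : (Fin m → Ω) → Ω → ℝ} (hW : MemLp W 2 P)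
    (hW0 : ∫ z, W z ∂P = 0) (hV₁ : IsCentredCorrection P W V₁)
    (hV₂ : IsCentredCorrection P W V₂) :
    ∫⁻ q : (Fin m → Ω) × (Fin m → Ω), ENNReal.ofReal
      ((∑ i, (W (q.1 i) + V₂ q.2 (q.1 i)) + ∑ i, (W (q.2 i) + V₁ q.1 (q.2 i))) ^ 2)
        ∂((Measure.pi fun _ => P).prod (Measure.pi fun _ => P)) ≤
      (m + m) * (∫⁻ z, ENNReal.ofReal (W z ^ 2) ∂P +
        ∫⁻ D, ∫⁻ z, ENNReal.ofReal (V₁ D z ^ 2) ∂P ∂(Measure.pi fun _ => P) +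
        ∫⁻ D, ∫⁻ z, ENNReal.ofReal (V₂ D z ^ 2) ∂P ∂(Measure.pi fun _ => P)) := by
  set Q : Measure (Fin m → Ω) := Measure.pi fun _ => P with hQ
  set S := fun q : (Fin m → Ω) × (Fin m → Ω) => ∑ i, W (q.1 i) + ∑ i, W (q.2 i) with hSdef
  set T₁ := fun q : (Fin m → Ω) × (Fin m → Ω) => ∑ i, V₁ q.1 (q.2 i) with hT₁
  set T₂ := fun q : (Fin m → Ω) × (Fin m → Ω) => ∑ i, V₂ q.2 (q.1 i) with hT₂
  have hSm : MemLp S 2 (Q.prod Q) := memLp_sum_add_sum hW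
  have hT₁m : MemLp T₁ 2 (Q.prod Q) := hV₁.memLp_sum
  have hswap : MeasurePreserving (Prod.swap : (Fin m → Ω) × (Fin m → Ω) → _) (Q.prod Q)
      (Q.prod Q) := Measure.measurePreserving_swap
  have hT₂m : MemLp T₂ 2 (Q.prod Q) := hV₂.memLp_sum.comp_measurePreserving hswap
  have hc₁ : ∫ q, T₁ q * S q ∂(Q.prod Q) = 0 := hV₁.integral_mul_sum hW
  have hc₂ : ∫ q, T₂ q * S q ∂(Q.prod Q) = 0 := by
    rw [← integral_prod_swap]
    refine Eq.trans (integral_congr_ae (Filter.Eventually.of_forall fun q => ?_))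
      (hV₂.integral_mul_sum hW)
    simp only [hT₂, hSdef, Prod.swap]
    ring
  have hl₁ : ∫⁻ q, ENNReal.ofReal (T₁ q ^ 2) ∂(Q.prod Q) =
      m * ∫⁻ D, ∫⁻ z, ENNReal.ofReal (V₁ D z ^ 2) ∂P ∂Q := hV₁.lintegral_sum_sq
  have hl₂ : ∫⁻ q, ENNReal.ofReal (T₂ q ^ 2) ∂(Q.prod Q) =
      m * ∫⁻ D, ∫⁻ z, ENNReal.ofReal (V₂ D z ^ 2) ∂P ∂Q := by
    rw [← hV₂.lintegral_sum_sq]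
    exact hswap.lintegral_comp (hV₂.measurable_sum.pow_const 2).ennreal_ofReal
  have hpt : ∀ q : (Fin m → Ω) × (Fin m → Ω),
      (∑ i, (W (q.1 i) + V₂ q.2 (q.1 i)) + ∑ i, (W (q.2 i) + V₁ q.1 (q.2 i))) =
        S q + T₁ q + T₂ q := by
    intro q
    simp only [hSdef, hT₁, hT₂, Finset.sum_add_distrib]
    ring
  simp_rw [hpt]
  have hI := ((hSm.add hT₁m).add hT₂m).integrable_sq
  simp only [Pi.add_apply] at hI
  have iS := hSm.integrable_sq
  have i1 := (hT₁m.integrable_mul hSm).const_mul 2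
  have i2 := (hT₂m.integrable_mul hSm).const_mul 2
  have i3 := hT₁m.integrable_sq.const_mul 2
  have i4 := hT₂m.integrable_sq.const_mul 2
  simp only [Pi.mul_apply] at i1 i2
  have j4 : Integrable (fun q => 2 * T₁ q ^ 2 + 2 * T₂ q ^ 2) (Q.prod Q) := i3.add i4
  have j3 : Integrable (fun q => 2 * (T₂ q * S q) + (2 * T₁ q ^ 2 + 2 * T₂ q ^ 2)) (Q.prod Q) :=
    i2.add j4
  have j2 : Integrable (fun q => 2 * (T₁ q * S q) + (2 * (T₂ q * S q) +
    (2 * T₁ q ^ 2 + 2 * T₂ q ^ 2))) (Q.prod Q) := i1.add j3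
  -- Only the product of `T₁` and `T₂` needs an inequality, as each depends on both halves. Both
  -- products with `S` integrate to zero, so `S²` keeps the coefficient one.
  have hreal : ∫ q, (S q + T₁ q + T₂ q) ^ 2 ∂(Q.prod Q) ≤
      (m + m) * ∫ z, W z ^ 2 ∂P + (2 * ∫ q, T₁ q ^ 2 ∂(Q.prod Q) +
        2 * ∫ q, T₂ q ^ 2 ∂(Q.prod Q)) := by
    calc ∫ q, (S q + T₁ q + T₂ q) ^ 2 ∂(Q.prod Q)
        ≤ ∫ q, (S q ^ 2 + (2 * (T₁ q * S q) + (2 * (T₂ q * S q) +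
            (2 * T₁ q ^ 2 + 2 * T₂ q ^ 2)))) ∂(Q.prod Q) := by
          refine integral_mono hI (iS.add j2) fun q => ?_
          beta_reduce
          nlinarith [sq_nonneg (T₁ q - T₂ q)]
      _ = _ := by
          rw [integral_add iS j2, integral_add i1 j3, integral_add i2 j4, integral_add i3 i4, integral_const_mul, integral_const_mul, integral_const_mul,
            integral_const_mul, hc₁, hc₂, integral_sum_add_sum_sq hW hW0]
          ring
  have hnn : ∀ f : (Fin m → Ω) × (Fin m → Ω) → ℝ, 0 ≤ᵐ[Q.prod Q] fun q => f q ^ 2 :=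
    fun f => Filter.Eventually.of_forall fun _ => sq_nonneg _
  rw [← ofReal_integral_eq_lintegral_ofReal hI (hnn _)]
  refine (ENNReal.ofReal_le_ofReal hreal).trans_eq ?_
  have hp : ∀ f : (Fin m → Ω) × (Fin m → Ω) → ℝ, 0 ≤ ∫ q, f q ^ 2 ∂(Q.prod Q) :=
    fun f => integral_nonneg fun _ => sq_nonneg _
  have hpW : 0 ≤ ∫ z, W z ^ 2 ∂P := integral_nonneg fun _ => sq_nonneg _
  rw [ENNReal.ofReal_add (by positivity) (add_nonneg (mul_nonneg two_pos.le (hp _))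
      (mul_nonneg two_pos.le (hp _))), ENNReal.ofReal_add (mul_nonneg two_pos.le (hp _))
      (mul_nonneg two_pos.le (hp _)), ENNReal.ofReal_mul (by positivity),
    ENNReal.ofReal_mul two_pos.le, ENNReal.ofReal_mul two_pos.le,
    ofReal_integral_eq_lintegral_ofReal hT₁m.integrable_sq (hnn _),
    ofReal_integral_eq_lintegral_ofReal hT₂m.integrable_sq (hnn _),
    ofReal_integral_eq_lintegral_ofReal hW.integrable_sq
      (Filter.Eventually.of_forall fun _ => sq_nonneg _), hl₁, hl₂,
    ENNReal.ofReal_add (by positivity) (by positivity), ENNReal.ofReal_natCast,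
    ENNReal.ofReal_ofNat]
  ring

/-- A sample of size `m + m` consists of two independent samples of size `m`. -/
theorem measurePreserving_append (P : Measure Ω) [IsProbabilityMeasure P] (m : ℕ) :
    MeasurePreserving (fun q : (Fin m → Ω) × (Fin m → Ω) => Fin.append q.1 q.2)
      ((Measure.pi fun _ => P).prod (Measure.pi fun _ => P)) (Measure.pi fun _ => P) := by
  have hmeas : Measurable (fun q : (Fin m → Ω) × (Fin m → Ω) => Fin.append q.1 q.2) := by
    refine measurable_pi_lambda _ fun i => ?_
    refine Fin.addCases (fun i => ?_) (fun i => ?_) i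
    · simp only [Fin.append_left]; fun_prop
    · simp only [Fin.append_right]; fun_prop
  refine ⟨hmeas, (Measure.pi_eq fun s hs => ?_).symm⟩
  rw [Measure.map_apply hmeas (MeasurableSet.univ_pi hs)]
  have : (fun q : (Fin m → Ω) × (Fin m → Ω) => Fin.append q.1 q.2) ⁻¹' Set.univ.pi s =
      (Set.univ.pi fun i => s (Fin.castAdd m i)) ×ˢ (Set.univ.pi fun i => s (Fin.natAdd m i)) := by
    ext q
    simp only [Set.mem_preimage, Set.mem_pi, Set.mem_univ, true_implies, Set.mem_prod]
    constructor
    · intro h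
      exact ⟨fun i => by simpa using h (Fin.castAdd m i), fun i => by
        simpa only [Fin.append_right] using h (Fin.natAdd m i)⟩
    · rintro ⟨h1, h2⟩ i
      refine Fin.addCases (fun i => ?_) (fun i => ?_) i
      · simpa only [Fin.append_left] using h1 i
      · simpa only [Fin.append_right] using h2 i
  rw [this, Measure.prod_prod, Measure.pi_pi, Measure.pi_pi, Fin.prod_univ_add]

end CrossFitting

/-! ### Conditional means as `L²` projections. -/

section CondMean

variable {S T : Type*} [MeasurableSpace S] [MeasurableSpace T] {ξ : Measure S}
  [IsProbabilityMeasure ξ] {η : Kernel S T} [IsMarkovKernel η]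

theorem measurePreserving_fst_compProd (ξ : Measure S) [IsProbabilityMeasure ξ] (η : Kernel S T)
    [IsMarkovKernel η] : MeasurePreserving Prod.fst (ξ ⊗ₘ η) ξ :=
  ⟨measurable_fst, Measure.fst_compProd ξ η⟩

theorem measurable_condMean {u : S × T → ℝ} (hu : Measurable u) :
    Measurable fun x => ∫ a, u (x, a) ∂(η x) :=
  (StronglyMeasurable.integral_kernel_prod_right' hu.stronglyMeasurable).measurable

/-- Jensen's inequality for the square, in the form that a conditional variance is nonnegative. -/
theorem memLp_condMean {u : S × T → ℝ} (hum : Measurable u) (hu : MemLp u 2 (ξ ⊗ₘ η)) :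
    MemLp (fun x => ∫ a, u (x, a) ∂(η x)) 2 ξ := by
  have hm := measurable_condMean (η := η) hum
  rw [memLp_two_iff_integrable_sq hm.aestronglyMeasurable]
  have hsq := hu.integrable_sq
  have h1 := (Measure.integrable_compProd_iff hsq.aestronglyMeasurable).1 hsq
  refine h1.2.mono' (hm.pow_const 2).aestronglyMeasurable ?_
  filter_upwards [h1.1] with x hx
  have hx2 : MemLp (fun a => u (x, a)) 2 (η x) :=
    (memLp_two_iff_integrable_sq (hum.comp measurable_prodMk_left).aestronglyMeasurable).2 hx
  have hv := variance_nonneg (fun a => u (x, a)) (η x)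
  rw [variance_eq_sub hx2] at hv
  simp only [Pi.pow_apply, Real.norm_eq_abs, abs_sq] at hv ⊢
  linarith

theorem integral_mul_comp_fst {u : S × T → ℝ} (hu : MemLp u 2 (ξ ⊗ₘ η)) {F : S → ℝ}
    (hF : MemLp F 2 ξ) :
    ∫ p, u p * F p.1 ∂(ξ ⊗ₘ η) = ∫ x, (∫ a, u (x, a) ∂(η x)) * F x ∂ξ := by
  have hF' : MemLp (fun p : S × T => F p.1) 2 (ξ ⊗ₘ η) :=
    hF.comp_measurePreserving (measurePreserving_fst_compProd ξ η)
  have hi : Integrable (fun p => u p * F p.1) (ξ ⊗ₘ η) := hu.integrable_mul hF'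
  rw [Measure.integral_compProd hi]
  simp_rw [integral_mul_const]

theorem integral_comp_fst_compProd {F : S → ℝ} (hF : AEStronglyMeasurable F ξ) :
    ∫ p, F p.1 ∂(ξ ⊗ₘ η) = ∫ x, F x ∂ξ := by
  have h := (measurePreserving_fst_compProd ξ η).map_eq
  rw [← h] at hF
  have := integral_map measurable_fst.aemeasurable hF
  rw [h] at this
  exact this.symm

theorem memLp_sub_condMean {u : S × T → ℝ} (hum : Measurable u) (hu : MemLp u 2 (ξ ⊗ₘ η)) :
    MemLp (fun p => u p - ∫ a, u (p.1, a) ∂(η p.1)) 2 (ξ ⊗ₘ η) :=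
  hu.sub ((memLp_condMean hum hu).comp_measurePreserving (measurePreserving_fst_compProd ξ η))

/-- The conditionally centred variable is orthogonal to the functions of the conditioning. -/
theorem integral_sub_condMean_mul {u : S × T → ℝ} (hum : Measurable u) (hu : MemLp u 2 (ξ ⊗ₘ η))
    {F : S → ℝ} (hF : MemLp F 2 ξ) :
    ∫ p, (u p - ∫ a, u (p.1, a) ∂(η p.1)) * F p.1 ∂(ξ ⊗ₘ η) = 0 := by
  have hc := memLp_condMean hum hu
  have hfst := measurePreserving_fst_compProd ξ η
  have hF' : MemLp (fun p : S × T => F p.1) 2 (ξ ⊗ₘ η) := hF.comp_measurePreserving hfst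
  have hc' : MemLp (fun p : S × T => ∫ a, u (p.1, a) ∂(η p.1)) 2 (ξ ⊗ₘ η) :=
    hc.comp_measurePreserving hfst
  have i1 : Integrable (fun p => u p * F p.1) (ξ ⊗ₘ η) := hu.integrable_mul hF'
  have i2 : Integrable (fun p => (∫ a, u (p.1, a) ∂(η p.1)) * F p.1) (ξ ⊗ₘ η) :=
    hc'.integrable_mul hF'
  simp_rw [sub_mul]
  rw [integral_sub i1 i2, integral_mul_comp_fst hu hF,
    integral_comp_fst_compProd (F := fun x => (∫ a, u (x, a) ∂(η x)) * F x)
      (hc.integrable_mul hF).aestronglyMeasurable, sub_self]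

/-- Conditional centring decreases the second moment. -/
theorem integral_sub_condMean_sq_le {u : S × T → ℝ} (hum : Measurable u)
    (hu : MemLp u 2 (ξ ⊗ₘ η)) :
    ∫ p, (u p - ∫ a, u (p.1, a) ∂(η p.1)) ^ 2 ∂(ξ ⊗ₘ η) ≤ ∫ p, u p ^ 2 ∂(ξ ⊗ₘ η) := by
  have hc := memLp_condMean hum hu
  have hr := memLp_sub_condMean hum hu
  have hc' : MemLp (fun p : S × T => ∫ a, u (p.1, a) ∂(η p.1)) 2 (ξ ⊗ₘ η) :=
    hc.comp_measurePreserving (measurePreserving_fst_compProd ξ η)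
  have h0 := integral_sub_condMean_mul hum hu hc
  have i1 : Integrable (fun p => 2 * ((u p - ∫ a, u (p.1, a) ∂(η p.1)) *
    ∫ a, u (p.1, a) ∂(η p.1))) (ξ ⊗ₘ η) := (hr.integrable_mul hc').const_mul 2
  have i2 : Integrable (fun p => (u p - ∫ a, u (p.1, a) ∂(η p.1)) ^ 2 +
    2 * ((u p - ∫ a, u (p.1, a) ∂(η p.1)) * ∫ a, u (p.1, a) ∂(η p.1))) (ξ ⊗ₘ η) :=
    hr.integrable_sq.add i1
  calc _ = ∫ p, ((u p - ∫ a, u (p.1, a) ∂(η p.1)) ^ 2 +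
        2 * ((u p - ∫ a, u (p.1, a) ∂(η p.1)) * ∫ a, u (p.1, a) ∂(η p.1))) ∂(ξ ⊗ₘ η) := by
        rw [integral_add hr.integrable_sq i1, integral_const_mul, h0, mul_zero, add_zero]
    _ ≤ _ := by
        refine integral_mono i2 hu.integrable_sq fun p => ?_
        beta_reduce
        nlinarith [sq_nonneg (∫ a, u (p.1, a) ∂(η p.1))]

end CondMean

/-! ### Disintegration of the model and the weighted norm. -/

namespace Model

variable {𝕏 𝔸 : Type*} [MeasurableSpace 𝕏] [MeasurableSpace 𝔸] (M : Model 𝕏 𝔸)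

instance : IsProbabilityMeasure M.ξ := M.prob_ξ
instance : SigmaFinite M.lam := M.sigmaFinite_lam
instance : IsMarkovKernel M.κ := M.markov_κ

theorem measurable_density :
    Measurable (Function.uncurry fun x a => ENNReal.ofReal (M.π (x, a))) :=
  M.measurable_π.ennreal_ofReal

/-- The conditional law of the action. -/
def actionKernel : Kernel 𝕏 𝔸 :=
  (Kernel.const 𝕏 M.lam).withDensity fun x a => ENNReal.ofReal (M.π (x, a))

theorem actionKernel_apply (x : 𝕏) :
    M.actionKernel x = M.lam.withDensity fun a => ENNReal.ofReal (M.π (x, a)) := by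
  rw [actionKernel, Kernel.withDensity_apply _ M.measurable_density, Kernel.const_apply]

instance : IsMarkovKernel M.actionKernel :=
  ⟨fun x => ⟨by
    rw [actionKernel_apply, withDensity_apply _ MeasurableSet.univ, Measure.restrict_univ]
    exact M.lintegral_π x⟩⟩

/-- This form makes integrals against `g(x, ·) dλ` conditional expectations given the context. -/
theorem pairLaw_eq : M.pairLaw = M.ξ ⊗ₘ M.actionKernel := by
  ext s hs
  rw [Measure.compProd_apply hs, pairLaw, withDensity_apply _ hs, ← lintegral_indicator hs,
    lintegral_prod _ (M.measurable_π.ennreal_ofReal.indicator hs).aemeasurable]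
  refine lintegral_congr fun x => ?_
  rw [actionKernel_apply, withDensity_apply _ (measurable_prodMk_left hs),
    ← lintegral_indicator (measurable_prodMk_left hs)]
  rfl

instance : IsProbabilityMeasure M.pairLaw := by
  rw [pairLaw_eq]; infer_instance

instance : IsProbabilityMeasure M.dataLaw := by
  unfold dataLaw; infer_instance

theorem measurable_ratio : Measurable M.ratio := M.measurable_g.div M.measurable_π

theorem measurable_muStar : Measurable M.muStar :=
  (StronglyMeasurable.integral_kernel (κ := M.κ)
    (f := fun y : ℝ => y) stronglyMeasurable_id).measurable

theorem ratio_sq_weight (p : 𝕏 × 𝔸) (c : ℝ) :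
    ENNReal.ofReal (M.g p ^ 2 / M.π p * c) =
      ENNReal.ofReal (M.π p) * ENNReal.ofReal (M.ratio p ^ 2 * c) := by
  rw [← ENNReal.ofReal_mul (M.π_nonneg p)]
  congr 1
  unfold ratio
  rcases eq_or_ne (M.π p) 0 with h | h
  · simp [h]
  · field_simp

theorem wNormSq_eq {h : 𝕏 × 𝔸 → ℝ} (hh : Measurable h) :
    M.wNormSq h = ∫⁻ p, ENNReal.ofReal ((M.ratio p * h p) ^ 2) ∂M.pairLaw := by
  have hr := M.measurable_ratio
  rw [wNormSq, pairLaw, lintegral_withDensity_eq_lintegral_mul _ M.measurable_π.ennreal_ofReal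
    (by fun_prop)]
  refine lintegral_congr fun p => ?_
  rw [ratio_sq_weight, ← mul_pow]
  rfl

theorem memLp_pairLaw {h : 𝕏 × 𝔸 → ℝ} (hh : Measurable h) (hfin : M.wNormSq h < ⊤) :
    MemLp (fun p => M.ratio p * h p) 2 M.pairLaw := by
  have hm : Measurable fun p => M.ratio p * h p := M.measurable_ratio.mul hh
  rw [memLp_two_iff_integrable_sq hm.aestronglyMeasurable]
  refine ⟨(hm.pow_const 2).aestronglyMeasurable, ?_⟩
  rw [hasFiniteIntegral_iff_ofReal (Filter.Eventually.of_forall fun _ => sq_nonneg _),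
    ← M.wNormSq_eq hh]
  exact hfin

/-- Where `π = 0` the ratio is `0` by the convention for division, and overlap makes `g` vanish
there too. -/
theorem g_eq_ae : ∀ᵐ p ∂(M.ξ.prod M.lam), M.g p = M.π p * M.ratio p := by
  filter_upwards [M.overlap] with p hp
  unfold ratio
  rcases eq_or_ne (M.π p) 0 with h | h
  · simp [h, hp h]
  · field_simp

/-- The inner product `⟨g(x, ·), h(x, ·)⟩` is a conditional mean. -/
theorem integral_g_mul_ae (h : 𝕏 × 𝔸 → ℝ) :
    ∀ᵐ x ∂M.ξ, ∫ a, M.g (x, a) * h (x, a) ∂M.lam =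
      ∫ a, M.ratio (x, a) * h (x, a) ∂(M.actionKernel x) := by
  filter_upwards [Measure.ae_ae_of_ae_prod M.g_eq_ae] with x hx
  have hm : Measurable fun a => ENNReal.ofReal (M.π (x, a)) :=
    (M.measurable_π.comp measurable_prodMk_left).ennreal_ofReal
  rw [actionKernel_apply, integral_withDensity_eq_integral_toReal_smul hm
    (Filter.Eventually.of_forall fun _ => ENNReal.ofReal_lt_top)]
  refine integral_congr_ae ?_
  filter_upwards [hx] with a ha
  rw [ha, ENNReal.toReal_ofReal (M.π_nonneg _), smul_eq_mul, mul_assoc]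

theorem tauStar_eq : M.tauStar = ∫ p, M.ratio p * M.muStar p ∂M.pairLaw := by
  rw [tauStar, pairLaw, integral_withDensity_eq_integral_toReal_smul
    M.measurable_π.ennreal_ofReal
    (Filter.Eventually.of_forall fun _ => ENNReal.ofReal_lt_top)]
  refine integral_congr_ae ?_
  filter_upwards [M.g_eq_ae] with p hp
  rw [hp, ENNReal.toReal_ofReal (M.π_nonneg _), smul_eq_mul, mul_assoc]

theorem ae_pairLaw_of_ae_fst {p : 𝕏 → Prop} (hp : ∀ᵐ x ∂M.ξ, p x) :
    ∀ᵐ q ∂M.pairLaw, p q.1 := by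
  rw [pairLaw_eq]
  exact (measurePreserving_fst_compProd M.ξ M.actionKernel).quasiMeasurePreserving.ae hp

/-- The difference of two auxiliary functions is a conditionally centred variable. -/
theorem aux_sub_aux_ae {h₁ h₂ : 𝕏 × 𝔸 → ℝ}
    (hL₁ : MemLp (fun p => M.ratio p * h₁ p) 2 M.pairLaw)
    (hL₂ : MemLp (fun p => M.ratio p * h₂ p) 2 M.pairLaw) :
    (fun p => M.aux h₁ p - M.aux h₂ p) =ᵐ[M.pairLaw] fun p =>
      (M.ratio p * (h₁ p - h₂ p)) -
        ∫ a, M.ratio (p.1, a) * (h₁ (p.1, a) - h₂ (p.1, a)) ∂(M.actionKernel p.1) := by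
  rw [pairLaw_eq] at hL₁ hL₂
  have hi₁ := (Measure.integrable_compProd_iff hL₁.aestronglyMeasurable).1
    (hL₁.integrable one_le_two)
  have hi₂ := (Measure.integrable_compProd_iff hL₂.aestronglyMeasurable).1
    (hL₂.integrable one_le_two)
  filter_upwards [M.ae_pairLaw_of_ae_fst (M.integral_g_mul_ae h₁),
    M.ae_pairLaw_of_ae_fst (M.integral_g_mul_ae h₂), M.ae_pairLaw_of_ae_fst hi₁.1,
    M.ae_pairLaw_of_ae_fst hi₂.1] with p e₁ e₂ k₁ k₂
  unfold aux
  rw [e₁, e₂]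
  simp_rw [mul_sub]
  rw [integral_sub k₁ k₂]
  ring

end Model

/-! ### Quadratic forms in spectral coordinates. -/

section Eigenvalues

open Matrix

/-- `w` is the vector of coordinates of `x` in the orthonormal eigenbasis; both identities are
Parseval's. -/
theorem dotProduct_mulVec_eq_sum_eigenvalues {d : ℕ} {A : Matrix (Fin d) (Fin d) ℝ}
    (hA : A.IsHermitian) (x : Fin d → ℝ) :
    ∃ w : Fin d → ℝ, ∑ i, w i ^ 2 = ∑ j, x j ^ 2 ∧
      x ⬝ᵥ A *ᵥ x = ∑ i, hA.eigenvalues i * w i ^ 2 := by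
  have hsum := fun y : Fin d → ℝ => hA.eigenvectorBasis.sum_inner_mul_inner
    (WithLp.toLp 2 x) (WithLp.toLp 2 y)
  simp only [EuclideanSpace.inner_eq_star_dotProduct, star_trivial] at hsum
  refine ⟨fun i => (hA.eigenvectorBasis i).ofLp ⬝ᵥ x, ?_, ?_⟩
  · have h1 : ∑ j, x j ^ 2 = x ⬝ᵥ x := by simp only [dotProduct, sq]
    rw [h1, ← hsum x]
    refine Finset.sum_congr rfl fun i _ => ?_
    rw [sq, dotProduct_comm x]
  · rw [dotProduct_comm, ← hsum (A *ᵥ x)]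
    refine Finset.sum_congr rfl fun i _ => ?_
    have h2 : (A *ᵥ x) ⬝ᵥ (hA.eigenvectorBasis i).ofLp =
        hA.eigenvalues i * ((hA.eigenvectorBasis i).ofLp ⬝ᵥ x) := by
      have hT : Aᵀ = A := by simpa [conjTranspose_eq_transpose_of_trivial] using hA.eq
      rw [dotProduct_comm, dotProduct_mulVec, ← mulVec_transpose, hT,
        hA.mulVec_eigenvectorBasis, smul_dotProduct, smul_eq_mul]
    rw [h2]
    ring

end Eigenvalues

/-! ### Influence function, corrections, and the mean-squared error. -/

namespace Model

variable {𝕏 𝔸 : Type*} [MeasurableSpace 𝕏] [MeasurableSpace 𝔸] (M : Model 𝕏 𝔸)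

/-- The weighted outcome noise. -/
def noise (z : (𝕏 × 𝔸) × ℝ) : ℝ := M.ratio z.1 * (z.2 - M.muStar z.1)

theorem measurable_noise : Measurable M.noise := by
  have h1 := M.measurable_ratio
  have h2 := M.measurable_muStar
  unfold noise; fun_prop

theorem NoiseMoments.subGaussianMoments {M : Model 𝕏 𝔸} {sbar : ℝ} (h : M.NoiseMoments sbar) :
    SubGaussianMoments M.dataLaw M.noise sbar := h

theorem measurePreserving_fst_dataLaw : MeasurePreserving Prod.fst M.dataLaw M.pairLaw :=
  measurePreserving_fst_compProd M.pairLaw M.κ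

theorem integrable_id_κ (p : 𝕏 × 𝔸) : Integrable (fun y : ℝ => y) (M.κ p) :=
  (M.memLp_κ p).integrable one_le_two

theorem integral_noise (p : 𝕏 × 𝔸) : ∫ y, M.noise (p, y) ∂(M.κ p) = 0 := by
  simp only [noise]
  rw [integral_const_mul, integral_sub (M.integrable_id_κ p) (integrable_const _)]
  simp [muStar]

theorem integral_noise_mul (hn : MemLp M.noise 2 M.dataLaw) {F : 𝕏 × 𝔸 → ℝ}
    (hF : MemLp F 2 M.pairLaw) : ∫ z, M.noise z * F z.1 ∂M.dataLaw = 0 := by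
  rw [dataLaw, integral_mul_comp_fst hn hF]
  simp [integral_noise]

/-- The inequality is all that is needed, and it holds without measurability of `condVar`. -/
theorem lintegral_noise_sq_le :
    ∫⁻ z, ENNReal.ofReal (M.noise z ^ 2) ∂M.dataLaw ≤
      ∫⁻ p, ENNReal.ofReal (M.g p ^ 2 / M.π p * M.condVar p) ∂(M.ξ.prod M.lam) := by
  rw [dataLaw, Measure.lintegral_compProd (M.measurable_noise.pow_const 2).ennreal_ofReal]
  have hinner : ∀ p, ∫⁻ y, ENNReal.ofReal (M.noise (p, y) ^ 2) ∂(M.κ p) =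
      ENNReal.ofReal (M.ratio p ^ 2 * M.condVar p) := by
    intro p
    unfold noise
    simp_rw [mul_pow, ENNReal.ofReal_mul (sq_nonneg (M.ratio p))]
    rw [lintegral_const_mul _ (by fun_prop), condVar, ofReal_variance (M.memLp_κ p),
      evariance_eq_lintegral_ofReal]
    rfl
  simp_rw [hinner]
  refine (lintegral_withDensity_le_lintegral_mul _ M.measurable_π.ennreal_ofReal _).trans_eq ?_
  refine lintegral_congr fun p => ?_
  rw [ratio_sq_weight]
  rfl

/-- The influence function of the oracle estimator. -/
def influence (z : (𝕏 × 𝔸) × ℝ) : ℝ := M.ratio z.1 * z.2 - M.aux M.muStar z.1 - M.tauStar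

/-- The conditional effect `⟨g(x, ·), μ⋆(x, ·)⟩`. -/
def condEffect (x : 𝕏) : ℝ := ∫ a, M.g (x, a) * M.muStar (x, a) ∂M.lam

/-- The two summands are uncorrelated, since the noise has conditional mean zero given `(X, A)`;
they account for the two terms of `vStarSq`. -/
theorem influence_eq (z : (𝕏 × 𝔸) × ℝ) :
    M.influence z = M.noise z + (M.condEffect z.1.1 - M.tauStar) := by
  unfold influence aux noise condEffect
  ring

variable {M}

theorem condEffect_ae (M : Model 𝕏 𝔸) : ∀ᵐ x ∂M.ξ, M.condEffect x =
    ∫ a, M.ratio (x, a) * M.muStar (x, a) ∂(M.actionKernel x) := M.integral_g_mul_ae M.muStar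

theorem memLp_condEffect (hμ : MemLp (fun p => M.ratio p * M.muStar p) 2 M.pairLaw) :
    MemLp M.condEffect 2 M.ξ := by
  rw [pairLaw_eq] at hμ
  exact (memLp_congr_ae M.condEffect_ae).2
    (memLp_condMean (M.measurable_ratio.mul M.measurable_muStar) hμ)

theorem integral_condEffect (hμ : MemLp (fun p => M.ratio p * M.muStar p) 2 M.pairLaw) :
    ∫ x, M.condEffect x ∂M.ξ = M.tauStar := by
  rw [tauStar_eq, integral_congr_ae M.condEffect_ae]
  rw [pairLaw_eq] at hμ ⊢
  rw [Measure.integral_compProd (hμ.integrable one_le_two)]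

theorem memLp_condEffect_sub (hμ : MemLp (fun p => M.ratio p * M.muStar p) 2 M.pairLaw) :
    MemLp (fun x => M.condEffect x - M.tauStar) 2 M.ξ :=
  (memLp_condEffect hμ).sub (memLp_const _)

theorem measurePreserving_fst_pairLaw (M : Model 𝕏 𝔸) :
    MeasurePreserving Prod.fst M.pairLaw M.ξ := by
  rw [pairLaw_eq]; exact measurePreserving_fst_compProd _ _

theorem memLp_condEffect_sub_fst (hμ : MemLp (fun p => M.ratio p * M.muStar p) 2 M.pairLaw) :
    MemLp (fun p : 𝕏 × 𝔸 => M.condEffect p.1 - M.tauStar) 2 M.pairLaw :=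
  (memLp_condEffect_sub hμ).comp_measurePreserving M.measurePreserving_fst_pairLaw

theorem memLp_influence (hμ : MemLp (fun p => M.ratio p * M.muStar p) 2 M.pairLaw)
    (hn : MemLp M.noise 2 M.dataLaw) : MemLp M.influence 2 M.dataLaw := by
  have h : M.influence = fun z => M.noise z + (M.condEffect z.1.1 - M.tauStar) :=
    funext M.influence_eq
  rw [h]
  exact hn.add ((memLp_condEffect_sub_fst hμ).comp_measurePreserving
    M.measurePreserving_fst_dataLaw)

theorem integral_comp_fst_pairLaw {F : 𝕏 → ℝ} (hF : AEStronglyMeasurable F M.ξ) :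
    ∫ p, F p.1 ∂M.pairLaw = ∫ x, F x ∂M.ξ := by
  rw [pairLaw_eq]; exact integral_comp_fst_compProd hF

theorem integral_comp_fst_dataLaw {F : 𝕏 × 𝔸 → ℝ} (hF : AEStronglyMeasurable F M.pairLaw) :
    ∫ z, F z.1 ∂M.dataLaw = ∫ p, F p ∂M.pairLaw := integral_comp_fst_compProd hF

theorem integral_influence (hμ : MemLp (fun p => M.ratio p * M.muStar p) 2 M.pairLaw)
    (hn : MemLp M.noise 2 M.dataLaw) : ∫ z, M.influence z ∂M.dataLaw = 0 := by
  have hc := memLp_condEffect_sub_fst hμ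
  have hc' : MemLp (fun z : (𝕏 × 𝔸) × ℝ => M.condEffect z.1.1 - M.tauStar) 2 M.dataLaw :=
    hc.comp_measurePreserving M.measurePreserving_fst_dataLaw
  simp_rw [influence_eq]
  rw [integral_add (hn.integrable one_le_two) (hc'.integrable one_le_two)]
  have h1 := M.integral_noise_mul hn (memLp_const (1 : ℝ))
  simp only [mul_one] at h1
  rw [h1, integral_comp_fst_dataLaw (F := fun p : 𝕏 × 𝔸 => M.condEffect p.1 - M.tauStar)
    hc.aestronglyMeasurable, integral_comp_fst_pairLaw (F := fun x => M.condEffect x - M.tauStar)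
    (memLp_condEffect_sub hμ).aestronglyMeasurable,
    integral_sub ((memLp_condEffect hμ).integrable one_le_two) (integrable_const _),
    integral_condEffect hμ]
  simp

theorem lintegral_influence_sq_le (hμ : MemLp (fun p => M.ratio p * M.muStar p) 2 M.pairLaw)
    (hn : MemLp M.noise 2 M.dataLaw) :
    ∫⁻ z, ENNReal.ofReal (M.influence z ^ 2) ∂M.dataLaw ≤ M.vStarSq := by
  have hc := memLp_condEffect_sub_fst hμ
  have hc' : MemLp (fun z : (𝕏 × 𝔸) × ℝ => M.condEffect z.1.1 - M.tauStar) 2 M.dataLaw :=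
    hc.comp_measurePreserving M.measurePreserving_fst_dataLaw
  have hexp : ∀ z, M.influence z ^ 2 = (M.condEffect z.1.1 - M.tauStar) ^ 2 + (M.noise z ^ 2 +
      2 * (M.noise z * (M.condEffect z.1.1 - M.tauStar))) := by
    intro z
    rw [influence_eq]; ring
  have i1 : Integrable (fun z => 2 * (M.noise z * (M.condEffect z.1.1 - M.tauStar))) M.dataLaw :=
    (hn.integrable_mul hc').const_mul 2
  have i2 : Integrable (fun z => M.noise z ^ 2 +
      2 * (M.noise z * (M.condEffect z.1.1 - M.tauStar))) M.dataLaw := hn.integrable_sq.add i1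
  have hreal : ∫ z, M.influence z ^ 2 ∂M.dataLaw =
      ∫ x, (M.condEffect x - M.tauStar) ^ 2 ∂M.ξ + ∫ z, M.noise z ^ 2 ∂M.dataLaw := by
    simp_rw [hexp]
    rw [integral_add hc'.integrable_sq i2, integral_add hn.integrable_sq i1, integral_const_mul,
      M.integral_noise_mul hn hc, mul_zero, add_zero,
      integral_comp_fst_dataLaw (F := fun p : 𝕏 × 𝔸 => (M.condEffect p.1 - M.tauStar) ^ 2)
      hc.integrable_sq.aestronglyMeasurable,
      integral_comp_fst_pairLaw (F := fun x => (M.condEffect x - M.tauStar) ^ 2)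
      (memLp_condEffect_sub hμ).integrable_sq.aestronglyMeasurable]
  rw [← ofReal_integral_eq_lintegral_ofReal (memLp_influence hμ hn).integrable_sq
    (Filter.Eventually.of_forall fun _ => sq_nonneg _), hreal,
    ENNReal.ofReal_add (integral_nonneg fun _ => sq_nonneg _)
      (integral_nonneg fun _ => sq_nonneg _),
    ofReal_integral_eq_lintegral_ofReal (memLp_condEffect_sub hμ).integrable_sq
      (Filter.Eventually.of_forall fun _ => sq_nonneg _),
    ofReal_integral_eq_lintegral_ofReal hn.integrable_sq
      (Filter.Eventually.of_forall fun _ => sq_nonneg _)]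
  refine add_le_add (le_of_eq ?_) M.lintegral_noise_sq_le
  rw [evariance_eq_lintegral_ofReal]
  change _ = ∫⁻ x, ENNReal.ofReal ((M.condEffect x - ∫ x, M.condEffect x ∂M.ξ) ^ 2) ∂M.ξ
  rw [integral_condEffect hμ]

/-- The error of the auxiliary function when `μ⋆` is replaced by `h`. -/
theorem memLp_aux_sub {h : 𝕏 × 𝔸 → ℝ} (hh : Measurable h)
    (hμ : MemLp (fun p => M.ratio p * M.muStar p) 2 M.pairLaw)
    (hL : MemLp (fun p => M.ratio p * h p) 2 M.pairLaw) :
    MemLp (fun p => M.aux M.muStar p - M.aux h p) 2 M.pairLaw ∧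
    (∀ F : 𝕏 → ℝ, MemLp F 2 M.ξ →
      ∫ p, (M.aux M.muStar p - M.aux h p) * F p.1 ∂M.pairLaw = 0) ∧
    ∫⁻ p, ENNReal.ofReal ((M.aux M.muStar p - M.aux h p) ^ 2) ∂M.pairLaw ≤
      M.wNormSq (M.muStar - h) := by
  have hae := M.aux_sub_aux_ae hμ hL
  have hum : Measurable fun p => M.ratio p * (M.muStar p - h p) :=
    M.measurable_ratio.mul (M.measurable_muStar.sub hh)
  have hu : MemLp (fun p => M.ratio p * (M.muStar p - h p)) 2 M.pairLaw := by
    simp_rw [mul_sub]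
    exact hμ.sub hL
  have hw : M.wNormSq (M.muStar - h) =
      ∫⁻ p, ENNReal.ofReal ((M.ratio p * (M.muStar p - h p)) ^ 2) ∂M.pairLaw :=
    M.wNormSq_eq (M.measurable_muStar.sub hh)
  rw [hw]
  rw [pairLaw_eq] at hae hu ⊢
  have hR := memLp_sub_condMean hum hu
  have hV : MemLp (fun p => M.aux M.muStar p - M.aux h p) 2 (M.ξ ⊗ₘ M.actionKernel) :=
    (memLp_congr_ae hae).2 hR
  refine ⟨hV, fun F hF => ?_, ?_⟩
  · rw [← integral_sub_condMean_mul hum hu hF]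
    refine integral_congr_ae ?_
    filter_upwards [hae] with p hp
    rw [hp]
  · rw [← ofReal_integral_eq_lintegral_ofReal hV.integrable_sq
      (Filter.Eventually.of_forall fun _ => sq_nonneg _),
      ← ofReal_integral_eq_lintegral_ofReal hu.integrable_sq
      (Filter.Eventually.of_forall fun _ => sq_nonneg _)]
    apply ENNReal.ofReal_le_ofReal
    refine le_trans (le_of_eq ?_) (integral_sub_condMean_sq_le hum hu)
    refine integral_congr_ae ?_
    filter_upwards [hae] with p hp
    rw [hp]

theorem measurable_aux_uncurry {B : Type*} [MeasurableSpace B] {μhat : B → 𝕏 × 𝔸 → ℝ}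
    (hm : Measurable fun q : B × (𝕏 × 𝔸) => μhat q.1 q.2) :
    Measurable fun q : B × (𝕏 × 𝔸) => M.aux (μhat q.1) q.2 := by
  have hr := M.measurable_ratio
  have hg := M.measurable_g
  have hf : Measurable fun r : (B × (𝕏 × 𝔸)) × 𝔸 =>
      M.g (r.1.2.1, r.2) * μhat r.1.1 (r.1.2.1, r.2) :=
    (hg.comp (by fun_prop : Measurable fun r : (B × (𝕏 × 𝔸)) × 𝔸 => (r.1.2.1, r.2))).mul
      (hm.comp (by fun_prop : Measurable fun r : (B × (𝕏 × 𝔸)) × 𝔸 =>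
        (r.1.1, (r.1.2.1, r.2))))
  have hI := (StronglyMeasurable.integral_prod_right' (ν := M.lam) hf.stronglyMeasurable).measurable
  exact ((hr.comp measurable_snd).mul hm).sub hI

theorem measurable_aux {h : 𝕏 × 𝔸 → ℝ} (hh : Measurable h) : Measurable (M.aux h) :=
  (measurable_aux_uncurry (B := Unit) (μhat := fun _ => h) (M := M)
    (hh.comp measurable_snd)).comp (measurable_prodMk_left (x := ()))

variable {m : ℕ}

/-- The correction terms of the cross-fitted estimator are centred. -/
theorem isCentredCorrection {μhat : (Fin m → (𝕏 × 𝔸) × ℝ) → 𝕏 × 𝔸 → ℝ}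
    (hm : Measurable fun q : (Fin m → (𝕏 × 𝔸) × ℝ) × (𝕏 × 𝔸) => μhat q.1 q.2)
    (hμ : MemLp (fun p => M.ratio p * M.muStar p) 2 M.pairLaw)
    (hn : MemLp M.noise 2 M.dataLaw)
    (hL : ∀ D, MemLp (fun p => M.ratio p * μhat D p) 2 M.pairLaw)
    (hfin : ∫⁻ D, M.wNormSq (M.muStar - μhat D) ∂(M.sampleLaw m) < ⊤) :
    IsCentredCorrection M.dataLaw M.influence
      (fun (D : Fin m → (𝕏 × 𝔸) × ℝ) z => M.aux M.muStar z.1 - M.aux (μhat D) z.1) ∧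
    ∫⁻ D : Fin m → (𝕏 × 𝔸) × ℝ, ∫⁻ z, ENNReal.ofReal
      ((M.aux M.muStar z.1 - M.aux (μhat D) z.1) ^ 2) ∂M.dataLaw
        ∂(Measure.pi fun _ => M.dataLaw) ≤
      ∫⁻ D, M.wNormSq (M.muStar - μhat D) ∂(M.sampleLaw m) := by
  have hmD : ∀ D, Measurable (μhat D) := fun D => hm.comp measurable_prodMk_left
  have haux := fun D => memLp_aux_sub (hmD D) hμ (hL D)
  have hauxm := measurable_aux (M := M) M.measurable_muStar
  have hle : ∫⁻ D : Fin m → (𝕏 × 𝔸) × ℝ, ∫⁻ z, ENNReal.ofReal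
      ((M.aux M.muStar z.1 - M.aux (μhat D) z.1) ^ 2) ∂M.dataLaw
        ∂(Measure.pi fun _ => M.dataLaw) ≤
      ∫⁻ D, M.wNormSq (M.muStar - μhat D) ∂(M.sampleLaw m) := by
    refine lintegral_mono fun D => ?_
    refine le_trans (le_of_eq ?_) (haux D).2.2
    exact M.measurePreserving_fst_dataLaw.lintegral_comp
      (f := fun p => ENNReal.ofReal ((M.aux M.muStar p - M.aux (μhat D) p) ^ 2))
      ((hauxm.sub (measurable_aux (hmD D))).pow_const 2).ennreal_ofReal
  refine ⟨⟨?_, fun D => ?_, fun D => ?_, fun D => ?_, hle.trans_lt hfin⟩, hle⟩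
  · exact (hauxm.comp (measurable_fst.comp measurable_snd)).sub
      ((measurable_aux_uncurry hm).comp
        (measurable_fst.prodMk (measurable_fst.comp measurable_snd)))
  · exact (haux D).1.comp_measurePreserving M.measurePreserving_fst_dataLaw
  · rw [integral_comp_fst_dataLaw (F := fun p => M.aux M.muStar p - M.aux (μhat D) p)
      (haux D).1.aestronglyMeasurable]
    simpa using (haux D).2.1 (fun _ => 1) (memLp_const 1)
  · have hV' : MemLp (fun z : (𝕏 × 𝔸) × ℝ => M.aux M.muStar z.1 - M.aux (μhat D) z.1) 2
        M.dataLaw := (haux D).1.comp_measurePreserving M.measurePreserving_fst_dataLaw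
    have hc := memLp_condEffect_sub_fst hμ
    have hc' : MemLp (fun z : (𝕏 × 𝔸) × ℝ => M.condEffect z.1.1 - M.tauStar) 2 M.dataLaw :=
      hc.comp_measurePreserving M.measurePreserving_fst_dataLaw
    have i1 : Integrable (fun z => M.noise z * (M.aux M.muStar z.1 - M.aux (μhat D) z.1))
      M.dataLaw := hn.integrable_mul hV'
    have i2 : Integrable (fun z => (M.aux M.muStar z.1 - M.aux (μhat D) z.1) *
      (M.condEffect z.1.1 - M.tauStar)) M.dataLaw := hV'.integrable_mul hc'
    -- The noise is orthogonal to every square-integrable function of `(X, A)`, and the correction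
    -- to every such function of `X`.
    have hexp : ∀ z, (M.aux M.muStar z.1 - M.aux (μhat D) z.1) * M.influence z =
        M.noise z * (M.aux M.muStar z.1 - M.aux (μhat D) z.1) +
        (M.aux M.muStar z.1 - M.aux (μhat D) z.1) * (M.condEffect z.1.1 - M.tauStar) := by
      intro z
      rw [influence_eq]; ring
    simp_rw [hexp]
    rw [integral_add i1 i2, M.integral_noise_mul hn (haux D).1,
      integral_comp_fst_dataLaw (F := fun p => (M.aux M.muStar p - M.aux (μhat D) p) *
        (M.condEffect p.1 - M.tauStar)) ((haux D).1.integrable_mul hc).aestronglyMeasurable,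
      (haux D).2.1 _ (memLp_condEffect_sub hμ), add_zero]

/-- Adding and subtracting the oracle correction `aux muStar` in each summand puts the error in the
form of `lintegral_crossFit_le`. -/
theorem tauHat_append_sub (hm : 1 ≤ m) (μhat₁ μhat₂ : (Fin m → (𝕏 × 𝔸) × ℝ) → 𝕏 × 𝔸 → ℝ)
    (B₁ B₂ : Fin m → (𝕏 × 𝔸) × ℝ) :
    M.tauHat μhat₁ μhat₂ (Fin.append B₁ B₂) - M.tauStar = (1 / (m + m : ℕ) : ℝ) *
      (∑ i, (M.influence (B₁ i) + (M.aux M.muStar (B₁ i).1 - M.aux (μhat₂ B₂) (B₁ i).1)) +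
        ∑ i, (M.influence (B₂ i) + (M.aux M.muStar (B₂ i).1 - M.aux (μhat₁ B₁) (B₂ i).1))) := by
  have hm0 : (0 : ℝ) < m := by exact_mod_cast hm
  unfold tauHat
  simp only [Fin.append_left, Fin.append_right]
  have h : ∀ (h : 𝕏 × 𝔸 → ℝ) (z : (𝕏 × 𝔸) × ℝ), M.influence z + (M.aux M.muStar z.1 - M.aux h z.1)
      = (M.ratio z.1 * z.2 - M.aux h z.1) - M.tauStar := fun h z => by
    unfold influence; ring
  simp_rw [h]
  rw [Finset.sum_sub_distrib _ (fun _ : Fin m => M.tauStar),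
    Finset.sum_sub_distrib _ (fun _ : Fin m => M.tauStar), Finset.sum_const, Finset.card_univ,
    Fintype.card_fin, nsmul_eq_mul]
  push_cast
  field_simp
  ring

theorem measurable_tauHat {μhat₁ μhat₂ : (Fin m → (𝕏 × 𝔸) × ℝ) → 𝕏 × 𝔸 → ℝ}
    (hm₁ : Measurable fun q : (Fin m → (𝕏 × 𝔸) × ℝ) × (𝕏 × 𝔸) => μhat₁ q.1 q.2)
    (hm₂ : Measurable fun q : (Fin m → (𝕏 × 𝔸) × ℝ) × (𝕏 × 𝔸) => μhat₂ q.1 q.2) :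
    Measurable (M.tauHat μhat₁ μhat₂) := by
  have hr := M.measurable_ratio
  have h₁ := measurable_aux_uncurry (M := M) hm₁
  have h₂ := measurable_aux_uncurry (M := M) hm₂
  have hB₁ : Measurable fun (D : Fin (m + m) → (𝕏 × 𝔸) × ℝ) (i : Fin m) => D (Fin.castAdd m i) := by
    fun_prop
  have hB₂ : Measurable fun (D : Fin (m + m) → (𝕏 × 𝔸) × ℝ) (i : Fin m) => D (Fin.natAdd m i) := by
    fun_prop
  refine ((Finset.measurable_fun_sum _ fun i _ => Measurable.sub (by fun_prop) ?_).const_mul _).add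
    ((Finset.measurable_fun_sum _ fun i _ => Measurable.sub (by fun_prop) ?_).const_mul _)
  · exact h₂.comp (hB₂.prodMk (by fun_prop))
  · exact h₁.comp (hB₁.prodMk (by fun_prop))

/-- The mean-squared error of the cross-fitted estimator is at most the efficient variance plus
the errors of the two regression estimators. -/
theorem mse_le (hm : 1 ≤ m) {μhat₁ μhat₂ : (Fin m → (𝕏 × 𝔸) × ℝ) → 𝕏 × 𝔸 → ℝ}
    (hm₁ : Measurable fun q : (Fin m → (𝕏 × 𝔸) × ℝ) × (𝕏 × 𝔸) => μhat₁ q.1 q.2)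
    (hm₂ : Measurable fun q : (Fin m → (𝕏 × 𝔸) × ℝ) × (𝕏 × 𝔸) => μhat₂ q.1 q.2)
    (hμ : MemLp (fun p => M.ratio p * M.muStar p) 2 M.pairLaw)
    (hn : MemLp M.noise 2 M.dataLaw)
    (hL₁ : ∀ D, MemLp (fun p => M.ratio p * μhat₁ D p) 2 M.pairLaw)
    (hL₂ : ∀ D, MemLp (fun p => M.ratio p * μhat₂ D p) 2 M.pairLaw)
    (hfin₁ : ∫⁻ D, M.wNormSq (M.muStar - μhat₁ D) ∂(M.sampleLaw m) < ⊤)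
    (hfin₂ : ∫⁻ D, M.wNormSq (M.muStar - μhat₂ D) ∂(M.sampleLaw m) < ⊤) :
    M.mse μhat₁ μhat₂ ≤ (M.vStarSq + ∫⁻ D, M.wNormSq (M.muStar - μhat₁ D) ∂(M.sampleLaw m) +
      ∫⁻ D, M.wNormSq (M.muStar - μhat₂ D) ∂(M.sampleLaw m)) / ((m + m : ℕ) : ℝ≥0∞) := by
  obtain ⟨hV₁, hb₁⟩ := isCentredCorrection hm₁ hμ hn hL₁ hfin₁
  obtain ⟨hV₂, hb₂⟩ := isCentredCorrection hm₂ hμ hn hL₂ hfin₂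
  have hmse : M.mse μhat₁ μhat₂ = ENNReal.ofReal ((1 / (m + m : ℕ) : ℝ) ^ 2) *
      ∫⁻ q : (Fin m → (𝕏 × 𝔸) × ℝ) × (Fin m → (𝕏 × 𝔸) × ℝ), ENNReal.ofReal
      ((∑ i, (M.influence (q.1 i) +
          (M.aux M.muStar (q.1 i).1 - M.aux (μhat₂ q.2) (q.1 i).1)) +
        ∑ i, (M.influence (q.2 i) +
          (M.aux M.muStar (q.2 i).1 - M.aux (μhat₁ q.1) (q.2 i).1))) ^ 2)
        ∂((Measure.pi fun _ => M.dataLaw).prod (Measure.pi fun _ => M.dataLaw)) := by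
    unfold mse sampleLaw
    rw [← (measurePreserving_append M.dataLaw m).lintegral_comp
      (((measurable_tauHat hm₁ hm₂).sub_const _).pow_const 2).ennreal_ofReal]
    rw [← lintegral_const_mul' _ _ ENNReal.ofReal_ne_top]
    refine lintegral_congr fun q => ?_
    rw [tauHat_append_sub hm, mul_pow, ENNReal.ofReal_mul (sq_nonneg _)]
  have hcross := lintegral_crossFit_le (memLp_influence hμ hn) (integral_influence hμ hn) hV₁ hV₂
  rw [hmse, ENNReal.div_eq_inv_mul]
  refine (mul_le_mul_right (hcross.trans (mul_le_mul_right (add_le_add (add_le_add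
    (lintegral_influence_sq_le hμ hn) hb₁) hb₂) _)) _).trans_eq ?_
  rw [← mul_assoc]
  congr 1
  have hm0 : ((m + m : ℕ) : ℝ≥0∞) ≠ 0 := by
    simp only [ne_eq, Nat.cast_eq_zero]; omega
  have hmR : (0 : ℝ) < ((m + m : ℕ) : ℝ) := by
    have : 0 < m + m := by omega
    exact_mod_cast this
  rw [one_div, inv_pow, ENNReal.ofReal_inv_of_pos (by positivity), ENNReal.ofReal_pow hmR.le,
    ENNReal.ofReal_natCast, sq, ENNReal.mul_inv (Or.inl hm0) (Or.inr hm0), mul_assoc,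
    ← Nat.cast_add, ENNReal.inv_mul_cancel hm0 (ENNReal.natCast_ne_top _), mul_one]

end Model

/-! ### Reduction of weighted least squares to the unweighted problem. -/

namespace Model

variable {𝕏 𝔸 : Type*} [MeasurableSpace 𝕏] [MeasurableSpace 𝔸] {M : Model 𝕏 𝔸} {d : ℕ}
  {φ : Fin d → 𝕏 × 𝔸 → ℝ}

variable (M φ) in
/-- The weighted features, as functions of one observation. -/
def feature (j : Fin d) (z : (𝕏 × 𝔸) × ℝ) : ℝ := M.ratio z.1 * φ j z.1

theorem linFun_feature (δ : Fin d → ℝ) (z : (𝕏 × 𝔸) × ℝ) :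
    linFun (M.feature φ) δ z = M.ratio z.1 * linFun φ δ z.1 := by
  simp only [linFun, feature, Finset.mul_sum]
  exact Finset.sum_congr rfl fun j _ => by ring

theorem measurable_feature (hφ : ∀ j, Measurable (φ j)) (j : Fin d) :
    Measurable (M.feature φ j) := by
  have h1 := M.measurable_ratio
  have h2 := hφ j
  unfold feature; fun_prop

theorem FeatureMoments.subGaussianMoments {ν : ℝ} (hφ : ∀ j, Measurable (φ j))
    (h : M.FeatureMoments φ ν) (j : Fin d) : SubGaussianMoments M.dataLaw (M.feature φ j) ν := by
  intro l hl
  have hm : Measurable fun p => ENNReal.ofReal (|M.ratio p * φ j p| ^ l) := by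
    have h1 := M.measurable_ratio
    have h2 := hφ j
    fun_prop
  exact (M.measurePreserving_fst_dataLaw.lintegral_comp hm).trans_le (h j l hl)

theorem FeatureMoments.subGaussianMoments_pairLaw {ν : ℝ} (h : M.FeatureMoments φ ν) (j : Fin d) :
    SubGaussianMoments M.pairLaw (fun p => M.ratio p * φ j p) ν := h j

theorem FeatureMoments.memLp {ν : ℝ} (hφ : ∀ j, Measurable (φ j)) (h : M.FeatureMoments φ ν)
    (j : Fin d) : MemLp (fun p => M.ratio p * φ j p) 2 M.pairLaw :=
  (h.subGaussianMoments_pairLaw j).memLp (M.measurable_ratio.mul (hφ j))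

theorem FeatureMoments.memLp_linFun {ν : ℝ} (hφ : ∀ j, Measurable (φ j))
    (h : M.FeatureMoments φ ν) (δ : Fin d → ℝ) :
    MemLp (fun p => M.ratio p * linFun φ δ p) 2 M.pairLaw := by
  refine (OffPolicy.memLp_linFun (h.memLp hφ) δ).ae_eq (Filter.Eventually.of_forall fun p => ?_)
  simp only [linFun, Finset.mul_sum]
  exact Finset.sum_congr rfl fun j _ => by ring

theorem wNormSq_linFun {ν : ℝ} (hφ : ∀ j, Measurable (φ j)) (h : M.FeatureMoments φ ν)
    (δ : Fin d → ℝ) :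
    M.wNormSq (linFun φ δ) = ENNReal.ofReal (popSq M.dataLaw (M.feature φ) δ) := by
  have hL := h.memLp_linFun hφ δ
  rw [M.wNormSq_eq (measurable_linFun hφ δ), popSq]
  simp_rw [linFun_feature]
  rw [integral_comp_fst_dataLaw (F := fun p => (M.ratio p * linFun φ δ p) ^ 2)
    hL.integrable_sq.aestronglyMeasurable, ofReal_integral_eq_lintegral_ofReal hL.integrable_sq
    (Filter.Eventually.of_forall fun _ => sq_nonneg _)]

theorem wNorm_linFun {ν : ℝ} (hφ : ∀ j, Measurable (φ j)) (h : M.FeatureMoments φ ν)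
    (δ : Fin d → ℝ) :
    M.wNorm (linFun φ δ) = ENNReal.ofReal √(popSq M.dataLaw (M.feature φ) δ) := by
  rw [wNorm, wNormSq_linFun hφ h, ENNReal.ofReal_rpow_of_nonneg (popSq_nonneg _ _) (by norm_num),
    Real.sqrt_eq_rpow]

open Matrix in
theorem popSq_feature_eq {ν : ℝ} (hφ : ∀ j, Measurable (φ j)) (h : M.FeatureMoments φ ν)
    (δ : Fin d → ℝ) :
    popSq M.dataLaw (M.feature φ) δ = δ ⬝ᵥ M.momentMatrix φ *ᵥ δ := by
  have hL := h.memLp_linFun hφ δ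
  rw [popSq]
  simp_rw [linFun_feature]
  rw [integral_comp_fst_dataLaw (F := fun p => (M.ratio p * linFun φ δ p) ^ 2)
    hL.integrable_sq.aestronglyMeasurable]
  have hI : ∀ i j, Integrable (fun p => δ i * (M.ratio p ^ 2 * (φ i p * φ j p) * δ j)) M.pairLaw := by
    intro i j
    refine (Integrable.mul_const ?_ _).const_mul _
    refine ((h.memLp hφ i).integrable_mul (h.memLp hφ j)).congr
      (Filter.Eventually.of_forall fun p => ?_)
    simp only [Pi.mul_apply]
    ring
  have hexp : ∀ p, (M.ratio p * linFun φ δ p) ^ 2 =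
      ∑ i, ∑ j, δ i * (M.ratio p ^ 2 * (φ i p * φ j p) * δ j) := by
    intro p
    rw [mul_pow, sq (linFun φ δ p), linFun, Finset.sum_mul_sum, Finset.mul_sum]
    refine Finset.sum_congr rfl fun i _ => ?_
    rw [Finset.mul_sum]
    exact Finset.sum_congr rfl fun j _ => by ring
  simp_rw [hexp]
  rw [integral_finsetSum _ fun i _ => integrable_finsetSum _ fun j _ => hI i j]
  simp only [dotProduct, mulVec, Finset.mul_sum]
  refine Finset.sum_congr rfl fun i _ => ?_
  rw [integral_finsetSum _ fun j _ => hI i j]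
  refine Finset.sum_congr rfl fun j _ => ?_
  rw [integral_const_mul, integral_mul_const]
  rfl

theorem lamMin_mul_le_popSq {ν : ℝ} (hφ : ∀ j, Measurable (φ j)) (h : M.FeatureMoments φ ν)
    (δ : Fin d → ℝ) :
    M.lamMin φ * ∑ j, δ j ^ 2 ≤ popSq M.dataLaw (M.feature φ) δ := by
  obtain ⟨w, hw, hq⟩ := dotProduct_mulVec_eq_sum_eigenvalues (M.momentMatrix_isHermitian φ) δ
  rw [popSq_feature_eq hφ h, hq, ← hw, Finset.mul_sum]
  exact Finset.sum_le_sum fun i _ => mul_le_mul_of_nonneg_right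
    (ciInf_le (Set.finite_range _).bddBelow i) (sq_nonneg _)

theorem popSq_le_lamMax_mul {ν : ℝ} (hφ : ∀ j, Measurable (φ j)) (h : M.FeatureMoments φ ν)
    (δ : Fin d → ℝ) :
    popSq M.dataLaw (M.feature φ) δ ≤ M.lamMax φ * ∑ j, δ j ^ 2 := by
  obtain ⟨w, hw, hq⟩ := dotProduct_mulVec_eq_sum_eigenvalues (M.momentMatrix_isHermitian φ) δ
  rw [popSq_feature_eq hφ h, hq, ← hw, Finset.mul_sum]
  exact Finset.sum_le_sum fun i _ => mul_le_mul_of_nonneg_right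
    (le_ciSup (Set.finite_range _).bddAbove i) (sq_nonneg _)

theorem l1_smul (c : ℝ) (δ : Fin d → ℝ) : l1 (c • δ) = |c| * l1 δ := by
  simp [l1, abs_mul, Finset.mul_sum]

theorem linFun_zero {S : Type*} (ψ : Fin d → S → ℝ) : linFun ψ 0 = 0 := by
  ext z
  simp [linFun]

/-- The small-ball condition over the differences of the class extends to all directions. -/
theorem SmallBall.forall_direction {ν α₁ α₂ R : ℝ} (hα₁ : 0 < α₁) (hR : 0 < R)
    (hφ : ∀ j, Measurable (φ j)) (h : M.FeatureMoments φ ν)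
    (hS : M.SmallBall (l1Class φ R) α₁ α₂) (δ : Fin d → ℝ) :
    ENNReal.ofReal α₂ ≤ M.dataLaw {z | α₁ * √(popSq M.dataLaw (M.feature φ) δ) ≤
      |linFun (M.feature φ) δ z|} := by
  have hl := l1_nonneg δ
  -- Both sides of the event are homogeneous in `δ`, so `δ` may be shrunk into the ball and compared
  -- with the zero function. The `+ 1` covers `δ = 0`.
  set t := R / (l1 δ + 1) with ht
  have ht0 : 0 < t := by positivity
  have htδ : l1 (t • δ) ≤ R := by
    rw [l1_smul, abs_of_pos ht0, ht, div_mul_eq_mul_div, div_le_iff₀ (by positivity)]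
    nlinarith
  have h1 := hS _ ⟨t • δ, htδ, rfl⟩ _ ⟨0, by simp [l1, hR.le], rfl⟩
  rw [linFun_zero, sub_zero, wNorm_linFun hφ h, popSq_smul] at h1
  refine h1.trans_eq ?_
  have hm : MeasurableSet {p | α₁ * √(popSq M.dataLaw (M.feature φ) δ) ≤
      |M.ratio p * linFun φ δ p|} :=
    measurableSet_le measurable_const (M.measurable_ratio.mul (measurable_linFun hφ δ)).abs
  have h2 := M.measurePreserving_fst_dataLaw.measure_preimage hm.nullMeasurableSet
  have h3 : {z : (𝕏 × 𝔸) × ℝ | α₁ * √(popSq M.dataLaw (M.feature φ) δ) ≤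
      |linFun (M.feature φ) δ z|} = Prod.fst ⁻¹' {p | α₁ * √(popSq M.dataLaw (M.feature φ) δ) ≤
      |M.ratio p * linFun φ δ p|} := by
    ext z
    simp [linFun_feature]
  rw [h3, h2]
  congr 1
  ext p
  simp only [Set.mem_ofPred_eq]
  rw [← ENNReal.ofReal_mul hα₁.le, ENNReal.ofReal_le_ofReal_iff (abs_nonneg _),
    Real.sqrt_mul (sq_nonneg t), Real.sqrt_sq ht0.le, linFun_smul,
    show M.ratio p * (t * linFun φ δ p) = t * (M.ratio p * linFun φ δ p) by ring,
    abs_mul, abs_of_pos ht0,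
    show α₁ * (t * √(popSq M.dataLaw (M.feature φ) δ)) =
      t * (α₁ * √(popSq M.dataLaw (M.feature φ) δ)) by ring]
  exact mul_le_mul_iff_right₀ ht0

theorem wNormSq_sub_le {ν : ℝ} (hφ : ∀ j, Measurable (φ j)) (h : M.FeatureMoments φ ν)
    (θ δ : Fin d → ℝ) :
    M.wNormSq (M.muStar - linFun φ (θ + δ)) ≤ 2 * M.wNormSq (M.muStar - linFun φ θ) +
      2 * ENNReal.ofReal (popSq M.dataLaw (M.feature φ) δ) := by
  have hmθ := measurable_linFun hφ θ
  have hmδ := measurable_linFun hφ δ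
  have hr := M.measurable_ratio
  have hmu := M.measurable_muStar
  rw [← wNormSq_linFun hφ h, M.wNormSq_eq (hmu.sub (measurable_linFun hφ _)),
    M.wNormSq_eq (hmu.sub hmθ), M.wNormSq_eq hmδ, ← lintegral_const_mul 2 (by fun_prop),
    ← lintegral_const_mul 2 (by fun_prop), ← lintegral_add_left (by fun_prop)]
  refine lintegral_mono fun p => ?_
  have h2 : (2 : ℝ≥0∞) = ENNReal.ofReal 2 := by simp
  rw [h2, ← ENNReal.ofReal_mul two_pos.le, ← ENNReal.ofReal_mul two_pos.le,
    ← ENNReal.ofReal_add (by positivity) (by positivity)]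
  apply ENNReal.ofReal_le_ofReal
  simp only [Pi.sub_apply, linFun_add]
  nlinarith [sq_nonneg (M.ratio p * (M.muStar p - linFun φ θ p) + M.ratio p * linFun φ δ p)]

/-- The oracle inequality for the weighted least-squares estimator. -/
theorem IsWLSEstimator.lintegral_wNormSq_le {α₁ α₂ R sbar ν : ℝ} {k m : ℕ}
    {μhat : (Fin m → (𝕏 × 𝔸) × ℝ) → 𝕏 × 𝔸 → ℝ} (hα₁ : 0 < α₁) (hα₂ : 0 < α₂) (hd : 2 ≤ d)
    (hφ : ∀ j, Measurable (φ j)) (hR : 0 < R) (hs : 0 < sbar) (hν : 0 < ν)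
    (hlam : 0 < M.lamMin φ) (hS : M.SmallBall (l1Class φ R) α₁ α₂)
    (hN : M.NoiseMoments sbar) (hF : M.FeatureMoments φ ν) (hk : 1 ≤ k) (hm : 1 ≤ m)
    (hsize : sampleConst α₁ α₂ * (ν ^ 2 * k * Real.log d / M.lamMin φ + Real.log d ^ 2 +
      Real.log (R * M.lamMax φ / (sbar * ν))) ≤ ((m + m : ℕ) : ℝ))
    (hμ : M.IsWLSEstimator (l1Class φ R) m μhat) {θ : Fin d → ℝ} (hθ : l1 θ = R)
    (hθk : l0 θ ≤ k) :
    ∫⁻ D, M.wNormSq (M.muStar - μhat D) ∂(M.sampleLaw m) ≤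
      ENNReal.ofReal (2 + 2 * oracleConst α₁ α₂) * (M.wNormSq (M.muStar - linFun φ θ) +
        ENNReal.ofReal (sbar ^ 2 * l0 θ * Real.log d / ((m + m : ℕ) : ℝ) *
          (ν ^ 2 / M.lamMin φ))) := by
  -- The coefficients are chosen with no measurability in `D`. They enter only through lower
  -- integrals, bounded by monotonicity and scaled by finite constants.
  choose ϑ hϑ hμϑ using hμ.mem
  have hm0 : (0 : ℝ) < m := by exact_mod_cast hm
  have hnoise := M.measurable_noise
  have hψ := measurable_feature (M := M) hφ
  have hbm : Measurable fun p => M.ratio p * (M.muStar p - linFun φ θ p) :=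
    M.measurable_ratio.mul (M.measurable_muStar.sub (measurable_linFun hφ θ))
  have hnL : MemLp M.noise 2 M.dataLaw := hN.subGaussianMoments.memLp hnoise
  have hκ : 0 ≤ oracleConst α₁ α₂ := by
    have := epsSq_pos hα₁ hα₂
    unfold oracleConst sampleConst sizeConst kappa; positivity
  -- The residual `ratio * (μhat - Y)` equals the linear form in `ϑ D - θ` minus the weighted noise
  -- and the weighted bias of `θ`, so minimality against `θ` is the basic inequality.
  have hmin : ∀ D : Fin m → (𝕏 × 𝔸) × ℝ,
      ∑ i, (linFun (M.feature φ) (ϑ D - θ) (D i) -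
        (M.noise (D i) + M.ratio (D i).1 * (M.muStar (D i).1 - linFun φ θ (D i).1))) ^ 2 ≤
      ∑ i, (M.noise (D i) + M.ratio (D i).1 * (M.muStar (D i).1 - linFun φ θ (D i).1)) ^ 2 := by
    intro D
    have h1 := hμ.minimizes D _ ⟨θ, hθ.le, rfl⟩
    unfold wlsLoss at h1
    have h2 := le_of_mul_le_mul_left h1 (by positivity)
    rw [hμϑ D] at h2
    refine (le_of_eq ?_).trans (h2.trans (le_of_eq ?_))
    · refine Finset.sum_congr rfl fun i _ => ?_
      rw [linFun_feature, linFun_sub, noise, ← mul_pow]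
      ring
    · refine Finset.sum_congr rfl fun i _ => ?_
      rw [noise, ← mul_pow]
      ring
  have horacle := lintegral_popSq_le (P := M.dataLaw) hd hm hk hψ hnoise
    (hbm.comp measurable_fst) hs hν hα₁ hα₂ hlam hR (hF.subGaussianMoments hφ)
    hN.subGaussianMoments (fun j => M.integral_noise_mul hnL (hF.memLp hφ j))
    (lamMin_mul_le_popSq hφ hF) (popSq_le_lamMax_mul hφ hF)
    (hS.forall_direction hα₁ hR hφ hF) hsize hθ hθk (δ := fun D => ϑ D - θ)
    (fun D => by rw [add_sub_cancel]; exact hϑ D) hmin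
  have hb : ∫⁻ z, ENNReal.ofReal (((fun p => M.ratio p * (M.muStar p - linFun φ θ p)) ∘
      Prod.fst) z ^ 2) ∂M.dataLaw = M.wNormSq (M.muStar - linFun φ θ) := by
    rw [M.wNormSq_eq (M.measurable_muStar.sub (measurable_linFun hφ θ))]
    exact M.measurePreserving_fst_dataLaw.lintegral_comp (hbm.pow_const 2).ennreal_ofReal
  rw [hb] at horacle
  set E := M.wNormSq (M.muStar - linFun φ θ) with hE
  set r := ENNReal.ofReal (sbar ^ 2 * l0 θ * Real.log d / ((m + m : ℕ) : ℝ) *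
    (ν ^ 2 / M.lamMin φ)) with hr
  calc ∫⁻ D, M.wNormSq (M.muStar - μhat D) ∂(M.sampleLaw m)
      ≤ ∫⁻ D, (2 * E + 2 * ENNReal.ofReal (popSq M.dataLaw (M.feature φ) (ϑ D - θ)))
          ∂(M.sampleLaw m) := by
        refine lintegral_mono fun D => ?_
        have := wNormSq_sub_le hφ hF θ (ϑ D - θ)
        rwa [add_sub_cancel, ← hμϑ D] at this
    _ = 2 * E + 2 * ∫⁻ D, ENNReal.ofReal (popSq M.dataLaw (M.feature φ) (ϑ D - θ))
          ∂(M.sampleLaw m) := by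
        rw [lintegral_add_left measurable_const, lintegral_const,
          lintegral_const_mul' _ _ ENNReal.ofNat_ne_top]
        simp [sampleLaw]
    _ ≤ 2 * E + 2 * (ENNReal.ofReal (oracleConst α₁ α₂) * (E + r)) := by
        gcongr
        exact horacle
    _ ≤ 2 * (E + r) + 2 * (ENNReal.ofReal (oracleConst α₁ α₂) * (E + r)) := by
        gcongr
        exact le_self_add
    _ = _ := by
        rw [ENNReal.ofReal_add two_pos.le (by positivity), ENNReal.ofReal_mul two_pos.le,
          ENNReal.ofReal_ofNat]
        ring

end Model

end OffPolicy

end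

/-! ### Assembly. -/

theorem mainTheorem7 (α₁ α₂ : ℝ) (hα₁ : 0 < α₁) (hα₂ : 0 < α₂) :
    ∃ c₀ c : ℝ, 0 < c₀ ∧ 0 < c ∧
      ∀ (𝕏 𝔸 : Type*) [MeasurableSpace 𝕏] [MeasurableSpace 𝔸] (M : OffPolicy.Model 𝕏 𝔸)
        (d : ℕ) (φ : Fin d → 𝕏 × 𝔸 → ℝ) (R₁ sbar ν : ℝ) (k m : ℕ)
        (μhat₁ μhat₂ : (Fin m → (𝕏 × 𝔸) × ℝ) → 𝕏 × 𝔸 → ℝ),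
        2 ≤ d → (∀ j, Measurable (φ j)) → 0 < R₁ → 0 < sbar → 0 < ν →
        0 < M.lamMin φ →
        M.SmallBall (OffPolicy.l1Class φ R₁) α₁ α₂ →
        M.NoiseMoments sbar → M.FeatureMoments φ ν →
        1 ≤ k → k ≤ d → 1 ≤ m →
        c₀ * (ν ^ 2 * k * Real.log d / M.lamMin φ + Real.log d ^ 2 +
          Real.log (R₁ * M.lamMax φ / (sbar * ν))) ≤ ((m + m : ℕ) : ℝ) →
        M.IsWLSEstimator (OffPolicy.l1Class φ R₁) m μhat₁ →
        M.IsWLSEstimator (OffPolicy.l1Class φ R₁) m μhat₂ →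
        M.mse μhat₁ μhat₂ ≤
          M.vStarSq / ((m + m : ℕ) : ℝ≥0∞) +
            ENNReal.ofReal c / ((m + m : ℕ) : ℝ≥0∞) *
              ⨅ θ ∈ {θ : Fin d → ℝ | OffPolicy.l1 θ = R₁ ∧ OffPolicy.l0 θ ≤ k},
                (M.wNormSq (M.muStar - OffPolicy.linFun φ θ) +
                  ENNReal.ofReal (sbar ^ 2 * OffPolicy.l0 θ * Real.log d / ((m + m : ℕ) : ℝ) *
                    (ν ^ 2 / M.lamMin φ))) := by
  have heps := OffPolicy.epsSq_pos hα₁ hα₂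
  have hc₀ : 0 < OffPolicy.sampleConst α₁ α₂ := by
    unfold OffPolicy.sampleConst OffPolicy.sizeConst; positivity
  have hc : 0 < OffPolicy.oracleConst α₁ α₂ := by
    unfold OffPolicy.oracleConst OffPolicy.kappa; positivity
  -- The outer factor two counts the two halves. The inner expression comes from splitting `μ⋆ -
  -- μhat` at `θ`.
  refine ⟨OffPolicy.sampleConst α₁ α₂, 2 * (2 + 2 * OffPolicy.oracleConst α₁ α₂), hc₀,
    by positivity, ?_⟩
  intro 𝕏 𝔸 _ _ M d φ R₁ sbar ν k m μhat₁ μhat₂ hd hφ hR hs hν hlam hS hN hF hk _ hm hsize h₁ h₂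
  set c := 2 + 2 * OffPolicy.oracleConst α₁ α₂ with hcdef
  have hcpos : 0 < c := by positivity
  have hn0 : ((m + m : ℕ) : ℝ≥0∞) ≠ 0 := by
    simp only [ne_eq, Nat.cast_eq_zero]; omega
  have hfac0 : ENNReal.ofReal (2 * c) / ((m + m : ℕ) : ℝ≥0∞) ≠ 0 :=
    ENNReal.div_ne_zero.2 ⟨by simpa using hcpos, ENNReal.natCast_ne_top _⟩
  have hfact : ENNReal.ofReal (2 * c) / ((m + m : ℕ) : ℝ≥0∞) ≠ ⊤ :=
    ENNReal.div_ne_top ENNReal.ofReal_ne_top hn0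
  -- The factor is neither `0` nor `⊤`, so the infimum can be moved outside and each `θ` treated
  -- alone.
  simp only [ENNReal.mul_iInf_of_ne hfac0 hfact, ENNReal.add_iInf]
  refine le_iInf₂ fun θ hθ => ?_
  obtain ⟨hθ₁, hθ₀⟩ := hθ
  rcases eq_top_or_lt_top (M.wNormSq (M.muStar - OffPolicy.linFun φ θ)) with htop | hlt
  · rw [htop, top_add, ENNReal.mul_top hfac0, add_top]
    exact le_top
  set T := M.wNormSq (M.muStar - OffPolicy.linFun φ θ) +
    ENNReal.ofReal (sbar ^ 2 * OffPolicy.l0 θ * Real.log d / ((m + m : ℕ) : ℝ) *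
      (ν ^ 2 / M.lamMin φ)) with hT
  have hTfin : T < ⊤ := ENNReal.add_lt_top.2 ⟨hlt, ENNReal.ofReal_lt_top⟩
  have hb₁ := h₁.lintegral_wNormSq_le hα₁ hα₂ hd hφ hR hs hν hlam hS hN hF hk hm hsize hθ₁ hθ₀
  have hb₂ := h₂.lintegral_wNormSq_le hα₁ hα₂ hd hφ hR hs hν hlam hS hN hF hk hm hsize hθ₁ hθ₀
  have hfin : ENNReal.ofReal c * T < ⊤ := ENNReal.mul_lt_top ENNReal.ofReal_lt_top hTfin
  have hL : ∀ μhat : (Fin m → (𝕏 × 𝔸) × ℝ) → 𝕏 × 𝔸 → ℝ,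
      M.IsWLSEstimator (OffPolicy.l1Class φ R₁) m μhat →
      ∀ D, MemLp (fun p => M.ratio p * μhat D p) 2 M.pairLaw := by
    intro μhat h D
    obtain ⟨ϑ, _, hϑ⟩ := h.mem D
    rw [hϑ]
    exact hF.memLp_linFun hφ ϑ
  -- Square integrability of the weighted `μ⋆` is not assumed; it follows from the finite
  -- approximation error of this `θ`.
  have hμ : MemLp (fun p => M.ratio p * M.muStar p) 2 M.pairLaw := by
    have hd' := M.memLp_pairLaw
      (M.measurable_muStar.sub (OffPolicy.measurable_linFun hφ θ)) hlt
    refine (hd'.add (hF.memLp_linFun hφ θ)).ae_eq (Filter.Eventually.of_forall fun p => ?_)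
    simp only [Pi.add_apply, Pi.sub_apply]
    ring
  have hmse := OffPolicy.Model.mse_le hm h₁.measurable h₂.measurable hμ
    (hN.subGaussianMoments.memLp M.measurable_noise) (hL _ h₁) (hL _ h₂)
    (hb₁.trans_lt hfin) (hb₂.trans_lt hfin)
  refine hmse.trans ?_
  rw [ENNReal.div_add_div_same.symm, ENNReal.div_add_div_same.symm, add_assoc]
  gcongr
  rw [ENNReal.div_add_div_same, ← ENNReal.mul_div_right_comm]
  gcongr
  refine (add_le_add hb₁ hb₂).trans_eq ?_
  rw [ENNReal.ofReal_mul two_pos.le, ENNReal.ofReal_ofNat]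
  ring
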